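/- A line $\ell$ of the hyperbolic plane $H^2$ (curvature $-1$) is a supporting line of a convex body $K$ if it meets $K$ and $K$ lies in one of the closed half-planes bounded by $\ell$. The width of $K$ with respect to a supporting line $\ell$ is the distance of $\ell$ and a supporting line of $K$ most distant from $\ell$; the thickness of $K$ is the minimum of its widths over all supporting lines. An $n$-gon is a convex body that is the convex hull of finitely many points and has exactly $n$ vertices; it is regular if all its sides have equal length and all its angles are equal. For odd $n\ge 3$, a (convex) $n$-gon of thickness $w$ with vertices $v_1,\dots,v_n$ in cyclic order (indices mod $n$) is called ordinary reduced if, for every $i$, the vertex $v_i$ has distance $w$ from the opposite side $\left[v_{i+\frac{n-1}{2}},v_{i+\frac{n+1}{2}}\right]$ and the orthogonal projection of $v_i$ on the line containing this side lies in the relative interior of the side. Theorem. Let $R\subset H^2$ be an ordinary reduced $n$-gon of thickness $w$, and let $\widetilde R$ be a regular $n$-gon of thickness $w$. Then $\widetilde R$ is itself ordinary reduced, and $$\operatorname{area}(R)\le\operatorname{area}(\widetilde R),$$ with equality if and only if $R$ and $\widetilde R$ are congruent. -/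

import Mathlib

open scoped UpperHalfPlane
open MeasureTheory

noncomputable section

namespace HypPlane

/-! The hyperbolic plane is the upper half-plane `ℍ` with its hyperbolic metric `dist`
(curvature `-1`) and its invariant measure `volume`, that is `dx dy / y ^ 2`. -/

/-- The geodesic segment `[x, y]`: all points metrically between `x` and `y`. -/
def segment (x y : ℍ) : Set ℍ := {z | dist x z + dist z y = dist x y}

/-- The relative interior of the geodesic segment `[x, y]` (for `x ≠ y`). -/
def openSegment (x y : ℍ) : Set ℍ := {z | z ∈ segment x y ∧ z ≠ x ∧ z ≠ y}

/-- A set is convex if it contains the geodesic segment between any two of its points. -/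
def IsConvex (K : Set ℍ) : Prop := ∀ x ∈ K, ∀ y ∈ K, segment x y ⊆ K

/-- The convex hull: the intersection of all convex sets containing `X`. -/
def hull (X : Set ℍ) : Set ℍ := ⋂₀ {C | IsConvex C ∧ X ⊆ C}

/-- An oriented hyperbolic line, given by an equation `a |z|² + b Re z + c = 0` whose real
solution set is a Euclidean circle centred on the real axis (`a ≠ 0`) or a vertical Euclidean
line (`a = 0`); the condition on the discriminant says that it does meet the upper half-plane. -/
structure Line where
  a : ℝ
  b : ℝ
  c : ℝ
  discr_pos : 0 < b ^ 2 - 4 * a * c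

namespace Line

/-- The defining function of a line. -/
def eqn (L : Line) (z : ℍ) : ℝ := L.a * Complex.normSq (z : ℂ) + L.b * z.re + L.c

/-- The points of a line. -/
def carrier (L : Line) : Set ℍ := {z | L.eqn z = 0}

/-- One of the two closed half-planes bounded by the line. -/
def posSide (L : Line) : Set ℍ := {z | 0 ≤ L.eqn z}

/-- The other closed half-plane bounded by the line. -/
def negSide (L : Line) : Set ℍ := {z | L.eqn z ≤ 0}

/-- `L` is a supporting line of `K`. -/
def Supports (L : Line) (K : Set ℍ) : Prop :=
  (K ∩ L.carrier).Nonempty ∧ (K ⊆ L.posSide ∨ K ⊆ L.negSide)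

/-- The distance of two lines. -/
def distance (L L' : Line) : ℝ :=
  sInf {d | ∃ x ∈ L.carrier, ∃ y ∈ L'.carrier, d = dist x y}

/-- `t` is the orthogonal projection of the point `p` on the line `L`, i.e. the point of `L`
nearest to `p`. -/
def IsProj (L : Line) (p t : ℍ) : Prop :=
  t ∈ L.carrier ∧ ∀ s ∈ L.carrier, dist p t ≤ dist p s

end Line

/-- The width of `K` with respect to the line `L` (used for supporting lines `L` of `K`): the
distance of `L` and a supporting line of `K` most distant from `L`. -/
def width (K : Set ℍ) (L : Line) : ℝ :=
  sSup {d | ∃ L' : Line, L'.Supports K ∧ d = L.distance L'}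

/-- The thickness (minimal width): the minimum of the widths with respect to all supporting
lines. -/
def thickness (K : Set ℍ) : ℝ := sInf {d | ∃ L : Line, L.Supports K ∧ d = width K L}

/-- The image of `z` in the Poincaré disk model under the conformal map `ℍ → 𝔻` that sends
`p` to `0`. -/
def toDisk (p z : ℍ) : ℂ := ((z : ℂ) - p) / ((z : ℂ) - starRingEnd ℂ (p : ℂ))

/-- The hyperbolic angle `∠ x p y` at `p`: in the Poincaré disk model with `p` at the centre, the
geodesic rays from `p` are Euclidean radii and angles are the Euclidean ones. -/
def angle (x p y : ℍ) : ℝ := InnerProductGeometry.angle (toDisk p x) (toDisk p y)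

/-- `R` is a (convex) `n`-gon with the `n` distinct vertices `v i`, numbered in cyclic order along
the boundary, i.e. the line through two consecutive vertices is a supporting line of `R`. -/
structure IsNGon (n : ℕ) (v : ZMod n → ℍ) (R : Set ℍ) : Prop where
  three_le : 3 ≤ n
  injective : Function.Injective v
  eq_hull : R = hull (Set.range v)
  interior_nonempty : (interior R).Nonempty
  vertex : ∀ i, v i ∉ hull (Set.range v \ {v i})
  side : ∀ i, ∃ L : Line, v i ∈ L.carrier ∧ v (i + 1) ∈ L.carrier ∧ L.Supports R

/-- `R` is an ordinary reduced `n`-gon of thickness `w`: `n` is odd, `R` is an `n`-gon of thickness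
`w`, every vertex is at distance `w` from the opposite side, and its orthogonal projection on the
line containing the opposite side lies in the relative interior of that side. -/
def IsOrdinaryReduced (n : ℕ) (w : ℝ) (R : Set ℍ) : Prop :=
  Odd n ∧ thickness R = w ∧ ∃ v : ZMod n → ℍ, IsNGon n v R ∧
    ∀ i : ZMod n,
      let p := v (i + ((n - 1) / 2 : ℕ))
      let q := v (i + ((n + 1) / 2 : ℕ))
      Metric.infDist (v i) (segment p q) = w ∧
      ∃ L : Line, p ∈ L.carrier ∧ q ∈ L.carrier ∧ ∃ t, L.IsProj (v i) t ∧ t ∈ openSegment p q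

/-- `R` is a regular `n`-gon: all sides have the same length, and all angles are equal. -/
def IsRegular (n : ℕ) (R : Set ℍ) : Prop :=
  ∃ v : ZMod n → ℍ, IsNGon n v R ∧
    (∀ i j, dist (v i) (v (i + 1)) = dist (v j) (v (j + 1))) ∧
    (∀ i j, angle (v (i - 1)) (v i) (v (i + 1)) = angle (v (j - 1)) (v j) (v (j + 1)))

/-- Two sets are congruent if an isometry of the hyperbolic plane maps one onto the other. -/
def Congruent (R S : Set ℍ) : Prop := ∃ g : ℍ ≃ᵢ ℍ, g '' R = S

/-- The hyperbolic area. -/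
def area (R : Set ℍ) : ENNReal := volume R

end HypPlane

end

/-!
The hyperbolic plane is mapped to the hyperboloid in a Lorentzian space of signature `(1, 2)`:
`bil (vec x) (vec y) = cosh (dist x y)`, lines are zero sets of linear functionals `bil l`, segments
and triangles are traces of cones, and `det` decides orientation.

*Butterflies.* For odd `n`, number the vertices of an ordinary reduced polygon in star order, such
that the side opposite to `u j` is `[u (j - 1), u (j + 1)]`, and let `t j` be the projection of `u j`
on it. The right triangles `u j`, `t j`, `u (j + 1)` and `u (j + 1)`, `t (j + 1)`, `u j` have a common
hypotenuse and equal legs `[u j, t j]` and `[u (j + 1), t (j + 1)]` of length `w`, so they are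
congruent. Hence these legs cross at a point `p j` at the same distance `q j < w / 2` from both
feet, and they cut off two congruent right triangles with the leg `q j` and the hypotenuse
`w - q j`: a butterfly. Let `phi w (q j)` and `alpha w (q j)` be its angles opposite and adjacent to
that leg.

*Area.* The line `u j t j` splits the interior angle at `u j` into the angles `phi` of two
consecutive butterflies, so by Gauss–Bonnet the area is `(n - 2) * π - 2 * ∑ j, phi w (q j)`. As `n`
is odd, the butterflies cover the polygon: a point cannot change sides at every step from one of
the lines `u j t j` to the next (`StarData.exists_mem_butterfly`). The area is therefore at most
`∑ j, 2 * (π / 2 - phi w (q j) - alpha w (q j))`, which says that `∑ j, alpha w (q j) ≤ π`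
(`StarData.exists_param`).

*Convexity.* For fixed `w`, the angle `phi` is a strictly convex decreasing function of `alpha`
(`tangent_lt`), so by Jensen's inequality `∑ j, phi w (q j)` is smallest when all `alpha w (q j)` are
equal to `π / n` (`jensen`). A regular polygon attains this bound (`StarData.pi_le`). If equality
holds, all butterflies are congruent to those of the regular polygon; the distances of `u j` to
`u (j + 1)` and `u (j + 2)` are then the same in both polygons, they determine all distances by a
linear recursion (`Recurrent.bil_eq`), and equal Gram matrices give an isometry
(`StarData.volume_le`). That congruent polygons have equal areas follows by applying the inequality
in both directions.

*Regular polygons.* A regular polygon with an odd number of vertices consists of congruent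
butterflies with the midpoints of the sides as feet, where `w` is replaced by its height
(`IsRegular.exists_starData`). Its thickness is the height (`StarData.thickness_eq`): each vertex is
farthest from its opposite side, so the width with respect to a side is at most the height. Any
other supporting line contains a vertex `u j`, and one of the vertices `u (j ± 1)` is at least as far
from it as the height; the farthest vertex from a supporting line then lies on a second supporting
line perpendicular to the shortest connection.
-/

namespace HypPlane

/-! ### The hyperboloid model -/

/-- The point of the hyperboloid `P * N - Q ^ 2 = 1`, `0 < P`, that corresponds to `z`. In these
coordinates lines of the hyperbolic plane are given by linear equations. -/
noncomputable def vec (z : ℍ) : ℝ × ℝ × ℝ :=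
  (1 / z.im, z.re / z.im, (z.re ^ 2 + z.im ^ 2) / z.im)

/-- The Lorentzian bilinear form, of signature `(1, 2)`, whose quadratic form is `P * N - Q ^ 2`. -/
noncomputable def bil (X Y : ℝ × ℝ × ℝ) : ℝ :=
  (X.1 * Y.2.2 + X.2.2 * Y.1) / 2 - X.2.1 * Y.2.1

/-- Half the determinant of three vectors. With this normalization its square is the Gram
determinant for `bil`; it is positive on triples of points in counterclockwise position. -/
noncomputable def det (X Y Z : ℝ × ℝ × ℝ) : ℝ :=
  (X.1 * (Y.2.1 * Z.2.2 - Y.2.2 * Z.2.1) - X.2.1 * (Y.1 * Z.2.2 - Y.2.2 * Z.1)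
    + X.2.2 * (Y.1 * Z.2.1 - Y.2.1 * Z.1)) / 2

lemma bil_comm (X Y : ℝ × ℝ × ℝ) : bil X Y = bil Y X := by simp only [bil]; ring

@[simp] lemma bil_add_left (X Y Z : ℝ × ℝ × ℝ) : bil (X + Y) Z = bil X Z + bil Y Z := by
  simp only [bil, Prod.fst_add, Prod.snd_add]; ring
@[simp] lemma bil_add_right (X Y Z : ℝ × ℝ × ℝ) : bil Z (X + Y) = bil Z X + bil Z Y := by
  simp only [bil, Prod.fst_add, Prod.snd_add]; ring
@[simp] lemma bil_sub_left (X Y Z : ℝ × ℝ × ℝ) : bil (X - Y) Z = bil X Z - bil Y Z := by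
  simp only [bil, Prod.fst_sub, Prod.snd_sub]; ring
@[simp] lemma bil_sub_right (X Y Z : ℝ × ℝ × ℝ) : bil Z (X - Y) = bil Z X - bil Z Y := by
  simp only [bil, Prod.fst_sub, Prod.snd_sub]; ring
@[simp] lemma bil_smul_left (a : ℝ) (X Z : ℝ × ℝ × ℝ) : bil (a • X) Z = a * bil X Z := by
  simp only [bil, Prod.smul_fst, Prod.smul_snd, smul_eq_mul]; ring
@[simp] lemma bil_smul_right (a : ℝ) (X Z : ℝ × ℝ × ℝ) : bil Z (a • X) = a * bil Z X := by
  simp only [bil, Prod.smul_fst, Prod.smul_snd, smul_eq_mul]; ring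

@[simp] lemma det_add_left (X X' Y Z : ℝ × ℝ × ℝ) :
    det (X + X') Y Z = det X Y Z + det X' Y Z := by
  simp only [det, Prod.fst_add, Prod.snd_add]; ring
@[simp] lemma det_add_mid (X X' Y Z : ℝ × ℝ × ℝ) :
    det Y (X + X') Z = det Y X Z + det Y X' Z := by
  simp only [det, Prod.fst_add, Prod.snd_add]; ring
@[simp] lemma det_add_right (X X' Y Z : ℝ × ℝ × ℝ) :
    det Y Z (X + X') = det Y Z X + det Y Z X' := by
  simp only [det, Prod.fst_add, Prod.snd_add]; ring
@[simp] lemma det_sub_right (X X' Y Z : ℝ × ℝ × ℝ) :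
    det Y Z (X - X') = det Y Z X - det Y Z X' := by
  simp only [det, Prod.fst_sub, Prod.snd_sub]; ring
@[simp] lemma det_smul_left (a : ℝ) (X Y Z : ℝ × ℝ × ℝ) : det (a • X) Y Z = a * det X Y Z := by
  simp only [det, Prod.smul_fst, Prod.smul_snd, smul_eq_mul]; ring
@[simp] lemma det_smul_mid (a : ℝ) (X Y Z : ℝ × ℝ × ℝ) : det Y (a • X) Z = a * det Y X Z := by
  simp only [det, Prod.smul_fst, Prod.smul_snd, smul_eq_mul]; ring
@[simp] lemma det_smul_right (a : ℝ) (X Y Z : ℝ × ℝ × ℝ) : det Y Z (a • X) = a * det Y Z X := by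
  simp only [det, Prod.smul_fst, Prod.smul_snd, smul_eq_mul]; ring
@[simp] lemma det_self_left (X Y : ℝ × ℝ × ℝ) : det X X Y = 0 := by simp only [det]; ring
@[simp] lemma det_self_right (X Y : ℝ × ℝ × ℝ) : det X Y Y = 0 := by simp only [det]; ring
@[simp] lemma det_self_outer (X Y : ℝ × ℝ × ℝ) : det X Y X = 0 := by simp only [det]; ring

lemma det_rot (X Y Z : ℝ × ℝ × ℝ) : det X Y Z = det Y Z X := by simp only [det]; ring
lemma det_swap (X Y Z : ℝ × ℝ × ℝ) : det X Z Y = -det X Y Z := by simp only [det]; ring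
lemma det_swap' (X Y Z : ℝ × ℝ × ℝ) : det Y X Z = -det X Y Z := by simp only [det]; ring

/-- The Cauchy–Binet formula: a product of two determinants is a Gram determinant. -/
lemma det_mul_det (X Y Z X' Y' Z' : ℝ × ℝ × ℝ) :
    det X Y Z * det X' Y' Z' =
      bil X X' * (bil Y Y' * bil Z Z' - bil Y Z' * bil Z Y')
      - bil X Y' * (bil Y X' * bil Z Z' - bil Y Z' * bil Z X')
      + bil X Z' * (bil Y X' * bil Z Y' - bil Y Y' * bil Z X') := by
  simp only [det, bil]; ring

/-- Cramer's rule: the coordinates of `Z` with respect to `X`, `Y`, `W` are determinants. -/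
lemma cramer (X Y W Z : ℝ × ℝ × ℝ) :
    det X Y W • Z = det Y W Z • X + det W X Z • Y + det X Y Z • W := by
  ext <;> simp [det] <;> ring

/-- The three-term Grassmann–Plücker relation. -/
lemma plucker (X Y Z W T : ℝ × ℝ × ℝ) :
    det X Y Z * det X W T - det X Y W * det X Z T + det X Y T * det X Z W = 0 := by
  simp only [det]; ring

lemma vec_fst_pos (z : ℍ) : 0 < (vec z).1 := by simp [vec, z.im_pos]

lemma bil_vec (z w : ℍ) : bil (vec z) (vec w) = Real.cosh (dist z w) := by
  have h1 := z.im_pos.ne'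
  have h2 := w.im_pos.ne'
  rw [UpperHalfPlane.cosh_dist, Complex.dist_eq, Complex.sq_norm, Complex.normSq_apply]
  simp only [bil, vec, Complex.sub_re, Complex.sub_im, UpperHalfPlane.coe_re,
    UpperHalfPlane.coe_im]
  field_simp
  ring

@[simp] lemma bil_vec_self (z : ℍ) : bil (vec z) (vec z) = 1 := by simp [bil_vec]

lemma one_le_bil (z w : ℍ) : 1 ≤ bil (vec z) (vec w) := by
  rw [bil_vec]; exact Real.one_le_cosh _

lemma one_lt_bil {z w : ℍ} (h : z ≠ w) : 1 < bil (vec z) (vec w) := by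
  rw [bil_vec]; exact Real.one_lt_cosh.2 (dist_pos.2 h).ne'

lemma eq_of_bil_eq_one {z w : ℍ} (h : bil (vec z) (vec w) = 1) : z = w := by
  by_contra hne
  exact absurd h (one_lt_bil hne).ne'

lemma dist_eq_of_bil {x y x' y' : ℍ} (h : bil (vec x) (vec y) = bil (vec x') (vec y')) :
    dist x y = dist x' y' := by
  rw [bil_vec, bil_vec] at h
  have := Real.cosh_injOn dist_nonneg dist_nonneg h
  exact this

lemma dist_le_iff_bil {x y x' y' : ℍ} :
    dist x y ≤ dist x' y' ↔ bil (vec x) (vec y) ≤ bil (vec x') (vec y') := by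
  rw [bil_vec, bil_vec, Real.cosh_le_cosh, abs_of_nonneg dist_nonneg, abs_of_nonneg dist_nonneg]

lemma vec_injective : Function.Injective vec := by
  intro z w h
  apply eq_of_bil_eq_one
  rw [h, bil_vec_self]

/-- The open future cone: the positive multiples of the points of the hyperboloid. -/
def Future (Z : ℝ × ℝ × ℝ) : Prop := 0 < Z.1 ∧ 0 < bil Z Z

lemma future_vec (z : ℍ) : Future (vec z) := ⟨vec_fst_pos z, by simp⟩

lemma Future.smul {Z : ℝ × ℝ × ℝ} (h : Future Z) {a : ℝ} (ha : 0 < a) : Future (a • Z) := by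
  refine ⟨by simpa using mul_pos ha h.1, ?_⟩
  rw [bil_smul_left, bil_smul_right]
  have := h.2
  positivity

/-- The reversed Cauchy–Schwarz inequality, in a weak form. -/
lemma Future.bil_pos {Z W : ℝ × ℝ × ℝ} (hZ : Future Z) (hW : Future W) : 0 < bil Z W := by
  obtain ⟨p, q, r⟩ := Z
  obtain ⟨p', q', r'⟩ := W
  obtain ⟨h1, h2⟩ := hZ
  obtain ⟨h3, h4⟩ := hW
  simp only [bil] at *
  have hr : 0 < r := by
    by_contra h
    nlinarith [sq_nonneg q]
  have hr' : 0 < r' := by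
    by_contra h
    nlinarith [sq_nonneg q']
  have e1 : q ^ 2 < p * r := by nlinarith
  have e2 : q' ^ 2 < p' * r' := by nlinarith
  have e3 : (2 * (q * q')) ^ 2 < (p * r' + r * p') ^ 2 := by
    have : q ^ 2 * q' ^ 2 < (p * r) * (p' * r') :=
      mul_lt_mul'' e1 e2 (sq_nonneg _) (sq_nonneg _)
    nlinarith [sq_nonneg (p * r' - r * p')]
  have := abs_lt_of_sq_lt_sq e3 (by positivity)
  have := abs_lt.1 this
  linarith [this.2]

/-- The future cone is one of the two components of the cone `0 < bil Z Z`; pairing with a point of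
the hyperboloid tells them apart. -/
lemma Future.of_bil_pos {Z : ℝ × ℝ × ℝ} (h : 0 < bil Z Z) {t : ℍ} (ht : 0 < bil Z (vec t)) :
    Future Z := by
  refine ⟨?_, h⟩
  rcases lt_trichotomy Z.1 0 with h0 | h0 | h0
  · have : Future ((-1 : ℝ) • Z) := ⟨by simpa using h0, by rw [bil_smul_left, bil_smul_right]; linarith⟩
    have := this.bil_pos (future_vec t)
    rw [bil_smul_left] at this
    linarith
  · exfalso
    simp only [bil, h0] at h
    nlinarith [sq_nonneg Z.2.1]
  · exact h0

lemma Future.add {Z W : ℝ × ℝ × ℝ} (hZ : Future Z) (hW : Future W) : Future (Z + W) := by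
  refine ⟨add_pos hZ.1 hW.1, ?_⟩
  rw [bil_add_left, bil_add_right, bil_add_right]
  have := hZ.bil_pos hW
  have := hW.bil_pos hZ
  linarith [hZ.2, hW.2]

lemma exists_vec_eq {Z : ℝ × ℝ × ℝ} (h0 : 0 < Z.1) (h1 : bil Z Z = 1) : ∃ z : ℍ, vec z = Z := by
  obtain ⟨p, q, r⟩ := Z
  simp only [bil] at h0 h1
  refine ⟨⟨⟨q / p, 1 / p⟩, by positivity⟩, ?_⟩
  have : r = (1 + q ^ 2) / p := by field_simp; linarith
  subst this
  ext
  · simp [vec, UpperHalfPlane.im]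
  · simp only [vec, UpperHalfPlane.im, UpperHalfPlane.re]; field_simp
  · simp only [vec, UpperHalfPlane.im, UpperHalfPlane.re]; field_simp; ring

/-- Radial projection of the future cone to the hyperboloid. -/
lemma Future.exists_vec {Z : ℝ × ℝ × ℝ} (h : Future Z) :
    ∃ (z : ℍ) (r : ℝ), 0 < r ∧ r ^ 2 = bil Z Z ∧ Z = r • vec z := by
  have hs := Real.sqrt_pos.2 h.2
  obtain ⟨z, hz⟩ := exists_vec_eq (Z := (√(bil Z Z))⁻¹ • Z) (by
    simpa using mul_pos (inv_pos.2 hs) h.1) (by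
    rw [bil_smul_left, bil_smul_right, ← mul_assoc, ← mul_inv, Real.mul_self_sqrt h.2.le,
      inv_mul_cancel₀ h.2.ne'])
  refine ⟨z, √(bil Z Z), hs, Real.sq_sqrt h.2.le, ?_⟩
  rw [hz, smul_smul, mul_inv_cancel₀ hs.ne', one_smul]

lemma future_comb {x y : ℍ} {a b : ℝ} (ha : 0 ≤ a) (hb : 0 ≤ b) (hab : 0 < a + b) :
    Future (a • vec x + b • vec y) := by
  rcases ha.eq_or_lt with rfl | ha
  · simpa using (future_vec y).smul (by linarith)
  rcases hb.eq_or_lt with rfl | hb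
  · simpa using (future_vec x).smul (by linarith)
  exact ((future_vec x).smul ha).add ((future_vec y).smul hb)

/-! ### Segments, lines and convex sets -/

/-- A geodesic segment is the trace on the hyperboloid of the cone over its endpoints. -/
lemma mem_segment_iff {x y z : ℍ} :
    z ∈ segment x y ↔ ∃ a b : ℝ, 0 ≤ a ∧ 0 ≤ b ∧ vec z = a • vec x + b • vec y := by
  constructor
  · intro h
    change dist x z + dist z y = dist x y at h
    rcases eq_or_ne x y with rfl | hxy
    · have h1 : dist x z = 0 := by
        have := dist_nonneg (x := x) (y := z)
        have := dist_nonneg (x := z) (y := x)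
        rw [dist_self] at h
        linarith
      refine ⟨1, 0, by norm_num, le_rfl, ?_⟩
      rw [dist_eq_zero.1 h1]; simp
    have hd : 0 < Real.sinh (dist x y) := Real.sinh_pos_iff.2 (dist_pos.2 hxy)
    set r := dist x z with hr
    set s := dist z y with hs
    have hr0 : 0 ≤ Real.sinh r := Real.sinh_nonneg_iff.2 dist_nonneg
    have hs0 : 0 ≤ Real.sinh s := Real.sinh_nonneg_iff.2 dist_nonneg
    have e1 : bil (vec x) (vec z) = Real.cosh r := bil_vec x z
    have e2 : bil (vec y) (vec z) = Real.cosh s := by rw [bil_comm]; exact bil_vec z y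
    have e3 : bil (vec x) (vec y) = Real.cosh (dist x y) := bil_vec x y
    have hS : Real.sinh (dist x y) = Real.sinh r * Real.cosh s + Real.cosh r * Real.sinh s := by
      rw [← h, Real.sinh_add]
    have hC : Real.cosh (dist x y) = Real.cosh r * Real.cosh s + Real.sinh r * Real.sinh s := by
      rw [← h, Real.cosh_add]
    set d := Real.sinh (dist x y) with hd'
    have hcr := Real.cosh_sq r
    have hcs := Real.cosh_sq s
    -- the point of the cone over `x` and `y` at the distances `r` and `s` from them
    set W : ℝ × ℝ × ℝ := (Real.sinh s / d) • vec x + (Real.sinh r / d) • vec y with hW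
    have hq : bil W W = 1 := by
      rw [hW]
      simp only [bil_add_left, bil_add_right, bil_smul_left, bil_smul_right, bil_vec_self,
        bil_comm (vec y) (vec x), e3, hC]
      field_simp
      rw [hS]
      linear_combination (Real.sinh s ^ 2) * (-hcr) + (Real.sinh r ^ 2) * (-hcs)
    have hpos : 0 < W.1 := by
      have : Future W := by
        rw [hW]
        apply future_comb (by positivity) (by positivity)
        rw [← add_div]
        apply div_pos _ hd
        rcases hs0.eq_or_lt with h0 | h0
        · rcases hr0.eq_or_lt with h1 | h1
          · rw [← h0, ← h1] at hS; simp at hS; exact absurd hS hd.ne'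
          · linarith
        · linarith
      exact this.1
    obtain ⟨z', hz'⟩ := exists_vec_eq hpos hq
    have : z' = z := by
      apply eq_of_bil_eq_one
      rw [hz', hW, bil_add_left, bil_smul_left, bil_smul_left, e1, e2]
      field_simp
      rw [hS]; ring
    refine ⟨Real.sinh s / d, Real.sinh r / d, div_nonneg hs0 hd.le, div_nonneg hr0 hd.le, ?_⟩
    rw [← this, hz']
  · rintro ⟨a, b, ha, hb, h⟩
    change dist x z + dist z y = dist x y
    set d := dist x y with hd
    have hc : bil (vec x) (vec y) = Real.cosh d := bil_vec x y
    have h1 : a ^ 2 + b ^ 2 + 2 * a * b * Real.cosh d = 1 := by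
      have := bil_vec_self z
      rw [h] at this
      simp only [bil_add_left, bil_add_right, bil_smul_left, bil_smul_right, bil_vec_self,
        bil_comm (vec y) (vec x), hc] at this
      linarith
    have e1 : Real.cosh (dist x z) = a + b * Real.cosh d := by
      rw [← bil_vec, h]; simp [hc]
    have e2 : Real.cosh (dist z y) = a * Real.cosh d + b := by
      rw [← bil_vec, h]; simp [hc]
    have hsd : 0 ≤ Real.sinh d := Real.sinh_nonneg_iff.2 dist_nonneg
    have hcd := Real.cosh_sq d
    -- the coefficients are ratios of hyperbolic sines, so that addition theorems give the claim
    have s1 : Real.sinh (dist x z) = b * Real.sinh d := by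
      have h0 : 0 ≤ Real.sinh (dist x z) := Real.sinh_nonneg_iff.2 dist_nonneg
      rw [← sq_eq_sq₀ h0 (by positivity)]
      have := Real.cosh_sq (dist x z)
      rw [e1] at this
      linear_combination (-1) * this + b ^ 2 * hcd + h1
    have s2 : Real.sinh (dist z y) = a * Real.sinh d := by
      have h0 : 0 ≤ Real.sinh (dist z y) := Real.sinh_nonneg_iff.2 dist_nonneg
      rw [← sq_eq_sq₀ h0 (by positivity)]
      have := Real.cosh_sq (dist z y)
      rw [e2] at this
      linear_combination (-1) * this + a ^ 2 * hcd + h1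
    apply Real.sinh_injective
    rw [Real.sinh_add, s1, s2, e1, e2]
    linear_combination Real.sinh d * h1

/-- The relatively interior points of a segment are those with positive coefficients. -/
lemma mem_openSegment_iff {x y z : ℍ} (hxy : x ≠ y) :
    z ∈ openSegment x y ↔ ∃ a b : ℝ, 0 < a ∧ 0 < b ∧ vec z = a • vec x + b • vec y := by
  constructor
  · rintro ⟨h, hx, hy⟩
    obtain ⟨a, b, ha, hb, h⟩ := mem_segment_iff.1 h
    have key : ∀ (u : ℍ) (c : ℝ), 0 ≤ c → vec z = c • vec u → z = u := by
      intro u c hc h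
      have h1 := bil_vec_self z
      have h2 : c = 1 := by
        rw [h] at h1
        simp only [bil_smul_left, bil_smul_right, bil_vec_self] at h1
        nlinarith
      rw [h2, one_smul] at h
      exact vec_injective h
    refine ⟨a, b, lt_of_le_of_ne ha ?_, lt_of_le_of_ne hb ?_, h⟩
    · rintro rfl
      exact hy (key y b hb (by simpa using h))
    · rintro rfl
      exact hx (key x a ha (by simpa using h))
  · rintro ⟨a, b, ha, hb, h⟩
    have hc := one_lt_bil hxy
    have h1 : a ^ 2 + b ^ 2 + 2 * a * b * bil (vec x) (vec y) = 1 := by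
      have := bil_vec_self z
      rw [h] at this
      simp only [bil_add_left, bil_add_right, bil_smul_left, bil_smul_right, bil_vec_self,
        bil_comm (vec y) (vec x)] at this
      linarith
    have hab : 0 < a * b := mul_pos ha hb
    refine ⟨mem_segment_iff.2 ⟨a, b, ha.le, hb.le, h⟩, ?_, ?_⟩
    · rintro rfl
      have := bil_vec_self z
      nth_rw 2 [h] at this
      simp only [bil_add_right, bil_smul_right, bil_vec_self] at this
      nlinarith [sq_nonneg (a + b * bil (vec z) (vec y)), mul_pos hb hb,
        mul_pos (mul_pos hb hb) (sub_pos.2 hc)]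
    · rintro rfl
      have := bil_vec_self z
      nth_rw 1 [h] at this
      simp only [bil_add_left, bil_smul_left, bil_vec_self] at this
      nlinarith [sq_nonneg (a * bil (vec x) (vec z) + b), mul_pos ha ha,
        mul_pos (mul_pos ha ha) (sub_pos.2 hc)]

/-- Half-planes are convex. -/
lemma isConvex_setOf_linear {f : ℝ × ℝ × ℝ → ℝ}
    (hf : ∀ (a b : ℝ) (X Y : ℝ × ℝ × ℝ), f (a • X + b • Y) = a * f X + b * f Y) :
    IsConvex {z | 0 ≤ f (vec z)} := by
  intro x hx y hy z hz
  obtain ⟨a, b, ha, hb, h⟩ := mem_segment_iff.1 hz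
  simp only [Set.mem_ofPred_eq] at *
  rw [h, hf]
  positivity

lemma subset_hull (X : Set ℍ) : X ⊆ hull X := fun _ hx _ hC => hC.2 hx

lemma hull_subset {X C : Set ℍ} (hC : IsConvex C) (h : X ⊆ C) : hull X ⊆ C :=
  fun _ hx => hx C ⟨hC, h⟩

lemma isConvex_hull (X : Set ℍ) : IsConvex (hull X) := fun _ hx _ hy _ hz C hC =>
  hC.1 _ (hx C hC) _ (hy C hC) hz

/-- A point of the cone over three points of a convex set belongs to the set. -/
lemma IsConvex.mem_of_comb {K : Set ℍ} (hK : IsConvex K) {x y w z : ℍ} (hx : x ∈ K) (hy : y ∈ K)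
    (hw : w ∈ K) {a b c : ℝ} (ha : 0 ≤ a) (hb : 0 ≤ b) (hc : 0 ≤ c)
    (h : vec z = a • vec x + b • vec y + c • vec w) : z ∈ K := by
  rcases (add_nonneg hb hc).eq_or_lt with h0 | h0
  · have hb' : b = 0 := by linarith
    have hc' : c = 0 := by linarith
    refine hK x hx x hx (mem_segment_iff.2 ⟨a, 0, ha, le_rfl, ?_⟩)
    rw [h, hb', hc']; simp
  · obtain ⟨m, r, hr, -, hm⟩ := (future_comb (x := y) (y := w) hb hc h0).exists_vec
    have hmK : m ∈ K := by
      refine hK y hy w hw (mem_segment_iff.2 ⟨b / r, c / r, by positivity, by positivity, ?_⟩)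
      rw [div_eq_inv_mul, div_eq_inv_mul, mul_smul, mul_smul, ← smul_add, hm, smul_smul,
        inv_mul_cancel₀ hr.ne', one_smul]
    refine hK x hx m hmK (mem_segment_iff.2 ⟨a, r, ha, hr.le, ?_⟩)
    rw [h, ← hm, add_assoc]

namespace Line

/-- The linear functional whose zero set on the hyperboloid is the line. -/
noncomputable def fn (L : Line) (X : ℝ × ℝ × ℝ) : ℝ := L.a * X.2.2 + L.b * X.2.1 + L.c * X.1

lemma fn_comb (L : Line) (a b : ℝ) (X Y : ℝ × ℝ × ℝ) :
    L.fn (a • X + b • Y) = a * L.fn X + b * L.fn Y := by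
  simp [fn]; ring

lemma eqn_eq (L : Line) (z : ℍ) : L.eqn z = z.im * L.fn (vec z) := by
  have := z.im_pos.ne'
  simp only [eqn, fn, vec, Complex.normSq_apply, UpperHalfPlane.coe_re, UpperHalfPlane.coe_im]
  field_simp

lemma mem_carrier (L : Line) (z : ℍ) : z ∈ L.carrier ↔ L.fn (vec z) = 0 := by
  change L.eqn z = 0 ↔ _
  rw [eqn_eq]; simp [z.im_ne_zero]

lemma mem_posSide (L : Line) (z : ℍ) : z ∈ L.posSide ↔ 0 ≤ L.fn (vec z) := by
  change 0 ≤ L.eqn z ↔ _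
  rw [eqn_eq, mul_nonneg_iff_of_pos_left z.im_pos]

lemma mem_negSide (L : Line) (z : ℍ) : z ∈ L.negSide ↔ L.fn (vec z) ≤ 0 := by
  change L.eqn z ≤ 0 ↔ _
  rw [eqn_eq, ← neg_nonneg, ← mul_neg, mul_nonneg_iff_of_pos_left z.im_pos, neg_nonneg]

/-- The line whose functional is `bil l`. -/
noncomputable def ofNormal (l : ℝ × ℝ × ℝ) (hl : bil l l < 0) : Line where
  a := l.1 / 2
  b := -l.2.1
  c := l.2.2 / 2
  discr_pos := by simp only [bil] at hl; nlinarith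

lemma fn_ofNormal (l : ℝ × ℝ × ℝ) (hl : bil l l < 0) (X : ℝ × ℝ × ℝ) :
    (ofNormal l hl).fn X = bil l X := by
  simp only [fn, ofNormal, bil]; ring

/-- Every line has a unit normal vector. -/
lemma exists_normal (L : Line) :
    ∃ (l : ℝ × ℝ × ℝ) (r : ℝ), 0 < r ∧ bil l l = -1 ∧ ∀ X, L.fn X = r * bil l X := by
  have h := L.discr_pos
  have hs := Real.sqrt_pos.2 h
  have hs2 := Real.sq_sqrt h.le
  set s := √(L.b ^ 2 - 4 * L.a * L.c) with hs'
  refine ⟨(2 * L.a / s, -L.b / s, 2 * L.c / s), s, hs, ?_, fun X => ?_⟩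
  · simp only [bil]
    field_simp
    rw [hs2]; ring
  · simp only [bil, fn]
    field_simp
    ring

end Line

/-- The cross product with respect to `bil`: a normal vector of the line through two points. -/
noncomputable def cross (X Y : ℝ × ℝ × ℝ) : ℝ × ℝ × ℝ :=
  (X.1 * Y.2.1 - X.2.1 * Y.1, (X.1 * Y.2.2 - X.2.2 * Y.1) / 2, X.2.1 * Y.2.2 - X.2.2 * Y.2.1)

lemma bil_cross (X Y Z : ℝ × ℝ × ℝ) : bil (cross X Y) Z = det X Y Z := by
  simp only [bil, cross, det]; ring

lemma bil_cross_cross (X Y : ℝ × ℝ × ℝ) :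
    bil (cross X Y) (cross X Y) = bil X X * bil Y Y - bil X Y ^ 2 := by
  simp only [bil, cross]; ring

lemma bil_cross_self_neg {x y : ℍ} (h : x ≠ y) :
    bil (cross (vec x) (vec y)) (cross (vec x) (vec y)) < 0 := by
  rw [bil_cross_cross, bil_vec_self, bil_vec_self]
  nlinarith [one_lt_bil h]

/-- The line through two distinct points. -/
noncomputable def lineThrough {x y : ℍ} (h : x ≠ y) : Line :=
  Line.ofNormal _ (bil_cross_self_neg h)

lemma fn_lineThrough {x y : ℍ} (h : x ≠ y) (X : ℝ × ℝ × ℝ) :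
    (lineThrough h).fn X = det (vec x) (vec y) X := by
  rw [lineThrough, Line.fn_ofNormal, bil_cross]

/-- A vector in the plane of two points on the hyperboloid is a combination of them. -/
lemma exists_comb_of_det_eq_zero {x y : ℍ} (h : x ≠ y) {Z : ℝ × ℝ × ℝ}
    (h0 : det (vec x) (vec y) Z = 0) : ∃ a b : ℝ, Z = a • vec x + b • vec y := by
  set l := cross (vec x) (vec y) with hl
  have hneg := bil_cross_self_neg h
  have hd : det (vec x) (vec y) l ≠ 0 := by
    rw [← bil_cross]; exact hneg.ne
  have := cramer (vec x) (vec y) l Z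
  refine ⟨det (vec y) l Z / det (vec x) (vec y) l, det l (vec x) Z / det (vec x) (vec y) l, ?_⟩
  rw [h0, zero_smul, add_zero] at this
  rw [div_eq_inv_mul, div_eq_inv_mul, mul_smul, mul_smul, ← smul_add, ← this, smul_smul,
    inv_mul_cancel₀ hd, one_smul]

/-- The equation of a line through two distinct points is proportional to a determinant. -/
lemma Line.exists_fn_eq (L : Line) {x y : ℍ} (h : x ≠ y) (hx : x ∈ L.carrier)
    (hy : y ∈ L.carrier) : ∃ k : ℝ, k ≠ 0 ∧ ∀ X, L.fn X = k * det (vec x) (vec y) X := by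
  rw [mem_carrier] at hx hy
  obtain ⟨l, r, hr, hl1, hl⟩ := L.exists_normal
  set m := cross (vec x) (vec y) with hm
  have hneg := bil_cross_self_neg h
  have hd : det (vec x) (vec y) m ≠ 0 := by
    rw [← bil_cross]; exact hneg.ne
  have key : ∀ X, L.fn X = (L.fn m / det (vec x) (vec y) m) * det (vec x) (vec y) X := by
    intro X
    have h1 := cramer (vec x) (vec y) m X
    have h2 := congrArg L.fn h1
    have e : L.fn (det (vec y) m X • vec x + det m (vec x) X • vec y + det (vec x) (vec y) X • m)
        = det (vec x) (vec y) X * L.fn m := by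
      rw [← one_smul ℝ (det (vec y) m X • vec x + det m (vec x) X • vec y), fn_comb, fn_comb,
        hx, hy]
      ring
    have e' : L.fn (det (vec x) (vec y) m • X) = det (vec x) (vec y) m * L.fn X := by
      have := L.fn_comb (det (vec x) (vec y) m) 0 X X
      simpa using this
    rw [e, e'] at h2
    field_simp
    linarith
  refine ⟨_, ?_, key⟩
  intro h0
  have h1 := key l
  rw [h0, zero_mul, hl, hl1] at h1
  linarith

/-! ### Isometries and Gram matrices -/

/-- `bil` is nondegenerate: a vector is determined by its products with a basis. -/
lemma eq_of_bil_eq {X Y W Z Z' : ℝ × ℝ × ℝ} (hD : det X Y W ≠ 0) (h1 : bil X Z = bil X Z')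
    (h2 : bil Y Z = bil Y Z') (h3 : bil W Z = bil W Z') : Z = Z' := by
  have key : ∀ V, bil V (Z - Z') = 0 := by
    intro V
    have h := congrArg (fun U => bil U (Z - Z')) (cramer X Y W V)
    simp only [bil_smul_left, bil_add_left, bil_sub_right, h1, h2, h3] at h
    rw [bil_sub_right]
    refine (mul_eq_zero.1 ?_).resolve_left hD
    linarith
  have k1 := key (1, 0, 0)
  have k2 := key (0, 1, 0)
  have k3 := key (0, 0, 1)
  obtain ⟨p, q, r⟩ := Z
  obtain ⟨p', q', r'⟩ := Z'
  simp [bil] at k1 k2 k3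
  ext <;> simp <;> linarith

/-- A vector is determined by its products and its determinant with two distinct points. -/
lemma eq_of_bil_of_det {x y : ℍ} (h : x ≠ y) {Z Z' : ℝ × ℝ × ℝ}
    (h1 : bil (vec x) Z = bil (vec x) Z') (h2 : bil (vec y) Z = bil (vec y) Z')
    (h3 : det (vec x) (vec y) Z = det (vec x) (vec y) Z') : Z = Z' := by
  refine eq_of_bil_eq (X := vec x) (Y := vec y) (W := cross (vec x) (vec y)) ?_ h1 h2 ?_
  · rw [← bil_cross]; exact (bil_cross_self_neg h).ne
  · rw [bil_cross, bil_cross, h3]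

/-- The determinant of three points is, up to its sign, determined by their distances. -/
lemma det_sq (x y z : ℍ) : det (vec x) (vec y) (vec z) ^ 2 =
    1 + 2 * bil (vec x) (vec y) * bil (vec y) (vec z) * bil (vec x) (vec z)
      - bil (vec x) (vec y) ^ 2 - bil (vec y) (vec z) ^ 2 - bil (vec x) (vec z) ^ 2 := by
  rw [sq, det_mul_det]
  simp only [bil_vec_self, bil_comm (vec z) (vec x), bil_comm (vec y) (vec x),
    bil_comm (vec z) (vec y)]
  ring

/-- A map of the hyperbolic plane that is linear in the hyperboloid model: it sends the triple `x`
to the triple `y` with the same Gram matrix. -/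
lemma exists_map_of_gram {x y : Fin 3 → ℍ}
    (hD : det (vec (x 0)) (vec (x 1)) (vec (x 2)) ≠ 0)
    (hG : ∀ i j, bil (vec (x i)) (vec (x j)) = bil (vec (y i)) (vec (y j))) :
    ∃ f : ℍ → ℍ, (∀ z w, bil (vec (f z)) (vec (f w)) = bil (vec z) (vec w)) ∧
      ∀ i z, bil (vec (f z)) (vec (y i)) = bil (vec z) (vec (x i)) := by
  set D := det (vec (x 0)) (vec (x 1)) (vec (x 2)) with hD'
  -- `F` is the linear map given by Cramer's rule, and `F'` is the same expression for the identity
  let F : ℝ × ℝ × ℝ → ℝ × ℝ × ℝ := fun Z => D⁻¹ • (det (vec (x 1)) (vec (x 2)) Z • vec (y 0) +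
    det (vec (x 2)) (vec (x 0)) Z • vec (y 1) + det (vec (x 0)) (vec (x 1)) Z • vec (y 2))
  let F' : ℝ × ℝ × ℝ → ℝ × ℝ × ℝ := fun Z => D⁻¹ • (det (vec (x 1)) (vec (x 2)) Z • vec (x 0) +
    det (vec (x 2)) (vec (x 0)) Z • vec (x 1) + det (vec (x 0)) (vec (x 1)) Z • vec (x 2))
  have hF' : ∀ Z, F' Z = Z := by
    intro Z
    simp only [F']
    rw [← cramer, smul_smul, inv_mul_cancel₀ hD, one_smul]
  have hFF : ∀ Z W, bil (F Z) (F W) = bil Z W := by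
    intro Z W
    have h : bil (F Z) (F W) = bil (F' Z) (F' W) := by
      simp only [F, F', bil_smul_left, bil_smul_right, bil_add_left, bil_add_right, hG]
    rw [h, hF', hF']
  have hFy : ∀ Z i, bil (F Z) (vec (y i)) = bil Z (vec (x i)) := by
    intro Z i
    have h : bil (F Z) (vec (y i)) = bil (F' Z) (vec (x i)) := by
      simp only [F, F', bil_smul_left, bil_add_left, hG]
    rw [h, hF']
  have hfut : ∀ z, ∃ w : ℍ, vec w = F (vec z) := by
    intro z
    have h1 : bil (F (vec z)) (F (vec z)) = 1 := by rw [hFF, bil_vec_self]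
    have h2 : 0 < bil (F (vec z)) (vec (y 0)) := by
      rw [hFy]; linarith [one_le_bil z (x 0)]
    exact exists_vec_eq (Future.of_bil_pos (by linarith) h2).1 h1
  choose f hf using hfut
  exact ⟨f, fun z w => by rw [hf, hf, hFF], fun i z => by rw [hf, hFy]⟩

/-- Two families of points with equal Gram matrices, not all on a line, are congruent. -/
lemma exists_isometry_of_gram {ι : Type*} (x y : ι → ℍ) (i j k : ι)
    (hD : det (vec (x i)) (vec (x j)) (vec (x k)) ≠ 0)
    (hG : ∀ i j, bil (vec (x i)) (vec (x j)) = bil (vec (y i)) (vec (y j))) :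
    ∃ g : ℍ ≃ᵢ ℍ, ∀ i, g (x i) = y i := by
  have hD' : det (vec (y i)) (vec (y j)) (vec (y k)) ≠ 0 := by
    intro h
    apply hD
    have h1 := det_sq (x i) (x j) (x k)
    rw [hG, hG, hG, ← det_sq, h] at h1
    simpa using h1
  obtain ⟨f, hf, hfy⟩ := exists_map_of_gram (x := ![x i, x j, x k]) (y := ![y i, y j, y k])
    (by simpa using hD) (by intro a b; fin_cases a <;> fin_cases b <;> simp [hG])
  obtain ⟨g, hg, hgx⟩ := exists_map_of_gram (x := ![y i, y j, y k]) (y := ![x i, x j, x k])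
    (by simpa using hD') (by intro a b; fin_cases a <;> fin_cases b <;> simp [hG])
  have hiso : Isometry f := by
    refine Isometry.of_dist_eq fun z w => ?_
    exact dist_eq_of_bil (hf z w)
  have key : ∀ z, f (g z) = z := by
    intro z
    apply vec_injective
    refine eq_of_bil_eq hD' ?_ ?_ ?_
    · rw [bil_comm, bil_comm _ (vec z)]; exact (hfy 0 _).trans (hgx 0 _)
    · rw [bil_comm, bil_comm _ (vec z)]; exact (hfy 1 _).trans (hgx 1 _)
    · rw [bil_comm, bil_comm _ (vec z)]; exact (hfy 2 _).trans (hgx 2 _)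
  refine ⟨IsometryEquiv.mk' f g key hiso, fun m => ?_⟩
  apply vec_injective
  change vec (f (x m)) = _
  refine eq_of_bil_eq hD' ?_ ?_ ?_
  · rw [bil_comm, bil_comm _ (vec (y m)), ← hG]; exact hfy 0 _
  · rw [bil_comm, bil_comm _ (vec (y m)), ← hG]; exact hfy 1 _
  · rw [bil_comm, bil_comm _ (vec (y m)), ← hG]; exact hfy 2 _

section isometry
variable (g : ℍ ≃ᵢ ℍ)

lemma bil_isometry (x y : ℍ) : bil (vec (g x)) (vec (g y)) = bil (vec x) (vec y) := by
  rw [bil_vec, bil_vec, g.dist_eq]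

/-- An isometry either preserves all orientations or reverses all of them. -/
lemma det_mul_det_isometry (x y z x' y' z' : ℍ) :
    det (vec (g x)) (vec (g y)) (vec (g z)) * det (vec (g x')) (vec (g y')) (vec (g z')) =
      det (vec x) (vec y) (vec z) * det (vec x') (vec y') (vec z') := by
  simp only [det_mul_det, bil_isometry]

lemma image_segment (x y : ℍ) : g '' segment x y = segment (g x) (g y) := by
  ext z
  constructor
  · rintro ⟨w, hw, rfl⟩
    change dist _ _ + dist _ _ = dist _ _
    rw [g.dist_eq, g.dist_eq, g.dist_eq]
    exact hw
  · intro hz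
    refine ⟨g.symm z, ?_, g.apply_symm_apply z⟩
    change dist _ _ + dist _ _ = dist _ _
    rw [← g.dist_eq x, ← g.dist_eq _ y, ← g.dist_eq x y, g.apply_symm_apply]
    exact hz

lemma IsConvex.image {K : Set ℍ} (hK : IsConvex K) : IsConvex (g '' K) := by
  rintro _ ⟨x, hx, rfl⟩ _ ⟨y, hy, rfl⟩
  rw [← image_segment]
  exact Set.image_mono (hK x hx y hy)

lemma image_hull (X : Set ℍ) : g '' hull X = hull (g '' X) := by
  have key : ∀ (h : ℍ ≃ᵢ ℍ) (Y : Set ℍ), hull (h '' Y) ⊆ h '' hull Y := fun h Y =>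
    hull_subset ((isConvex_hull Y).image h) (Set.image_mono (subset_hull Y))
  refine Set.Subset.antisymm ?_ (key g X)
  rintro _ ⟨z, hz, rfl⟩
  have h1 := key g.symm (g '' X)
  rw [← Set.image_comp, show (g.symm ∘ g) = id from by ext; simp, Set.image_id] at h1
  obtain ⟨w, hw, h⟩ := h1 hz
  rw [← h, g.apply_symm_apply]
  exact hw

end isometry

/-! ### The area under a geodesic segment -/

/-- Circles centred on the real axis and vertical lines are null sets. -/
lemma volume_eq_zero_of_conic {A B C : ℝ} (h : A ≠ 0 ∨ B ≠ 0) :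
    volume {z : ℍ | A * (z.re ^ 2 + z.im ^ 2) + B * z.re + C = 0} = 0 := by
  rw [UpperHalfPlane.volume_eq_lintegral]
  apply setLIntegral_measure_zero
  refine measure_mono_null (t := {z : ℂ | A * (z.re ^ 2 + z.im ^ 2) + B * z.re + C = 0}) ?_ ?_
  · rintro _ ⟨z, hz, rfl⟩
    exact hz
  have hS : MeasurableSet {x : ℝ × ℝ | A * (x.1 ^ 2 + x.2 ^ 2) + B * x.1 + C = 0} :=
    (isClosed_eq (by fun_prop) (by fun_prop)).measurableSet
  have h1 := Complex.volume_preserving_equiv_real_prod.measure_preimage hS.nullMeasurableSet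
  have h2 : (Complex.measurableEquivRealProd ⁻¹'
      {x : ℝ × ℝ | A * (x.1 ^ 2 + x.2 ^ 2) + B * x.1 + C = 0}) =
      {z : ℂ | A * (z.re ^ 2 + z.im ^ 2) + B * z.re + C = 0} := by
    ext z; simp [Complex.measurableEquivRealProd_apply]
  rw [← h2, h1, Measure.volume_eq_prod, Measure.measure_prod_null hS]
  have hfin : ∀ x : ℝ, (A ≠ 0 ∨ B * x + C ≠ 0) →
      volume (Prod.mk x ⁻¹' {x : ℝ × ℝ | A * (x.1 ^ 2 + x.2 ^ 2) + B * x.1 + C = 0}) = 0 := by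
    intro x hx
    apply Set.Finite.measure_zero
    rcases eq_or_ne A 0 with hA | hA
    · convert Set.finite_empty
      ext y
      simpa [hA] using hx
    · refine (Set.toFinite {√(-(B * x + C) / A - x ^ 2), -√(-(B * x + C) / A - x ^ 2)}).subset ?_
      intro y hy
      simp only [Set.mem_preimage, Set.mem_ofPred_eq] at hy
      have hy2 : y ^ 2 = -(B * x + C) / A - x ^ 2 := by field_simp; linarith
      rw [← hy2, Real.sqrt_sq_eq_abs]
      rcases abs_choice y with h | h <;> rw [h] <;> simp
  rcases eq_or_ne A 0 with hA | hA
  · have hB := h.resolve_left (not_not.2 hA)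
    have : ∀ᵐ x : ℝ, x ≠ -C / B := by
      simp [ae_iff]
    filter_upwards [this] with x hx
    refine hfin x (Or.inr fun h => hx ?_)
    field_simp
    linarith
  · exact Filter.Eventually.of_forall fun x => hfin x (Or.inl hA)

lemma lintegral_Ici_inv_sq {t : ℝ} (ht : 0 < t) :
    ∫⁻ y in Set.Ici t, ((1 / ‖y‖₊) ^ 2 : NNReal) = ENNReal.ofReal (1 / t) := by
  have h1 : IntegrableOn (fun y : ℝ => y ^ (-2 : ℝ)) (Set.Ioi t) :=
    integrableOn_Ioi_rpow_of_lt (by norm_num) ht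
  have h2 : ∫ y in Set.Ioi t, y ^ (-2 : ℝ) = 1 / t := by
    rw [integral_Ioi_rpow_of_lt (by norm_num) ht]
    norm_num
    rw [Real.rpow_neg_one]
  rw [← h2, ofReal_integral_eq_lintegral_ofReal h1, setLIntegral_congr Ioi_ae_eq_Ici.symm]
  · refine setLIntegral_congr_fun measurableSet_Ioi fun y hy => ?_
    have hy0 : 0 < y := ht.trans hy
    rw [Real.rpow_neg hy0.le, ENNReal.ofReal]
    congr 1
    ext
    simp [Real.coe_toNNReal _ (by positivity : (0:ℝ) ≤ (y ^ 2)⁻¹)]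
  · filter_upwards [ae_restrict_mem measurableSet_Ioi] with y hy
    exact Real.rpow_nonneg (ht.trans hy).le _

/-- The area above a graph. -/
lemma volume_above {h : ℝ → ℝ} {a b : ℝ} (hm : Measurable h) (hpos : ∀ x ∈ Set.Icc a b, 0 < h x) :
    volume {z : ℍ | z.re ∈ Set.Icc a b ∧ h z.re ≤ z.im} =
      ∫⁻ x in Set.Icc a b, ENNReal.ofReal (1 / h x) := by
  rw [UpperHalfPlane.volume_eq_lintegral]
  have him : UpperHalfPlane.coe '' {z : ℍ | z.re ∈ Set.Icc a b ∧ h z.re ≤ z.im} =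
      {z : ℂ | z.re ∈ Set.Icc a b ∧ h z.re ≤ z.im} := by
    ext z
    constructor
    · rintro ⟨w, hw, rfl⟩
      exact hw
    · intro hz
      exact ⟨⟨z, (hpos _ hz.1).trans_le hz.2⟩, hz, rfl⟩
  set S : Set (ℝ × ℝ) := {x | x.1 ∈ Set.Icc a b ∧ h x.1 ≤ x.2} with hSdef
  have hS : MeasurableSet S :=
    (measurable_fst measurableSet_Icc).inter (measurableSet_le (hm.comp measurable_fst)
      measurable_snd)
  have hpre : {z : ℂ | z.re ∈ Set.Icc a b ∧ h z.re ≤ z.im} =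
      Complex.measurableEquivRealProd ⁻¹' S := by
    ext z; simp [S, Complex.measurableEquivRealProd_apply]
  rw [him, hpre]
  let F : ℝ × ℝ → ENNReal := fun x => ((1 / ‖x.2‖₊) ^ 2 : NNReal)
  have hF : Measurable F := by
    simp only [F]
    fun_prop
  have h1 := Complex.volume_preserving_equiv_real_prod.setLIntegral_comp_preimage hS hF
  have h2 : ∀ z : ℂ, F (Complex.measurableEquivRealProd z) = ((1 / ‖z.im‖₊) ^ 2 : NNReal) := by
    intro z; simp [F, Complex.measurableEquivRealProd_apply]
  simp only [h2] at h1
  rw [h1, ← lintegral_indicator hS, Measure.volume_eq_prod,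
    lintegral_prod _ (hF.indicator hS).aemeasurable, ← lintegral_indicator measurableSet_Icc]
  refine lintegral_congr fun x => ?_
  by_cases hx : x ∈ Set.Icc a b
  · rw [Set.indicator_of_mem hx, ← lintegral_Ici_inv_sq (hpos x hx),
      ← lintegral_indicator measurableSet_Ici]
    refine lintegral_congr fun y => ?_
    by_cases hy : h x ≤ y
    · rw [Set.indicator_of_mem (show (x, y) ∈ S from ⟨hx, hy⟩),
        Set.indicator_of_mem (show y ∈ Set.Ici (h x) from hy)]
    · rw [Set.indicator_of_notMem (fun hmem : (x, y) ∈ S => hy hmem.2),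
        Set.indicator_of_notMem (show y ∉ Set.Ici (h x) from hy)]
  · rw [Set.indicator_of_notMem hx]
    refine (lintegral_congr fun y => ?_).trans lintegral_zero
    exact Set.indicator_of_notMem (fun hmem : (x, y) ∈ S => hx hmem.1) _

/-- The integral of `dx / y` along the geodesic segment from `p` to `q`, in a closed form that needs
no distinction between vertical segments and circular arcs. -/
noncomputable def arc (p q : ℍ) : ℝ := 2 * Real.arctan ((q.re - p.re) / (p.im + q.im))

/-- The region above the geodesic segment from `p` to `q`, for `p.re ≤ q.re`. -/
def above (p q : ℍ) : Set ℍ :=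
  {z | p.re ≤ z.re ∧ z.re ≤ q.re ∧ 0 ≤ det (vec p) (vec q) (vec z)}

lemma det_vec (p q z : ℍ) : det (vec p) (vec q) (vec z) =
    ((q.re - p.re) * (z.re ^ 2 + z.im ^ 2 - (p.re ^ 2 + p.im ^ 2))
      - (z.re - p.re) * (q.re ^ 2 + q.im ^ 2 - (p.re ^ 2 + p.im ^ 2)))
      / (2 * p.im * q.im * z.im) := by
  have := p.im_pos.ne'
  have := q.im_pos.ne'
  have := z.im_pos.ne'
  simp only [det, vec]
  field_simp
  ring

/-- The integral of `dx / y` along an arc of a circle centred on the real axis. -/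
lemma lintegral_arc {a b c r : ℝ} (hr : 0 < r) (hab : a ≤ b) (ha : |a - c| < r)
    (hb : |b - c| < r) :
    ∫⁻ x in Set.Icc a b, ENNReal.ofReal (1 / √(r ^ 2 - (x - c) ^ 2)) =
      ENNReal.ofReal (Real.arcsin ((b - c) / r) - Real.arcsin ((a - c) / r)) := by
  have hin : ∀ x ∈ Set.Icc a b, |x - c| < r := by
    intro x hx
    rw [abs_lt] at *
    constructor <;> linarith [hx.1, hx.2, ha.1, hb.2]
  have hpos : ∀ x ∈ Set.Icc a b, 0 < r ^ 2 - (x - c) ^ 2 := by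
    intro x hx
    have := sq_lt_sq' (by linarith [(abs_lt.1 (hin x hx)).1]) (abs_lt.1 (hin x hx)).2
    linarith
  have hcont : ContinuousOn (fun x => 1 / √(r ^ 2 - (x - c) ^ 2)) (Set.Icc a b) := by
    refine continuousOn_const.div (by fun_prop) fun x hx => ?_
    exact (Real.sqrt_pos.2 (hpos x hx)).ne'
  have hderiv : ∀ x ∈ Set.uIcc a b, HasDerivAt (fun x => Real.arcsin ((x - c) / r))
      (1 / √(r ^ 2 - (x - c) ^ 2)) x := by
    intro x hx
    rw [Set.uIcc_of_le hab] at hx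
    have h1 := abs_lt.1 (hin x hx)
    have h2 : (x - c) / r ≠ -1 := by
      intro h; rw [div_eq_iff hr.ne'] at h; linarith [h1.1]
    have h3 : (x - c) / r ≠ 1 := by
      intro h; rw [div_eq_iff hr.ne'] at h; linarith [h1.2]
    have h4 := (Real.hasDerivAt_arcsin h2 h3).comp x (((hasDerivAt_id x).sub_const c).div_const r)
    refine HasDerivAt.congr_deriv h4 ?_
    have h5 : 1 - ((x - c) / r) ^ 2 = (r ^ 2 - (x - c) ^ 2) / r ^ 2 := by field_simp
    rw [h5, Real.sqrt_div (hpos x hx).le, Real.sqrt_sq hr.le]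
    have := (Real.sqrt_pos.2 (hpos x hx)).ne'
    field_simp
  have hI := intervalIntegral.integral_eq_sub_of_hasDerivAt hderiv
    (by rw [← Set.uIcc_of_le hab] at hcont; exact hcont.intervalIntegrable)
  rw [← hI, intervalIntegral.integral_of_le hab, ← integral_Icc_eq_integral_Ioc,
    ofReal_integral_eq_lintegral_ofReal (hcont.integrableOn_compact isCompact_Icc)]
  filter_upwards with x
  positivity

lemma arcsin_sub_arcsin {u v s t r : ℝ} (hr : 0 < r) (hs : 0 < s) (ht : 0 < t)
    (h1 : u ^ 2 + s ^ 2 = r ^ 2) (h2 : v ^ 2 + t ^ 2 = r ^ 2) :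
    Real.arcsin (v / r) - Real.arcsin (u / r) = 2 * Real.arctan ((v - u) / (s + t)) := by
  have aux : ∀ x y : ℝ, 0 < y → x ^ 2 + y ^ 2 = r ^ 2 →
      Real.sin (Real.arcsin (x / r)) = x / r ∧ Real.cos (Real.arcsin (x / r)) = y / r := by
    intro x y hy h
    have hx := abs_le_of_sq_le_sq (a := x) (b := r) (by nlinarith) hr.le
    rw [abs_le] at hx
    refine ⟨Real.sin_arcsin ?_ ?_, ?_⟩
    · rw [le_div_iff₀ hr]; linarith
    · rw [div_le_iff₀ hr]; linarith
    · rw [Real.cos_arcsin, show 1 - (x / r) ^ 2 = (y / r) ^ 2 by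
        field_simp; linarith, Real.sqrt_sq (by positivity)]
  obtain ⟨s1, c1⟩ := aux u s hs h1
  obtain ⟨s2, c2⟩ := aux v t ht h2
  have b : ∀ x y : ℝ, 0 < y → x ^ 2 + y ^ 2 = r ^ 2 →
      -(Real.pi / 2) < Real.arcsin (x / r) ∧ Real.arcsin (x / r) < Real.pi / 2 := by
    intro x y hy h
    have hx := abs_lt_of_sq_lt_sq (a := x) (b := r) (by nlinarith) hr.le
    rw [abs_lt] at hx
    rw [Real.neg_pi_div_two_lt_arcsin, Real.arcsin_lt_pi_div_two, lt_div_iff₀ hr, div_lt_iff₀ hr]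
    constructor <;> linarith
  have b1 := b u s hs h1
  have b2 := b v t ht h2
  set A := Real.arcsin (u / r)
  set B := Real.arcsin (v / r)
  have key : Real.arctan ((v - u) / (s + t)) = (B - A) / 2 := by
    rw [← Real.arctan_tan (x := (B - A) / 2) (by linarith) (by linarith)]
    congr 1
    have e1 : v - u = r * (Real.sin B - Real.sin A) := by rw [s1, s2]; field_simp
    have e2 : s + t = r * (Real.cos A + Real.cos B) := by rw [c1, c2]; field_simp
    have hc : 0 < Real.cos ((B - A) / 2) :=
      Real.cos_pos_of_mem_Ioo ⟨by linarith, by linarith⟩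
    have hc' : 0 < Real.cos ((A + B) / 2) :=
      Real.cos_pos_of_mem_Ioo ⟨by linarith, by linarith⟩
    rw [e1, e2, Real.sin_sub_sin, Real.cos_add_cos, Real.tan_eq_sin_div_cos,
      show (A - B) / 2 = -((B - A) / 2) by ring, Real.cos_neg, show (B + A) / 2 = (A + B) / 2 by ring]
    field_simp
  rw [key]; ring

lemma arc_nonneg {p q : ℍ} (h : p.re ≤ q.re) : 0 ≤ arc p q := by
  have := p.im_pos
  have := q.im_pos
  have : 0 ≤ (q.re - p.re) / (p.im + q.im) := div_nonneg (by linarith) (by linarith)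
  have := Real.arctan_nonneg.2 this
  unfold arc
  positivity

lemma arc_swap (p q : ℍ) : arc q p = -arc p q := by
  unfold arc
  rw [show (p.re - q.re) / (q.im + p.im) = -((q.re - p.re) / (p.im + q.im)) by ring,
    Real.arctan_neg]
  ring

lemma volume_re_eq (a : ℝ) : volume {z : ℍ | z.re = a} = 0 := by
  have := volume_eq_zero_of_conic (A := 0) (B := 1) (C := -a) (by simp)
  refine measure_mono_null (fun z hz => ?_) this
  change z.re = a at hz
  change 0 * (z.re ^ 2 + z.im ^ 2) + 1 * z.re + -a = 0
  rw [hz]; ring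

/-- The area above a geodesic segment is the integral of `dx / y` along it. -/
lemma volume_above_segment {p q : ℍ} (h : p.re ≤ q.re) :
    volume (above p q) = ENNReal.ofReal (arc p q) := by
  rcases h.eq_or_lt with h | h
  · have : arc p q = 0 := by simp [arc, h]
    rw [this, ENNReal.ofReal_zero]
    refine measure_mono_null (fun z hz => ?_) (volume_re_eq p.re)
    exact le_antisymm (hz.2.1.trans h.ge) hz.1
  have hp := p.im_pos
  have hq := q.im_pos
  -- the centre and the radius of the Euclidean circle through `p` and `q`
  set c : ℝ := (q.re ^ 2 + q.im ^ 2 - (p.re ^ 2 + p.im ^ 2)) / (2 * (q.re - p.re)) with hc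
  have hpq : 0 < q.re - p.re := by linarith
  have hc2 : q.re ^ 2 + q.im ^ 2 - (p.re ^ 2 + p.im ^ 2) = 2 * c * (q.re - p.re) := by
    rw [hc]; field_simp
  set r : ℝ := √((p.re - c) ^ 2 + p.im ^ 2) with hr
  have hr2 : r ^ 2 = (p.re - c) ^ 2 + p.im ^ 2 := Real.sq_sqrt (by positivity)
  have hr2' : r ^ 2 = (q.re - c) ^ 2 + q.im ^ 2 := by rw [hr2]; linarith
  have hr0 : 0 < r := Real.sqrt_pos.2 (by positivity)
  have ha : |p.re - c| < r := abs_lt_of_sq_lt_sq (by nlinarith) hr0.le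
  have hb : |q.re - c| < r := abs_lt_of_sq_lt_sq (by nlinarith) hr0.le
  have hset : above p q =
      {z : ℍ | z.re ∈ Set.Icc p.re q.re ∧ √(r ^ 2 - (z.re - c) ^ 2) ≤ z.im} := by
    ext z
    have hz := z.im_pos
    simp only [above, Set.mem_ofPred_eq, Set.mem_Icc, and_assoc]
    refine and_congr_right fun _ => and_congr_right fun _ => ?_
    rw [det_vec, hc2, Real.sqrt_le_left hz.le, le_div_iff₀ (by positivity), zero_mul,
      show (q.re - p.re) * (z.re ^ 2 + z.im ^ 2 - (p.re ^ 2 + p.im ^ 2)) -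
        (z.re - p.re) * (2 * c * (q.re - p.re)) = (q.re - p.re) * (z.im ^ 2 -
        (r ^ 2 - (z.re - c) ^ 2)) by rw [hr2]; ring, mul_nonneg_iff_of_pos_left hpq, sub_nonneg]
  have hpos : ∀ x ∈ Set.Icc p.re q.re, 0 < √(r ^ 2 - (x - c) ^ 2) := by
    intro x hx
    rw [abs_lt] at ha hb
    have := sq_lt_sq' (a := x - c) (b := r) (by linarith [hx.1]) (by linarith [hx.2])
    exact Real.sqrt_pos.2 (by linarith)
  rw [hset, volume_above (by fun_prop) hpos, lintegral_arc hr0 h.le ha hb,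
    arcsin_sub_arcsin hr0 hp hq hr2.symm hr2'.symm]
  unfold arc
  congr 4
  ring

/-! ### The area of a triangle -/

/-- The closed triangle with vertices `x`, `y`, `z` in counterclockwise order. -/
def tri (x y z : ℍ) : Set ℍ :=
  {o | 0 ≤ det (vec x) (vec y) (vec o) ∧ 0 ≤ det (vec y) (vec z) (vec o) ∧
    0 ≤ det (vec z) (vec x) (vec o)}

lemma tri_rot (x y z : ℍ) : tri y z x = tri x y z := by
  ext o; simp only [tri, Set.mem_ofPred_eq]; tauto

lemma continuous_det_vec (x y : ℍ) : Continuous fun z : ℍ => det (vec x) (vec y) (vec z) := by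
  have h : ∀ z : ℍ, 2 * x.im * y.im * z.im ≠ 0 := fun z => by
    have := x.im_pos; have := y.im_pos; have := z.im_pos; positivity
  simp only [det_vec]
  refine Continuous.div ?_ ?_ h
  · have := UpperHalfPlane.continuous_re
    have := UpperHalfPlane.continuous_im
    fun_prop
  · have := UpperHalfPlane.continuous_im
    fun_prop

lemma measurableSet_tri (x y z : ℍ) : MeasurableSet (tri x y z) := by
  apply IsClosed.measurableSet
  exact (isClosed_le continuous_const (continuous_det_vec _ _)).inter
    ((isClosed_le continuous_const (continuous_det_vec _ _)).inter
      (isClosed_le continuous_const (continuous_det_vec _ _)))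

lemma measurableSet_above (p q : ℍ) : MeasurableSet (above p q) := by
  apply IsClosed.measurableSet
  exact (isClosed_le continuous_const UpperHalfPlane.continuous_re).inter
    ((isClosed_le UpperHalfPlane.continuous_re continuous_const).inter
      (isClosed_le continuous_const (continuous_det_vec _ _)))

lemma volume_line_eq_zero {x y : ℍ} (h : x ≠ y) :
    volume {z : ℍ | det (vec x) (vec y) (vec z) = 0} = 0 := by
  have hx := x.im_pos
  have hy := y.im_pos
  refine measure_mono_null ?_ (volume_eq_zero_of_conic (A := y.re - x.re)
    (B := -(y.re ^ 2 + y.im ^ 2 - (x.re ^ 2 + x.im ^ 2)))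
    (C := -(y.re - x.re) * (x.re ^ 2 + x.im ^ 2)
      + x.re * (y.re ^ 2 + y.im ^ 2 - (x.re ^ 2 + x.im ^ 2))) ?_)
  · intro z hz
    have hz' := z.im_pos
    change det (vec x) (vec y) (vec z) = 0 at hz
    rw [det_vec, div_eq_zero_iff] at hz
    have := hz.resolve_right (by positivity)
    change _ = _
    linarith
  · by_contra hcon
    push Not at hcon
    obtain ⟨h1, h2⟩ := hcon
    apply h
    have h1' : x.re = y.re := by linarith
    refine UpperHalfPlane.ext_re_im h1' ?_
    rw [← sq_eq_sq₀ hx.le hy.le]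
    rw [h1'] at h2
    linarith

/-- The ideal point at infinity. -/
def inftyVec : ℝ × ℝ × ℝ := (0, 0, 1)

lemma det_inftyVec (p q : ℍ) :
    det (vec p) (vec q) inftyVec = (q.re - p.re) / (2 * p.im * q.im) := by
  have := p.im_pos.ne'
  have := q.im_pos.ne'
  simp only [det, vec, inftyVec]
  field_simp
  ring

lemma det_inftyVec_pos {p q : ℍ} (h : p.re < q.re) : 0 < det (vec p) (vec q) inftyVec := by
  rw [det_inftyVec]
  have := p.im_pos
  have := q.im_pos
  exact div_pos (by linarith) (by positivity)

lemma det_inftyVec_nonneg {p q : ℍ} (h : p.re ≤ q.re) :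
    0 ≤ det (vec p) (vec q) inftyVec := by
  rw [det_inftyVec]
  have := p.im_pos
  have := q.im_pos
  exact div_nonneg (by linarith) (by positivity)

/-- The barycentric coordinates of `o` in the triangle `x`, `y`, `z`, as seen from infinity. -/
lemma bary_inftyVec (x y z o : ℍ) :
    det (vec x) (vec y) (vec z) * det (vec x) (vec o) inftyVec =
      det (vec z) (vec x) (vec o) * det (vec x) (vec y) inftyVec
      + det (vec x) (vec y) (vec o) * det (vec x) (vec z) inftyVec := by
  have e := congrArg (fun V => det (vec x) V inftyVec) (cramer (vec x) (vec y) (vec z) (vec o))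
  simpa only [det_smul_mid, det_add_mid, det_self_left, mul_zero, zero_add] using e

/-- Almost every point avoids the sides of a triangle and the vertical lines through its vertices. -/
lemma ae_generic (x y z : ℍ) (hxy : x ≠ y) (hyz : y ≠ z) (hzx : z ≠ x) : ∀ᵐ o : ℍ,
    o.re ≠ x.re ∧ o.re ≠ y.re ∧ o.re ≠ z.re ∧ det (vec x) (vec y) (vec o) ≠ 0 ∧
      det (vec y) (vec z) (vec o) ≠ 0 ∧ det (vec z) (vec x) (vec o) ≠ 0 := by
  have h : ∀ a : ℝ, ∀ᵐ o : ℍ, o.re ≠ a := fun a => by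
    rw [ae_iff]; simpa using volume_re_eq a
  have h' : ∀ p q : ℍ, p ≠ q → ∀ᵐ o : ℍ, det (vec p) (vec q) (vec o) ≠ 0 := fun p q hpq => by
    rw [ae_iff]; simpa using volume_line_eq_zero hpq
  filter_upwards [h x.re, h y.re, h z.re, h' _ _ hxy, h' _ _ hyz, h' _ _ hzx] with o h1 h2 h3 h4 h5
    h6 using ⟨h1, h2, h3, h4, h5, h6⟩

lemma ne_of_det_pos {x y z : ℍ} (hD : 0 < det (vec x) (vec y) (vec z)) :
    x ≠ y ∧ y ≠ z ∧ z ≠ x := by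
  refine ⟨?_, ?_, ?_⟩ <;> rintro rfl <;> simp at hD

/-- The sign pattern behind `volume_tri_below`: `A`, `B`, `C` are the barycentric coordinates of a
point, `u`, `v`, `t` the horizontal extents of the sides, and `X`, `Y`, `Z` the horizontal positions
of the point relative to the vertices. -/
lemma below_aux {A B C D u v t X Y Z : ℝ} (hD : 0 < D) (hu : 0 ≤ u) (hv : 0 ≤ v) (ht : 0 ≤ t)
    (hC : C ≠ 0) (h1 : D * X = C * u + A * t) (h2 : D * Y = A * v - B * u)
    (h3 : D * Z = B * t + C * v) (n1 : X ≠ 0) (n2 : Y ≠ 0) (n3 : Z ≠ 0)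
    (m1 : Y < 0 → 0 < Z) (m2 : 0 < Y → 0 < X) :
    ((0 < X ∧ Y < 0 ∧ 0 ≤ A ∨ 0 < Y ∧ 0 < Z ∧ 0 ≤ B) ↔
      ((0 ≤ A ∧ 0 ≤ B ∧ 0 ≤ C) ∨ 0 < X ∧ 0 < Z ∧ 0 ≤ -C)) ∧
    ¬ ((0 < X ∧ Y < 0 ∧ 0 ≤ A) ∧ 0 < Y ∧ 0 < Z ∧ 0 ≤ B) ∧
    ¬ ((0 ≤ A ∧ 0 ≤ B ∧ 0 ≤ C) ∧ 0 < X ∧ 0 < Z ∧ 0 ≤ -C) := by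
  -- after the signs of all products are recorded, the claim is a propositional combination of linear
  -- facts in the products, which may be treated as atoms
  have s : ∀ P Q : ℝ, 0 ≤ Q → (0 ≤ P → 0 ≤ P * Q) ∧ (P ≤ 0 → P * Q ≤ 0) := fun P Q hQ =>
    ⟨fun hP => mul_nonneg hP hQ, fun hP => mul_nonpos_of_nonpos_of_nonneg hP hQ⟩
  have d : ∀ P : ℝ, (0 < P → 0 < D * P) ∧ (P < 0 → D * P < 0) := fun P =>
    ⟨fun hP => mul_pos hD hP, fun hP => mul_neg_of_pos_of_neg hD hP⟩
  have a1 := s A t ht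
  have a2 := s A v hv
  have a3 := s B u hu
  have a4 := s B t ht
  have a5 := s C u hu
  have a6 := s C v hv
  have d1 := d X
  have d2 := d Y
  have d3 := d Z
  generalize A * t = At, A * v = Av, B * u = Bu, B * t = Bt, C * u = Cu, C * v = Cv,
    D * X = DX, D * Y = DY, D * Z = DZ at *
  clear s d
  grind

/-- The sign pattern behind `volume_tri_above`, with the notation of `below_aux`. -/
lemma above_aux {A B C D u v t X Y Z : ℝ} (hD : 0 < D) (hu : 0 ≤ u) (hv : 0 ≤ v) (ht : 0 ≤ t)
    (hB : B ≠ 0) (hC : C ≠ 0) (h1 : D * X = C * u + A * t)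
    (h2 : D * Y = B * u + A * v) (h3 : D * Z = C * v - B * t) (n1 : X ≠ 0) (n2 : Y ≠ 0) (n3 : Z ≠ 0)
    (m1 : Z < 0 → 0 < Y) (m2 : 0 < Z → 0 < X) :
    ((0 < X ∧ 0 < Y ∧ 0 ≤ A) ↔
      ((0 ≤ A ∧ 0 ≤ B ∧ 0 ≤ C) ∨ (0 < X ∧ Z < 0 ∧ 0 ≤ -C) ∨ (0 < Z ∧ 0 < Y ∧ 0 ≤ -B))) ∧
    ¬ ((0 ≤ A ∧ 0 ≤ B ∧ 0 ≤ C) ∧ ((0 < X ∧ Z < 0 ∧ 0 ≤ -C) ∨ (0 < Z ∧ 0 < Y ∧ 0 ≤ -B))) ∧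
    ¬ ((0 < X ∧ Z < 0 ∧ 0 ≤ -C) ∧ (0 < Z ∧ 0 < Y ∧ 0 ≤ -B)) := by
  have s : ∀ P Q : ℝ, 0 ≤ Q → (0 ≤ P → 0 ≤ P * Q) ∧ (P ≤ 0 → P * Q ≤ 0) := fun P Q hQ =>
    ⟨fun hP => mul_nonneg hP hQ, fun hP => mul_nonpos_of_nonpos_of_nonneg hP hQ⟩
  have d : ∀ P : ℝ, (0 < P → 0 < D * P) ∧ (P < 0 → D * P < 0) := fun P =>
    ⟨fun hP => mul_pos hD hP, fun hP => mul_neg_of_pos_of_neg hD hP⟩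
  have a1 := s A t ht
  have a2 := s A v hv
  have a3 := s B u hu
  have a4 := s B t ht
  have a5 := s C u hu
  have a6 := s C v hv
  have d1 := d X
  have d2 := d Y
  have d3 := d Z
  generalize A * t = At, A * v = Av, B * u = Bu, B * t = Bt, C * u = Cu, C * v = Cv,
    D * X = DX, D * Y = DY, D * Z = DZ at *
  clear s d
  grind

/-- The position of a point in general position relative to a vertical line. -/
lemma re_le_iff_det {p o : ℍ} (h : o.re ≠ p.re) :
    (p.re ≤ o.re ↔ 0 < det (vec p) (vec o) inftyVec) ∧
    (o.re ≤ p.re ↔ det (vec p) (vec o) inftyVec < 0) ∧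
    det (vec p) (vec o) inftyVec ≠ 0 := by
  rcases lt_or_gt_of_ne h with h | h
  · have := det_inftyVec_pos h
    rw [det_swap'] at this
    refine ⟨⟨fun h' => ?_, fun h' => ?_⟩, ⟨fun _ => ?_, fun _ => h.le⟩, ?_⟩ <;> linarith
  · have := det_inftyVec_pos h
    refine ⟨⟨fun h' => this, fun _ => h.le⟩, ⟨fun h' => ?_, fun h' => ?_⟩, this.ne'⟩ <;> linarith

/-- A triangle whose middle vertex lies below the side that joins the outer ones. -/
lemma volume_tri_below {x y z : ℍ} (hD : 0 < det (vec x) (vec y) (vec z)) (hxy : x.re ≤ y.re)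
    (hyz : y.re ≤ z.re) :
    volume (tri x y z) = ENNReal.ofReal (arc x y + arc y z + arc z x) := by
  obtain ⟨n1, n2, n3⟩ := ne_of_det_pos hD
  have hpt : ∀ᵐ o : ℍ, ((o ∈ above x y ∨ o ∈ above y z) ↔ (o ∈ tri x y z ∨ o ∈ above x z)) ∧
      ¬ (o ∈ above x y ∧ o ∈ above y z) ∧ ¬ (o ∈ tri x y z ∧ o ∈ above x z) := by
    filter_upwards [ae_generic x y z n1 n2 n3] with o ⟨g1, g2, g3, g4, g5, g6⟩
    have b1 := bary_inftyVec x y z o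
    have b2 := bary_inftyVec y z x o
    have b3 := bary_inftyVec z x y o
    rw [← det_rot] at b2
    rw [det_rot] at b3
    obtain ⟨i1, i1', i1''⟩ := re_le_iff_det g1
    obtain ⟨i2, i2', i2''⟩ := re_le_iff_det g2
    obtain ⟨i3, i3', i3''⟩ := re_le_iff_det g3
    simp only [tri, above, Set.mem_ofPred_eq, det_swap' (vec z) (vec x) (vec o), i1, i2, i2']
    rw [i3', det_swap' (vec o) (vec z), neg_lt_zero]
    rw [det_swap' (vec o) (vec z)] at i3'' b3
    refine below_aux (D := det (vec x) (vec y) (vec z)) hD (det_inftyVec_nonneg hxy)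
      (det_inftyVec_nonneg hyz) (det_inftyVec_nonneg (hxy.trans hyz)) g6 b1 ?_ ?_ i1''
      i2'' (neg_ne_zero.1 i3'') ?_ ?_
    · rw [b2, det_swap' (vec x) (vec y) inftyVec]; ring
    · rw [det_swap' (vec x) (vec z), det_swap' (vec y) (vec z)] at b3; linarith
    · rw [← i2']; intro h
      exact det_inftyVec_pos (lt_of_le_of_ne (h.trans hyz) g3)
    · rw [← i2, ← i1]; exact hxy.trans
  have h1 : volume (above x y ∪ above y z) = volume (tri x y z ∪ above x z) := by
    apply measure_congr
    filter_upwards [hpt] with o ho using propext ho.1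
  have d1 : AEDisjoint volume (above x y) (above y z) := by
    refine measure_eq_zero_iff_ae_notMem.2 ?_
    filter_upwards [hpt] with o ho using ho.2.1
  have d2 : AEDisjoint volume (tri x y z) (above x z) := by
    refine measure_eq_zero_iff_ae_notMem.2 ?_
    filter_upwards [hpt] with o ho using ho.2.2
  rw [measure_union₀ (measurableSet_above _ _).nullMeasurableSet d1,
    measure_union₀ (measurableSet_above _ _).nullMeasurableSet d2, volume_above_segment hxy,
    volume_above_segment hyz, volume_above_segment (hxy.trans hyz),
    ← ENNReal.ofReal_add (arc_nonneg hxy) (arc_nonneg hyz)] at h1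
  rw [arc_swap x z, ← sub_eq_add_neg, ENNReal.ofReal_sub _ (arc_nonneg (hxy.trans hyz)), h1,
    ENNReal.add_sub_cancel_right ENNReal.ofReal_ne_top]

/-- A triangle whose middle vertex lies above the side that joins the outer ones. -/
lemma volume_tri_above {x y z : ℍ} (hD : 0 < det (vec x) (vec y) (vec z)) (hxz : x.re ≤ z.re)
    (hzy : z.re ≤ y.re) :
    volume (tri x y z) = ENNReal.ofReal (arc x y + arc y z + arc z x) := by
  obtain ⟨n1, n2, n3⟩ := ne_of_det_pos hD
  have hpt : ∀ᵐ o : ℍ, (o ∈ above x y ↔ (o ∈ tri x y z ∨ o ∈ above x z ∨ o ∈ above z y)) ∧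
      ¬ (o ∈ tri x y z ∧ (o ∈ above x z ∨ o ∈ above z y)) ∧
      ¬ (o ∈ above x z ∧ o ∈ above z y) := by
    filter_upwards [ae_generic x y z n1 n2 n3] with o ⟨g1, g2, g3, g4, g5, g6⟩
    have b1 := bary_inftyVec x y z o
    have b2 := bary_inftyVec y z x o
    have b3 := bary_inftyVec z x y o
    rw [← det_rot] at b2
    rw [det_rot] at b3
    obtain ⟨i1, i1', i1''⟩ := re_le_iff_det g1
    obtain ⟨i2, i2', i2''⟩ := re_le_iff_det g2
    obtain ⟨i3, i3', i3''⟩ := re_le_iff_det g3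
    simp only [tri, above, Set.mem_ofPred_eq, det_swap' (vec z) (vec x) (vec o),
      det_swap' (vec y) (vec z) (vec o), i1, i2', i3, i3']
    rw [det_swap' (vec o) (vec y), neg_lt_zero]
    rw [det_swap' (vec o) (vec y)] at i2'' b2
    refine above_aux (D := det (vec x) (vec y) (vec z)) hD
      (det_inftyVec_nonneg (hxz.trans hzy)) (det_inftyVec_nonneg hzy)
      (det_inftyVec_nonneg hxz) g5 g6 b1 ?_ ?_ i1'' (neg_ne_zero.1 i2'') i3'' ?_ ?_
    · rw [det_swap' (vec x) (vec y), det_swap' (vec z) (vec y)] at b2; linarith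
    · rw [b3, det_swap' (vec x) (vec z) inftyVec]; ring
    · rw [← i3']; intro h
      exact det_inftyVec_pos (lt_of_le_of_ne (h.trans hzy) g2)
    · rw [← i3, ← i1]; exact hxz.trans
  have h1 : volume (above x y) = volume (tri x y z ∪ (above x z ∪ above z y)) := by
    apply measure_congr
    filter_upwards [hpt] with o ho using propext ho.1
  have d1 : AEDisjoint volume (tri x y z) (above x z ∪ above z y) := by
    refine measure_eq_zero_iff_ae_notMem.2 ?_
    filter_upwards [hpt] with o ho using ho.2.1
  have d2 : AEDisjoint volume (above x z) (above z y) := by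
    refine measure_eq_zero_iff_ae_notMem.2 ?_
    filter_upwards [hpt] with o ho using ho.2.2
  rw [measure_union₀ ((measurableSet_above _ _).union (measurableSet_above _ _)).nullMeasurableSet
      d1, measure_union₀ (measurableSet_above _ _).nullMeasurableSet d2, volume_above_segment hxz,
    volume_above_segment hzy, volume_above_segment (hxz.trans hzy),
    ← ENNReal.ofReal_add (arc_nonneg hxz) (arc_nonneg hzy)] at h1
  rw [arc_swap x z, arc_swap z y, show arc x y + -arc z y + -arc x z = arc x y - (arc x z + arc z y)
    by ring, ENNReal.ofReal_sub _ (add_nonneg (arc_nonneg hxz) (arc_nonneg hzy)), h1,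
    ENNReal.add_sub_cancel_right ENNReal.ofReal_ne_top]

/-- The area of a triangle is the integral of `dx / y` along its boundary. -/
lemma volume_tri {x y z : ℍ} (hD : 0 < det (vec x) (vec y) (vec z)) :
    volume (tri x y z) = ENNReal.ofReal (arc x y + arc y z + arc z x) := by
  have main : ∀ x y z : ℍ, 0 < det (vec x) (vec y) (vec z) → x.re ≤ y.re → x.re ≤ z.re →
      volume (tri x y z) = ENNReal.ofReal (arc x y + arc y z + arc z x) := by
    intro x y z hD h1 h2
    rcases le_total y.re z.re with h | h
    · exact volume_tri_below hD h1 h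
    · exact volume_tri_above hD h2 h
  by_cases h1 : x.re ≤ y.re ∧ x.re ≤ z.re
  · exact main x y z hD h1.1 h1.2
  by_cases h2 : y.re ≤ z.re ∧ y.re ≤ x.re
  · have := main y z x (by rwa [← det_rot]) h2.1 h2.2
    rw [tri_rot] at this
    rw [this]; congr 1; ring
  · have h3 : z.re ≤ x.re ∧ z.re ≤ y.re := by
      rcases le_total x.re y.re with h | h <;> rcases le_total y.re z.re with h' | h' <;>
      rcases le_total x.re z.re with h'' | h'' <;>
      first
        | exact ⟨by assumption, by assumption⟩
        | exact absurd ⟨by assumption, by assumption⟩ h1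
        | exact absurd ⟨by assumption, by assumption⟩ h2
        | (constructor <;> linarith)
    have := main z x y (by rwa [det_rot]) h3.1 h3.2
    rw [← tri_rot] at this
    rw [this]; congr 1; ring

/-! ### Angles and the Gauss–Bonnet formula for triangles -/

/-- A complex number whose argument is the oriented angle `∠ y x z` at `x`. -/
noncomputable def turn (x y z : ℍ) : ℂ :=
  ⟨bil (vec x) (vec y) * bil (vec x) (vec z) - bil (vec y) (vec z), det (vec x) (vec y) (vec z)⟩

/-- The oriented angle `∠ y x z` at `x`. -/
noncomputable def ang (x y z : ℍ) : ℝ := (turn x y z).arg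

lemma normSq_turn (x y z : ℍ) : Complex.normSq (turn x y z) =
    (bil (vec x) (vec y) ^ 2 - 1) * (bil (vec x) (vec z) ^ 2 - 1) := by
  rw [Complex.normSq_apply]
  simp only [turn]
  have := det_sq x y z
  linear_combination this

lemma norm_turn (x y z : ℍ) : ‖turn x y z‖ = Real.sinh (dist x y) * Real.sinh (dist x z) := by
  have h1 : 0 ≤ Real.sinh (dist x y) := Real.sinh_nonneg_iff.2 dist_nonneg
  have h2 : 0 ≤ Real.sinh (dist x z) := Real.sinh_nonneg_iff.2 dist_nonneg
  rw [← sq_eq_sq₀ (norm_nonneg _) (by positivity), Complex.sq_norm, normSq_turn, bil_vec, bil_vec,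
    Real.cosh_sq, Real.cosh_sq]
  ring

lemma ang_pos {x y z : ℍ} (h : 0 < det (vec x) (vec y) (vec z)) : 0 < ang x y z := by
  have h1 : 0 ≤ (turn x y z).arg := Complex.arg_nonneg_iff.2 h.le
  refine lt_of_le_of_ne h1 fun h0 => ?_
  have := (Complex.arg_eq_zero_iff.1 h0.symm).2
  exact h.ne' this

lemma ang_lt_pi {x y z : ℍ} (h : 0 < det (vec x) (vec y) (vec z)) : ang x y z < Real.pi :=
  Complex.arg_lt_pi_iff.2 (Or.inr h.ne')

lemma turn_ne_zero {x y z : ℍ} (h : 0 < det (vec x) (vec y) (vec z)) : turn x y z ≠ 0 := by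
  intro h0
  have := congrArg Complex.im h0
  exact h.ne' this

lemma exists_turn_eq {x y z : ℍ} (h : 0 < det (vec x) (vec y) (vec z)) :
    ∃ R : ℝ, 0 < R ∧ turn x y z = R * Complex.exp (ang x y z * Complex.I) :=
  ⟨_, norm_pos_iff.2 (turn_ne_zero h), (Complex.norm_mul_exp_arg_mul_I _).symm⟩

lemma ang_eq_arccos {x y z : ℍ} (h : 0 < det (vec x) (vec y) (vec z)) :
    ang x y z = Real.arccos ((bil (vec x) (vec y) * bil (vec x) (vec z) - bil (vec y) (vec z)) /
      (Real.sinh (dist x y) * Real.sinh (dist x z))) := by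
  rw [← norm_turn, ← Real.arccos_cos (ang_pos h).le (ang_lt_pi h).le]
  congr 1
  exact Complex.cos_arg (turn_ne_zero h)

/-- Oriented angles at a point add up, up to full turns. -/
lemma turn_mul_turn (x y z w : ℍ) :
    turn x y z * turn x z w = ((bil (vec x) (vec z) ^ 2 - 1 : ℝ) : ℂ) * turn x y w := by
  have hre := det_mul_det (vec x) (vec y) (vec z) (vec x) (vec z) (vec w)
  have him := congrArg (fun V => bil (vec x) V * bil (vec x) (vec z) - bil V (vec z))
    (cramer (vec x) (vec z) (vec w) (vec y))
  simp only [bil_vec_self, bil_smul_right, bil_smul_left, bil_add_left, bil_add_right,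
    bil_comm (vec z) (vec x), bil_comm (vec y) (vec x), bil_comm (vec w) (vec z),
    det_swap (vec x) (vec y) (vec z), det_rot (vec w) (vec x) (vec y)] at hre him
  apply Complex.ext
  · simp only [turn, Complex.mul_re, Complex.ofReal_re, Complex.ofReal_im, zero_mul, sub_zero]
    linear_combination (-1) * hre
  · simp only [turn, Complex.mul_im, Complex.ofReal_re, Complex.ofReal_im, zero_mul, add_zero]
    linear_combination him

lemma eq_of_exp_eq {s t : ℝ} (h1 : s - t < 2 * Real.pi) (h2 : -(2 * Real.pi) < s - t)
    (h : Complex.exp (s * Complex.I) = Complex.exp (t * Complex.I)) : s = t := by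
  obtain ⟨n, hn⟩ := Complex.exp_eq_exp_iff_exists_int.1 h
  have hn' : s = t + n * (2 * Real.pi) := by
    have := congrArg Complex.im hn
    simpa using this
  have h1 : (n : ℝ) * (2 * Real.pi) < 1 * (2 * Real.pi) := by linarith
  have h2 : (-1 : ℝ) * (2 * Real.pi) < n * (2 * Real.pi) := by linarith
  have hp : 0 < 2 * Real.pi := by positivity
  have h1' : (n : ℝ) < 1 := lt_of_mul_lt_mul_right h1 hp.le
  have h2' : (-1 : ℝ) < n := lt_of_mul_lt_mul_right h2 hp.le
  have : n = 0 := by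
    have a : n < 1 := by exact_mod_cast h1'
    have b : -1 < n := by exact_mod_cast h2'
    omega
  rw [hn', this]; simp

lemma exp_eq_of_smul_eq {s t R : ℝ} {P : ℝ} (hR : 0 < R) (hP : 0 < P)
    (h : (R : ℂ) * Complex.exp (s * Complex.I) = P * Complex.exp (t * Complex.I)) :
    Complex.exp (s * Complex.I) = Complex.exp (t * Complex.I) := by
  have h1 := congrArg norm h
  simp only [norm_mul, Complex.norm_exp_ofReal_mul_I, mul_one, Complex.norm_real, Real.norm_eq_abs,
    abs_of_pos hR, abs_of_pos hP] at h1
  rw [h1] at h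
  exact mul_left_cancel₀ (by exact_mod_cast hP.ne') h

/-- Additivity of angles within a half-plane. -/
lemma ang_add {x y z w : ℍ} (h1 : 0 < det (vec x) (vec y) (vec z))
    (h2 : 0 < det (vec x) (vec z) (vec w)) (h3 : 0 < det (vec x) (vec y) (vec w)) :
    ang x y z + ang x z w = ang x y w := by
  have hz := (ne_of_det_pos h1).2.2
  have hB : 0 < bil (vec x) (vec z) ^ 2 - 1 := by nlinarith [one_lt_bil hz.symm]
  have h := turn_mul_turn x y z w
  obtain ⟨R1, hR1, e1⟩ := exists_turn_eq h1
  obtain ⟨R2, hR2, e2⟩ := exists_turn_eq h2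
  obtain ⟨R3, hR3, e3⟩ := exists_turn_eq h3
  rw [e1, e2, e3] at h
  have := ang_pos h1
  have := ang_pos h2
  have := ang_pos h3
  refine eq_of_exp_eq (by linarith [ang_lt_pi h1, ang_lt_pi h2]) (by linarith [ang_lt_pi h3]) ?_
  refine exp_eq_of_smul_eq (R := R1 * R2) (P := (bil (vec x) (vec z) ^ 2 - 1) * R3)
    (mul_pos hR1 hR2) (mul_pos hB hR3) ?_
  push_cast at h ⊢
  rw [add_mul, Complex.exp_add]
  linear_combination h

/-- Angles at a point depend only on the directions of their legs. -/
lemma ang_congr_left {x y y' z : ℍ} {a b : ℝ} (hb : 0 < b)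
    (h : vec y' = a • vec x + b • vec y) : ang x y' z = ang x y z := by
  have : turn x y' z = (b : ℂ) * turn x y z := by
    apply Complex.ext
    · simp only [turn, h, bil_add_left, bil_add_right, bil_smul_left, bil_smul_right, bil_vec_self,
        Complex.mul_re, Complex.ofReal_re, Complex.ofReal_im]
      ring
    · simp [turn, h]
  rw [ang, this, Complex.arg_real_mul _ hb, ang]

lemma ang_congr_right {x y z z' : ℍ} {a b : ℝ} (hb : 0 < b)
    (h : vec z' = a • vec x + b • vec z) : ang x y z' = ang x y z := by
  have : turn x y z' = (b : ℂ) * turn x y z := by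
    apply Complex.ext
    · simp only [turn, h, bil_add_right, bil_smul_right, bil_vec_self, bil_comm (vec y) (vec x),
        Complex.mul_re, Complex.ofReal_re, Complex.ofReal_im]
      ring
    · simp [turn, h]
  rw [ang, this, Complex.arg_real_mul _ hb, ang]

/-- A complex number whose argument is half of `arc p q`. -/
lemma exp_arc (p q : ℍ) : ∃ r : ℝ, 0 < r ∧
    (⟨p.im + q.im, q.re - p.re⟩ : ℂ) = r * Complex.exp ((arc p q / 2 : ℝ) * Complex.I) := by
  have hpq : 0 < p.im + q.im := add_pos p.im_pos q.im_pos
  set t := (q.re - p.re) / (p.im + q.im) with ht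
  have hs : 0 < √(1 + t ^ 2) := Real.sqrt_pos.2 (by positivity)
  refine ⟨(p.im + q.im) * √(1 + t ^ 2), by positivity, ?_⟩
  have ha : arc p q / 2 = Real.arctan t := by unfold arc; ring
  rw [ha, Complex.exp_mul_I, ← Complex.ofReal_cos, ← Complex.ofReal_sin, Real.cos_arctan,
    Real.sin_arctan]
  apply Complex.ext
  · simp only [Complex.mul_re, Complex.mul_im, Complex.add_re, Complex.add_im, Complex.ofReal_re,
      Complex.ofReal_im, Complex.I_re, Complex.I_im]
    field_simp
    ring
  · simp only [Complex.mul_re, Complex.mul_im, Complex.add_re, Complex.add_im, Complex.ofReal_re,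
      Complex.ofReal_im, Complex.I_re, Complex.I_im]
    field_simp
    rw [ht]
    field_simp
    ring

/-- A complex number whose argument is half the signed area of the triangle. -/
noncomputable def areaTurn (x y z : ℍ) : ℂ :=
  ⟨1 + bil (vec x) (vec y) + bil (vec y) (vec z) + bil (vec z) (vec x),
    det (vec x) (vec y) (vec z)⟩

/-- The integral of `dx / y` along the boundary of a triangle is the argument of `areaTurn`, which
depends only on the distances of the vertices and on the orientation. -/
lemma exp_arc_tri (x y z : ℍ) : ∃ r : ℝ, 0 < r ∧ areaTurn x y z =
    r * Complex.exp (((arc x y + arc y z + arc z x) / 2 : ℝ) * Complex.I) := by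
  obtain ⟨r1, h1, e1⟩ := exp_arc x y
  obtain ⟨r2, h2, e2⟩ := exp_arc y z
  obtain ⟨r3, h3, e3⟩ := exp_arc z x
  have hx := x.im_pos
  have hy := y.im_pos
  have hz := z.im_pos
  have key : ((2 * x.im * y.im * z.im : ℝ) : ℂ) * areaTurn x y z =
      ⟨x.im + y.im, y.re - x.re⟩ * ⟨y.im + z.im, z.re - y.re⟩ * ⟨z.im + x.im, x.re - z.re⟩ := by
    apply Complex.ext
    · simp only [areaTurn, bil, vec, Complex.mul_re, Complex.mul_im, Complex.ofReal_re,
        Complex.ofReal_im]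
      field_simp
      ring
    · simp only [areaTurn, det, vec, Complex.mul_re, Complex.mul_im, Complex.ofReal_re,
        Complex.ofReal_im]
      field_simp
      ring
  refine ⟨r1 * r2 * r3 / (2 * x.im * y.im * z.im), by positivity, ?_⟩
  have hne : ((2 * x.im * y.im * z.im : ℝ) : ℂ) ≠ 0 := by
    exact_mod_cast (by positivity : 2 * x.im * y.im * z.im ≠ 0)
  rw [← mul_right_inj' hne, key, e1, e2, e3, ← mul_assoc (Complex.ofReal _) (Complex.ofReal _),
    ← Complex.ofReal_mul, mul_div_cancel₀ _ (by positivity),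
    show (arc x y + arc y z + arc z x) / 2 = arc x y / 2 + arc y z / 2 + arc z x / 2 by ring]
  push_cast
  rw [add_mul, add_mul, Complex.exp_add, Complex.exp_add]
  ring

lemma arc_tri_mem {x y z : ℍ} (hD : 0 < det (vec x) (vec y) (vec z)) :
    0 < arc x y + arc y z + arc z x ∧ arc x y + arc y z + arc z x < Real.pi := by
  obtain ⟨r, hr, h⟩ := exp_arc_tri x y z
  have hb : ∀ p q : ℍ, -(Real.pi / 2) < arc p q / 2 ∧ arc p q / 2 < Real.pi / 2 := by
    intro p q
    have : arc p q / 2 = Real.arctan ((q.re - p.re) / (p.im + q.im)) := by unfold arc; ring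
    rw [this]
    exact ⟨Real.neg_pi_div_two_lt_arctan _, Real.arctan_lt_pi_div_two _⟩
  have b1 := hb x y
  have b2 := hb y z
  have b3 := hb z x
  set A := (arc x y + arc y z + arc z x) / 2 with hA
  have hre := congrArg Complex.re h
  have him := congrArg Complex.im h
  rw [Complex.exp_mul_I, ← Complex.ofReal_cos, ← Complex.ofReal_sin] at hre him
  simp only [areaTurn, Complex.mul_re, Complex.mul_im, Complex.add_re, Complex.add_im,
    Complex.ofReal_re, Complex.ofReal_im, Complex.I_re, Complex.I_im] at hre him
  have hcos : 0 < Real.cos A := by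
    have := one_le_bil x y
    have := one_le_bil y z
    have := one_le_bil z x
    by_contra hneg
    nlinarith
  have hsin : 0 < Real.sin A := by
    by_contra hneg
    nlinarith
  -- `A` is a sum of three arctangents, and its cosine and sine are positive
  have hA1 : A < Real.pi / 2 := by
    by_contra hneg
    have := Real.cos_nonpos_of_pi_div_two_le_of_le (not_lt.1 hneg) (by linarith)
    linarith
  have hA2 : -(Real.pi / 2) < A := by
    by_contra hneg
    have := Real.cos_nonpos_of_pi_div_two_le_of_le (x := -A) (by linarith) (by linarith)
    rw [Real.cos_neg] at this
    linarith
  have hA3 : 0 < A := by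
    by_contra hneg
    have := Real.sin_nonpos_of_nonpos_of_neg_pi_le (not_lt.1 hneg) (by linarith)
    linarith
  constructor <;> linarith

/-- Two angles of a triangle add up to less than `π`. -/
lemma ang_add_ang_lt {x y z : ℍ} (hD : 0 < det (vec x) (vec y) (vec z)) :
    ang x y z + ang y z x < Real.pi := by
  have hD' : 0 < det (vec y) (vec z) (vec x) := by rwa [← det_rot]
  obtain ⟨R1, hR1, e1⟩ := exists_turn_eq hD
  obtain ⟨R2, hR2, e2⟩ := exists_turn_eq hD'
  have h : (turn x y z * turn y z x).im = R1 * R2 * Real.sin (ang x y z + ang y z x) := by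
    have : turn x y z * turn y z x = ((R1 * R2 : ℝ) : ℂ) *
        Complex.exp ((ang x y z + ang y z x : ℝ) * Complex.I) := by
      rw [e1, e2]
      push_cast
      rw [add_mul, Complex.exp_add]
      ring
    rw [this, Complex.im_ofReal_mul, Complex.exp_ofReal_mul_I_im]
  have him : 0 < (turn x y z * turn y z x).im := by
    have n := ne_of_det_pos hD
    have b1 := one_lt_bil n.1
    have b2 := one_lt_bil n.2.1
    have b3 := one_lt_bil n.2.2
    have : (turn x y z * turn y z x).im = det (vec x) (vec y) (vec z) *
        ((bil (vec x) (vec y) - 1) * (bil (vec y) (vec z) + bil (vec z) (vec x))) := by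
      simp only [turn, Complex.mul_im, ← det_rot (vec x), bil_comm (vec y) (vec x),
        bil_comm (vec x) (vec z)]
      ring
    rw [this]
    have : 0 < bil (vec x) (vec y) - 1 := by linarith
    positivity
  by_contra hneg
  have := Real.sin_nonpos_of_nonpos_of_neg_pi_le
    (x := ang x y z + ang y z x - 2 * Real.pi) (by linarith [ang_lt_pi hD, ang_lt_pi hD'])
    (by linarith)
  rw [Real.sin_sub_two_pi] at this
  rw [h] at him
  have h0 := mul_pos hR1 hR2
  nlinarith

/-- The Gauss–Bonnet formula for a triangle. -/
lemma arc_tri_eq {x y z : ℍ} (hD : 0 < det (vec x) (vec y) (vec z)) :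
    arc x y + arc y z + arc z x = Real.pi - ang x y z - ang y z x - ang z x y := by
  have hD' : 0 < det (vec y) (vec z) (vec x) := by rwa [← det_rot]
  have hD'' : 0 < det (vec z) (vec x) (vec y) := by rwa [det_rot]
  obtain ⟨r, hr, h⟩ := exp_arc_tri x y z
  obtain ⟨a1, a2⟩ := arc_tri_mem hD
  have n := ne_of_det_pos hD
  have b1 := one_lt_bil n.1
  have b2 := one_lt_bil n.2.1
  have b3 := one_lt_bil n.2.2
  set K : ℝ := 2 * (1 + bil (vec y) (vec z)) * (1 + bil (vec z) (vec x)) *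
    (1 + bil (vec x) (vec y)) * (bil (vec y) (vec z) ^ 2 - 1) * (bil (vec z) (vec x) ^ 2 - 1) *
    (bil (vec x) (vec y) ^ 2 - 1) with hK
  have hKpos : 0 < K := by
    have : 0 < bil (vec y) (vec z) ^ 2 - 1 := by nlinarith
    have : 0 < bil (vec z) (vec x) ^ 2 - 1 := by nlinarith
    have : 0 < bil (vec x) (vec y) ^ 2 - 1 := by nlinarith
    positivity
  -- comparing arguments, the sum of the angles and the area is `π` up to full turns
  have key : turn x y z * turn y z x * turn z x y * areaTurn x y z ^ 2 = -(K : ℂ) := by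
    have hd := det_sq x y z
    rw [hK]
    simp only [turn, areaTurn, ← det_rot (vec x) (vec y) (vec z), det_rot (vec z) (vec x) (vec y),
      bil_comm (vec y) (vec x), bil_comm (vec x) (vec z), bil_comm (vec z) (vec y)] at hd ⊢
    generalize bil (vec x) (vec y) = c, bil (vec y) (vec z) = a, bil (vec z) (vec x) = b,
      det (vec x) (vec y) (vec z) = D at *
    have hd4 : D ^ 4 = (1 + 2 * c * a * b - c ^ 2 - a ^ 2 - b ^ 2) ^ 2 := by rw [← hd]; ring
    apply Complex.ext
    · simp only [pow_two (_ : ℂ), Complex.mul_re, Complex.mul_im, Complex.neg_re,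
        Complex.ofReal_re]
      linear_combination
        (-((b * c - a) + (c * a - b) + (a * b - c)) * (1 + c + a + b) ^ 2
          - (b * c - a) * (c * a - b) * (a * b - c) - 2 * (1 + c + a + b) *
            ((b * c - a) * (c * a - b) + (c * a - b) * (a * b - c) + (a * b - c) * (b * c - a)))
          * hd + (((b * c - a) + (c * a - b) + (a * b - c)) + 2 * (1 + c + a + b)) * hd4
    · simp only [pow_two (_ : ℂ), Complex.mul_re, Complex.mul_im, Complex.neg_im,
        Complex.ofReal_im]
      linear_combination D * ((-2 * (1 + c + a + b) * ((b * c - a) + (c * a - b) + (a * b - c))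
        - (1 + c + a + b) ^ 2 - ((b * c - a) * (c * a - b) + (c * a - b) * (a * b - c)
        + (a * b - c) * (b * c - a))) * hd + hd4)
  set A := arc x y + arc y z + arc z x with hA
  have e : Complex.exp ((ang x y z + ang y z x + ang z x y + A : ℝ) * Complex.I) =
      Complex.exp ((Real.pi : ℝ) * Complex.I) := by
    obtain ⟨R1, hR1, e1⟩ := exists_turn_eq hD
    obtain ⟨R2, hR2, e2⟩ := exists_turn_eq hD'
    obtain ⟨R3, hR3, e3⟩ := exists_turn_eq hD''
    refine exp_eq_of_smul_eq (R := R1 * R2 * R3 * r ^ 2) (P := K) (by positivity) hKpos ?_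
    rw [Complex.exp_pi_mul_I, mul_neg_one, ← key, e1, e2, e3, h, mul_pow, ← Complex.exp_nat_mul]
    push_cast
    rw [show (2 : ℂ) * ((A : ℂ) / 2 * Complex.I) = A * Complex.I by ring, add_mul, add_mul,
      add_mul, Complex.exp_add, Complex.exp_add, Complex.exp_add]
    ring
  have l1 := ang_add_ang_lt hD
  have l2 := ang_add_ang_lt hD'
  have l3 := ang_add_ang_lt hD''
  have p1 := ang_pos hD
  have p2 := ang_pos hD'
  have p3 := ang_pos hD''
  have := eq_of_exp_eq (by linarith) (by linarith) e
  linarith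

lemma volume_tri_eq {x y z : ℍ} (hD : 0 < det (vec x) (vec y) (vec z)) :
    volume (tri x y z) =
      ENNReal.ofReal (Real.pi - ang x y z - ang y z x - ang z x y) := by
  rw [volume_tri hD, arc_tri_eq hD]

lemma tri_defect_pos {x y z : ℍ} (hD : 0 < det (vec x) (vec y) (vec z)) :
    0 < Real.pi - ang x y z - ang y z x - ang z x y := by
  rw [← arc_tri_eq hD]; exact (arc_tri_mem hD).1

/-! ### Convex polygons -/

/-- The vertices `v i` are those of a convex polygon and are numbered counterclockwise: every vertex
lies to the left of every side that does not contain it. -/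
def Oriented {n : ℕ} (v : ZMod n → ℍ) : Prop :=
  ∀ i j, j ≠ i → j ≠ i + 1 → 0 < det (vec (v i)) (vec (v (i + 1))) (vec (v j))

/-- One of three collinear points lies between the other two. -/
lemma collinear_cases {x y z : ℍ} (h : x ≠ y) (hd : det (vec x) (vec y) (vec z) = 0) :
    z ∈ segment x y ∨ y ∈ segment x z ∨ x ∈ segment z y := by
  obtain ⟨a, b, hab⟩ := exists_comb_of_det_eq_zero h hd
  have h1 : (vec z).1 = a * (vec x).1 + b * (vec y).1 := by rw [hab]; simp
  have hx := vec_fst_pos x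
  have hy := vec_fst_pos y
  have hz := vec_fst_pos z
  rcases le_or_gt 0 a with ha | ha
  · rcases le_or_gt 0 b with hb | hb
    · exact Or.inl (mem_segment_iff.2 ⟨a, b, ha, hb, hab⟩)
    · have ha' : 0 < a := by
        by_contra hcon
        nlinarith [mul_neg_of_neg_of_pos hb hy]
      refine Or.inr (Or.inr (mem_segment_iff.2 ⟨1 / a, -b / a, by positivity,
        div_nonneg (by linarith) ha, ?_⟩))
      rw [hab, smul_add, smul_smul, smul_smul, add_assoc, ← add_smul]
      field_simp
      simp
  · have hb : 0 < b := by
      by_contra hcon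
      nlinarith [mul_neg_of_neg_of_pos ha hx]
    refine Or.inr (Or.inl (mem_segment_iff.2 ⟨-a / b, 1 / b, div_nonneg (by linarith) hb.le,
      by positivity, ?_⟩))
    rw [hab, smul_add, smul_smul, smul_smul, ← add_assoc, ← add_smul]
    field_simp
    simp

lemma ZMod.one_ne_zero_of_three_le {n : ℕ} (hn : 3 ≤ n) : (1 : ZMod n) ≠ 0 := by
  have := (ZMod.natCast_eq_zero_iff 1 n).not.2 (fun h => by have := Nat.le_of_dvd one_pos h; omega)
  simpa using this

lemma ZMod.two_ne_zero_of_three_le {n : ℕ} (hn : 3 ≤ n) : (2 : ZMod n) ≠ 0 := by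
  have := (ZMod.natCast_eq_zero_iff 2 n).not.2 (fun h => by have := Nat.le_of_dvd two_pos h; omega)
  simpa using this

/-- A property of residues that is inherited by successors holds for all residues. -/
lemma ZMod.induction_succ {n : ℕ} [NeZero n] {P : ZMod n → Prop} (h0 : P 0)
    (h : ∀ i, P i → P (i + 1)) (i : ZMod n) : P i := by
  have : ∀ m : ℕ, P (m : ZMod n) := fun m => by
    induction m with
    | zero => simpa using h0
    | succ k ih => push_cast; exact h _ ih
  have := this i.val
  rwa [ZMod.natCast_zmod_val] at this

section
variable {n : ℕ} {v : ZMod n → ℍ} {R : Set ℍ}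

lemma IsNGon.neZero (h : IsNGon n v R) : NeZero n := ⟨by have := h.three_le; omega⟩

lemma IsNGon.notMem_segment (h : IsNGon n v R) {i j k : ZMod n} (hj : j ≠ i) (hk : k ≠ i) :
    v i ∉ segment (v j) (v k) := fun hmem => by
  have key : ∀ l, l ≠ i → v l ∈ hull (Set.range v \ {v i}) := fun l hl =>
    subset_hull _ ⟨⟨l, rfl⟩, fun e => hl (h.injective e)⟩
  exact h.vertex i (isConvex_hull _ _ (key j hj) _ (key k hk) hmem)

/-- No three vertices are collinear. -/
lemma IsNGon.det_ne_zero (h : IsNGon n v R) {i j k : ZMod n} (hij : i ≠ j) (hik : i ≠ k)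
    (hjk : j ≠ k) : det (vec (v i)) (vec (v j)) (vec (v k)) ≠ 0 := fun h0 => by
  rcases collinear_cases (h.injective.ne hij) h0 with h' | h' | h'
  · exact h.notMem_segment hik hjk h'
  · exact h.notMem_segment hij hjk.symm h'
  · exact h.notMem_segment hik.symm hij.symm h'

lemma IsNGon.mem (h : IsNGon n v R) (i : ZMod n) : v i ∈ R := by
  rw [h.eq_hull]; exact subset_hull _ ⟨i, rfl⟩

/-- All other vertices lie strictly on the same side of the line through two consecutive ones. -/
lemma IsNGon.exists_sign (h : IsNGon n v R) (i : ZMod n) : ∃ e : ℝ, (e = 1 ∨ e = -1) ∧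
    ∀ j, j ≠ i → j ≠ i + 1 → 0 < e * det (vec (v i)) (vec (v (i + 1))) (vec (v j)) := by
  obtain ⟨L, h1, h2, -, hL⟩ := h.side i
  have hi : i ≠ i + 1 := fun e => ZMod.one_ne_zero_of_three_le h.three_le (by simpa using e)
  obtain ⟨k, hk, hfn⟩ := L.exists_fn_eq (h.injective.ne hi) h1 h2
  have hne : ∀ j, j ≠ i → j ≠ i + 1 → det (vec (v i)) (vec (v (i + 1))) (vec (v j)) ≠ 0 :=
    fun j hj hj' => h.det_ne_zero hi hj.symm hj'.symm
  have key : (∀ j, 0 ≤ k * det (vec (v i)) (vec (v (i + 1))) (vec (v j))) ∨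
      (∀ j, k * det (vec (v i)) (vec (v (i + 1))) (vec (v j)) ≤ 0) := by
    rcases hL with hL | hL
    · left; intro j
      rw [← hfn]
      exact (L.mem_posSide _).1 (hL (h.mem j))
    · right; intro j
      rw [← hfn]
      exact (L.mem_negSide _).1 (hL (h.mem j))
  rcases lt_or_gt_of_ne hk with hk | hk <;> rcases key with key | key
  · refine ⟨-1, Or.inr rfl, fun j hj hj' => ?_⟩
    have := key j
    have := hne j hj hj'
    rcases lt_or_gt_of_ne this with h' | h'
    · linarith
    · nlinarith
  · refine ⟨1, Or.inl rfl, fun j hj hj' => ?_⟩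
    have := key j
    have := hne j hj hj'
    rcases lt_or_gt_of_ne this with h' | h'
    · nlinarith
    · linarith
  · refine ⟨1, Or.inl rfl, fun j hj hj' => ?_⟩
    have := key j
    have := hne j hj hj'
    rcases lt_or_gt_of_ne this with h' | h'
    · nlinarith
    · linarith
  · refine ⟨-1, Or.inr rfl, fun j hj hj' => ?_⟩
    have := key j
    have := hne j hj hj'
    rcases lt_or_gt_of_ne this with h' | h'
    · linarith
    · nlinarith

lemma IsNGon.neg (h : IsNGon n v R) : IsNGon n (fun i => v (-i)) R := by
  have hr : Set.range (fun i => v (-i)) = Set.range v := (Equiv.neg (ZMod n)).surjective.range_comp v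
  refine ⟨h.three_le, fun i j e => neg_injective (h.injective e), by rw [hr]; exact h.eq_hull,
    h.interior_nonempty, fun i => by rw [hr]; exact h.vertex (-i), fun i => ?_⟩
  obtain ⟨L, h1, h2, hL⟩ := h.side (-i - 1)
  refine ⟨L, by simpa using h2, ?_, hL⟩
  rwa [show -(i + 1) = -i - 1 by ring]

/-- Up to reversal, the vertices of a polygon are numbered counterclockwise. -/
lemma IsNGon.oriented_or (h : IsNGon n v R) : Oriented v ∨ Oriented (fun i => v (-i)) := by
  have := h.neZero
  have h1 := ZMod.one_ne_zero_of_three_le h.three_le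
  have h2 := ZMod.two_ne_zero_of_three_le h.three_le
  choose e he hpos using h.exists_sign
  have hsucc : ∀ i, e (i + 1) = e i := by
    intro i
    have p1 := hpos i (i + 1 + 1) (fun h => h2 (by linear_combination h))
      (fun h => h1 (by linear_combination h))
    have p2 := hpos (i + 1) i (fun h => h1 (by linear_combination -h))
      (fun h => h2 (by linear_combination -h))
    rw [← det_rot] at p2
    rcases he i with h | h <;> rcases he (i + 1) with h' | h' <;> rw [h] at p1 <;> rw [h'] at p2 <;>
      rw [h, h'] <;> linarith
  have hconst : ∀ i, e i = e 0 := ZMod.induction_succ rfl fun i hi => by rw [hsucc, hi]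
  rcases he 0 with h0 | h0
  · left
    intro i j hj hj'
    have := hpos i j hj hj'
    rwa [hconst, h0, one_mul] at this
  · right
    intro i j hj hj'
    have := hpos (-i - 1) (-j) (fun h => hj' (by linear_combination -h))
      (fun h => hj (by linear_combination -h))
    rw [hconst, h0, show -i - 1 + 1 = -i by ring, det_swap'] at this
    change 0 < det (vec (v (-i))) (vec (v (-(i + 1)))) (vec (v (-j)))
    rw [show -(i + 1) = -i - 1 by ring]
    linarith

lemma Oriented.nonneg (h : Oriented v) (i j : ZMod n) :
    0 ≤ det (vec (v i)) (vec (v (i + 1))) (vec (v j)) := by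
  by_cases hj : j = i
  · subst hj; simp
  by_cases hj' : j = i + 1
  · subst hj'; simp
  exact (h i j hj hj').le

lemma natCast_ne {n a b : ℕ} (ha : a < n) (hb : b < n) (h : a ≠ b) : (a : ZMod n) ≠ b := by
  rw [Ne, ZMod.natCast_eq_natCast_iff, Nat.ModEq, Nat.mod_eq_of_lt ha, Nat.mod_eq_of_lt hb]
  exact h

lemma isConvex_leftSide (x y : ℍ) : IsConvex {z | 0 ≤ det (vec x) (vec y) (vec z)} :=
  isConvex_setOf_linear (fun a b X Y => by simp)

lemma Oriented.side_pos (h : Oriented v) {i j : ℕ} (hi : i + 1 < n) (hj : j < n) (hij : j ≠ i)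
    (hij' : j ≠ i + 1) :
    0 < det (vec (v (i : ℕ))) (vec (v (i + 1 : ℕ))) (vec (v (j : ℕ))) := by
  have h1 : (j : ZMod n) ≠ (i : ℕ) := natCast_ne hj (by omega) hij
  have h2 : (j : ZMod n) ≠ (i + 1 : ℕ) := natCast_ne hj (by omega) hij'
  have := h i j h1 (by push_cast at h2; exact h2)
  push_cast
  exact this

/-- The vertices are seen from the vertex `v 0` in counterclockwise order. -/
lemma Oriented.fan_pos (h : Oriented v) {i j : ℕ} (hi : 1 ≤ i) (hij : i < j) (hj : j < n) :
    0 < det (vec (v (0 : ℕ))) (vec (v (i : ℕ))) (vec (v (j : ℕ))) := by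
  have step : ∀ m : ℕ, 1 ≤ m → m + 1 < n →
      0 < det (vec (v (0 : ℕ))) (vec (v (m : ℕ))) (vec (v (m + 1 : ℕ))) := by
    intro m hm hm'
    rw [det_rot]
    exact h.side_pos hm' (by omega) (by omega) (by omega)
  have h1 : ∀ m : ℕ, 2 ≤ m → m < n →
      0 < det (vec (v (0 : ℕ))) (vec (v (1 : ℕ))) (vec (v (m : ℕ))) := by
    intro m hm hm'
    exact h.side_pos (i := 0) (by omega) hm' (by omega) (by omega)
  induction j, hij using Nat.le_induction with
  | base => exact step i hi hj
  | succ j hij ih =>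
    have ih := ih (by omega)
    have hP := plucker (vec (v (0 : ℕ))) (vec (v (1 : ℕ))) (vec (v (i : ℕ))) (vec (v (j : ℕ)))
      (vec (v (j + 1 : ℕ)))
    have p1 := h1 j (by omega) (by omega)
    have p2 := h1 (j + 1) (by omega) hj
    have p3 := step j (by omega) hj
    have p4 : 0 ≤ det (vec (v (0 : ℕ))) (vec (v (1 : ℕ))) (vec (v (i : ℕ))) := by
      rcases hi.eq_or_lt with rfl | hi
      · simp
      · exact (h1 i hi (by omega)).le
    have := mul_nonneg p4 p3.le
    have := mul_pos p2 ih
    by_contra hneg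
    have := mul_nonneg p1.le (neg_nonneg.2 (not_lt.1 hneg))
    linarith

/-- A point to the left of all sides lies in a triangle of the fan of `v 0`: it is the triangle at
which the point changes from the left to the right of the diagonals from `v 0`. -/
lemma mem_fan (hn : 3 ≤ n) {z : ℍ}
    (hz : ∀ i, 0 ≤ det (vec (v i)) (vec (v (i + 1))) (vec z)) :
    ∃ i ∈ Finset.Ico 1 (n - 1), z ∈ tri (v (0 : ℕ)) (v (i : ℕ)) (v (i + 1 : ℕ)) := by
  by_contra hcon
  push Not at hcon
  have hpos : ∀ i : ℕ, 1 ≤ i → i + 1 ≤ n - 1 →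
      0 ≤ det (vec (v (0 : ℕ))) (vec (v (i : ℕ))) (vec z) ∧
      0 < det (vec (v (0 : ℕ))) (vec (v (i + 1 : ℕ))) (vec z) := by
    intro i hi
    have step : ∀ j : ℕ, 1 ≤ j → j + 1 ≤ n - 1 →
        0 ≤ det (vec (v (0 : ℕ))) (vec (v (j : ℕ))) (vec z) →
        0 < det (vec (v (0 : ℕ))) (vec (v (j + 1 : ℕ))) (vec z) := by
      intro j hj hj' h0
      by_contra hneg
      refine hcon j (Finset.mem_Ico.2 ⟨hj, by omega⟩) ⟨h0, ?_, ?_⟩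
      · have := hz j
        push_cast
        exact this
      · rw [det_swap']; linarith
    induction i, hi using Nat.le_induction with
    | base =>
      intro hle
      have h0 : 0 ≤ det (vec (v (0 : ℕ))) (vec (v (1 : ℕ))) (vec z) := by
        simpa using hz 0
      exact ⟨h0, step 1 le_rfl hle h0⟩
    | succ i hi ih =>
      intro hle
      have := (ih (by omega)).2
      exact ⟨this.le, step (i + 1) (by omega) hle this.le⟩
  have h1 := (hpos (n - 2) (by omega) (by omega)).2
  have h2 := hz ((n - 2 + 1 : ℕ) : ZMod n)
  have h3 : ((n - 2 + 1 : ℕ) : ZMod n) + 1 = (0 : ℕ) := by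
    have : ((n - 2 + 1 + 1 : ℕ) : ZMod n) = (n : ℕ) := by congr 1; omega
    push_cast at this ⊢
    rw [this]; simp
  rw [h3, det_swap'] at h2
  linarith

lemma tri_subset_hull {x y z : ℍ} (hD : 0 < det (vec x) (vec y) (vec z)) {X : Set ℍ} (hx : x ∈ X)
    (hy : y ∈ X) (hz : z ∈ X) : tri x y z ⊆ hull X := by
  rintro o ⟨h1, h2, h3⟩
  refine (isConvex_hull X).mem_of_comb (subset_hull X hx) (subset_hull X hy) (subset_hull X hz)
    (div_nonneg h2 hD.le) (div_nonneg h3 hD.le) (div_nonneg h1 hD.le) ?_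
  rw [div_eq_inv_mul, div_eq_inv_mul, div_eq_inv_mul, mul_smul, mul_smul, mul_smul, ← smul_add,
    ← smul_add, ← cramer, smul_smul, inv_mul_cancel₀ hD.ne', one_smul]

/-- A convex polygon is triangulated by the diagonals from `v 0`. -/
lemma Oriented.hull_eq (h : Oriented v) (hn : 3 ≤ n) : hull (Set.range v) =
    ⋃ i ∈ Finset.Ico 1 (n - 1), tri (v (0 : ℕ)) (v (i : ℕ)) (v (i + 1 : ℕ)) := by
  apply Set.Subset.antisymm
  · intro z hz
    obtain ⟨i, hi, hmem⟩ := mem_fan hn (z := z) fun i =>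
      hull_subset (isConvex_leftSide _ _) (by rintro _ ⟨j, rfl⟩; exact h.nonneg i j) hz
    exact Set.mem_biUnion hi hmem
  · refine Set.iUnion₂_subset fun i hi => ?_
    rw [Finset.mem_Ico] at hi
    exact tri_subset_hull (h.fan_pos hi.1 (by omega) (by omega)) ⟨_, rfl⟩ ⟨_, rfl⟩ ⟨_, rfl⟩

/-- A convex polygon is the intersection of the half-planes bounded by its sides. -/
lemma Oriented.mem_hull_iff (h : Oriented v) (hn : 3 ≤ n) {z : ℍ} : z ∈ hull (Set.range v) ↔
    ∀ i, 0 ≤ det (vec (v i)) (vec (v (i + 1))) (vec z) := by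
  constructor
  · intro hz i
    exact hull_subset (isConvex_leftSide _ _) (by rintro _ ⟨j, rfl⟩; exact h.nonneg i j) hz
  · intro hz
    rw [h.hull_eq hn]
    obtain ⟨i, hi, hmem⟩ := mem_fan hn hz
    exact Set.mem_biUnion hi hmem

lemma Oriented.volume_hull (h : Oriented v) (hn : 3 ≤ n) : volume (hull (Set.range v)) =
    ENNReal.ofReal (∑ i ∈ Finset.Ico 1 (n - 1), (Real.pi
      - ang (v (0 : ℕ)) (v (i : ℕ)) (v (i + 1 : ℕ)) - ang (v (i : ℕ)) (v (i + 1 : ℕ)) (v (0 : ℕ))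
      - ang (v (i + 1 : ℕ)) (v (0 : ℕ)) (v (i : ℕ)))) := by
  have hD : ∀ i ∈ Finset.Ico 1 (n - 1),
      0 < det (vec (v (0 : ℕ))) (vec (v (i : ℕ))) (vec (v (i + 1 : ℕ))) := by
    intro i hi
    rw [Finset.mem_Ico] at hi
    exact h.fan_pos hi.1 (by omega) (by omega)
  have hdisj : ∀ i ∈ Finset.Ico 1 (n - 1), ∀ j ∈ Finset.Ico 1 (n - 1), i < j →
      AEDisjoint volume (tri (v (0 : ℕ)) (v (i : ℕ)) (v (i + 1 : ℕ)))
        (tri (v (0 : ℕ)) (v (j : ℕ)) (v (j + 1 : ℕ))) := by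
    intro i hi j hj hij
    have hi' := hi
    have hj' := hj
    rw [Finset.mem_Ico] at hi hj
    refine measure_mono_null ?_ (volume_line_eq_zero (ne_of_det_pos (hD i hi')).2.2.symm)
    rintro z ⟨⟨-, -, h1⟩, ⟨h2, h3, h4⟩⟩
    have e := congrArg (fun V => det (vec (v (0 : ℕ))) (vec (v (i + 1 : ℕ))) V)
      (cramer (vec (v (0 : ℕ))) (vec (v (j : ℕ))) (vec (v (j + 1 : ℕ))) (vec z))
    simp only [det_smul_right, det_add_right, det_self_outer, mul_zero, zero_add] at e
    have k1 : 0 ≤ det (vec (v (0 : ℕ))) (vec (v (i + 1 : ℕ))) (vec (v (j : ℕ))) := by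
      rcases (Nat.succ_le_of_lt hij).eq_or_lt with h' | h'
      · rw [← h']; simp
      · exact (h.fan_pos (by omega) h' (by omega)).le
    have k2 := h.fan_pos (i := i + 1) (j := j + 1) (by omega) (by omega) (by omega)
    have k3 := hD j hj'
    rw [det_swap'] at h1
    have k4 := mul_nonneg h4 k1
    have k5 := mul_nonneg h2 k2.le
    change _ = _
    refine le_antisymm (by linarith) ?_
    by_contra hneg
    have := mul_pos k3 (neg_pos.2 (not_le.1 hneg))
    linarith
  rw [h.hull_eq hn, measure_biUnion_finset₀, ENNReal.ofReal_sum_of_nonneg]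
  · exact Finset.sum_congr rfl fun i hi => volume_tri_eq (hD i hi)
  · exact fun i hi => (tri_defect_pos (hD i hi)).le
  · intro i hi j hj hij
    rcases lt_or_gt_of_ne hij with h' | h'
    · exact hdisj i hi j hj h'
    · exact (hdisj j hj i hi h').symm
  · exact fun i _ => (measurableSet_tri _ _ _).nullMeasurableSet

/-- The interior angle of a counterclockwise polygon at the vertex `v i`. -/
noncomputable def interiorAngle (v : ZMod n → ℍ) (i : ZMod n) : ℝ :=
  ang (v i) (v (i + 1)) (v (i - 1))

/-- The angles of the triangles of the fan of `v 0` add up to the interior angles of the polygon with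
vertices `v 0, …, v (m + 1)`; those at `v 0` and `v (m + 1)` are written out, as their neighbours in
this polygon are not their neighbours in the whole one. -/
lemma Oriented.sum_fan (h : Oriented v) {m : ℕ} (hm : 1 ≤ m) (hmn : m + 1 < n) :
    ∑ i ∈ Finset.Ico 1 (m + 1), (Real.pi
      - ang (v (0 : ℕ)) (v (i : ℕ)) (v (i + 1 : ℕ)) - ang (v (i : ℕ)) (v (i + 1 : ℕ)) (v (0 : ℕ))
      - ang (v (i + 1 : ℕ)) (v (0 : ℕ)) (v (i : ℕ))) =
    m * Real.pi - ang (v (0 : ℕ)) (v (1 : ℕ)) (v (m + 1 : ℕ))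
      - ∑ i ∈ Finset.Ico 1 (m + 1), interiorAngle v (i : ℕ)
      - ang (v (m + 1 : ℕ)) (v (0 : ℕ)) (v (m : ℕ)) := by
  have hcast : ∀ i : ℕ, interiorAngle v ((i + 1 : ℕ) : ZMod n) =
      ang (v (i + 1 : ℕ)) (v (i + 1 + 1 : ℕ)) (v (i : ℕ)) := by
    intro i
    unfold interiorAngle
    congr 2
    · push_cast; ring
    · push_cast; ring
  induction m, hm using Nat.le_induction with
  | base =>
    have := hcast 0
    simp only [zero_add] at this
    rw [Finset.sum_Ico_succ_top le_rfl, Finset.sum_Ico_succ_top le_rfl, this]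
    simp only [Finset.Ico_self, Finset.sum_empty, zero_add, Nat.cast_one, one_mul]
  | succ m hm ih =>
    rw [Finset.sum_Ico_succ_top (by omega), ih (by omega),
      Finset.sum_Ico_succ_top (b := m + 1) (by omega), hcast]
    have d1 := h.fan_pos (i := 1) (j := m + 1) le_rfl (by omega) (by omega)
    have d2 := h.fan_pos (i := m + 1) (j := m + 1 + 1) (by omega) (by omega) (by omega)
    have d3 := h.fan_pos (i := 1) (j := m + 1 + 1) le_rfl (by omega) (by omega)
    have d4 := h.side_pos (i := m + 1) (j := 0) (by omega) (by omega) (by omega) (by omega)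
    have d5 := h.fan_pos (i := m) (j := m + 1) hm (by omega) (by omega)
    rw [← det_rot] at d5
    have d6 := h.side_pos (i := m + 1) (j := m) (by omega) (by omega) (by omega) (by omega)
    have a1 := ang_add d1 d2 d3
    have a2 := ang_add d4 d5 d6
    rw [← a1, ← a2]
    push_cast
    ring

variable [NeZero n]

lemma sum_zmod_eq_sum_range (f : ZMod n → ℝ) : ∑ i, f i = ∑ i ∈ Finset.range n, f (i : ℕ) := by
  refine Finset.sum_nbij' (fun i => i.val) (fun i => (i : ZMod n)) ?_ ?_ ?_ ?_ ?_
  · intro i _; exact Finset.mem_range.2 (ZMod.val_lt i)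
  · intro i _; exact Finset.mem_univ _
  · intro i _; exact ZMod.natCast_zmod_val i
  · intro i hi; exact ZMod.val_cast_of_lt (Finset.mem_range.1 hi)
  · intro i _; rw [ZMod.natCast_zmod_val]

/-- The Gauss–Bonnet formula for a convex polygon. -/
lemma Oriented.volume_hull_eq (h : Oriented v) (hn : 3 ≤ n) : volume (hull (Set.range v)) =
    ENNReal.ofReal ((n - 2) * Real.pi - ∑ i, interiorAngle v i) ∧
    0 ≤ (n - 2) * Real.pi - ∑ i, interiorAngle v i := by
  obtain ⟨m, rfl⟩ : ∃ m, n = m + 2 := ⟨n - 2, by omega⟩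
  have hsum := h.sum_fan (m := m) (by omega) (by omega)
  have e1 : interiorAngle v ((0 : ℕ) : ZMod (m + 2)) =
      ang (v (0 : ℕ)) (v (1 : ℕ)) (v (m + 1 : ℕ)) := by
    unfold interiorAngle
    have h1 : ((0 : ℕ) : ZMod (m + 2)) + 1 = (1 : ℕ) := by simp
    have h2 : ((0 : ℕ) : ZMod (m + 2)) - 1 = (m + 1 : ℕ) := by
      have : ((m + 2 : ℕ) : ZMod (m + 2)) = 0 := ZMod.natCast_self _
      push_cast at this ⊢
      linear_combination -this
    rw [h1, h2]
  have e2 : interiorAngle v ((m + 1 : ℕ) : ZMod (m + 2)) =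
      ang (v (m + 1 : ℕ)) (v (0 : ℕ)) (v (m : ℕ)) := by
    unfold interiorAngle
    congr 2
    · have : ((m + 2 : ℕ) : ZMod (m + 2)) = 0 := ZMod.natCast_self _
      push_cast at this ⊢
      linear_combination this
    · push_cast; ring_nf
  have e3 : ∑ i, interiorAngle v i = ∑ i ∈ Finset.Ico 1 (m + 1), interiorAngle v (i : ℕ)
      + ang (v (0 : ℕ)) (v (1 : ℕ)) (v (m + 1 : ℕ))
      + ang (v (m + 1 : ℕ)) (v (0 : ℕ)) (v (m : ℕ)) := by
    rw [sum_zmod_eq_sum_range, Finset.sum_range_succ, e2, Finset.range_eq_Ico,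
      Finset.sum_eq_sum_Ico_succ_bot (by omega), e1]
    ring
  have e4 : ((m + 2 : ℕ) - 2 : ℝ) * Real.pi - ∑ i, interiorAngle v i =
      ∑ i ∈ Finset.Ico 1 (m + 1), (Real.pi
      - ang (v (0 : ℕ)) (v (i : ℕ)) (v (i + 1 : ℕ)) - ang (v (i : ℕ)) (v (i + 1 : ℕ)) (v (0 : ℕ))
      - ang (v (i + 1 : ℕ)) (v (0 : ℕ)) (v (i : ℕ))) := by
    rw [hsum, e3]; push_cast; ring
  rw [e4]
  refine ⟨h.volume_hull hn, Finset.sum_nonneg fun i hi => ?_⟩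
  rw [Finset.mem_Ico] at hi
  exact (tri_defect_pos (h.fan_pos hi.1 (by omega) (by omega))).le

end

/-! ### The right triangles of a butterfly -/

/-- The acute angle opposite to the leg `q` in the right triangle with leg `q` and hypotenuse
`w - q`. -/
noncomputable def phi (w q : ℝ) : ℝ := Real.arcsin (Real.sinh q / Real.sinh (w - q))

/-- The acute angle adjacent to the leg `q` in the right triangle with leg `q` and hypotenuse
`w - q`. -/
noncomputable def alpha (w q : ℝ) : ℝ :=
  Real.arccos (Real.sinh q * Real.cosh (w - q) / (Real.cosh q * Real.sinh (w - q)))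

section
variable {w q : ℝ}

lemma sinh_eq_split (w q : ℝ) : Real.sinh w =
    Real.sinh (w - q) * Real.cosh q + Real.cosh (w - q) * Real.sinh q := by
  rw [← Real.sinh_add]; congr 1; ring

lemma sinh_sub_eq_split (w q : ℝ) : Real.sinh (w - 2 * q) =
    Real.sinh (w - q) * Real.cosh q - Real.cosh (w - q) * Real.sinh q := by
  rw [← Real.sinh_sub]; congr 1; ring

lemma cosh_eq_split (w q : ℝ) : Real.cosh w =
    Real.cosh (w - q) * Real.cosh q + Real.sinh (w - q) * Real.sinh q := by
  rw [← Real.cosh_add]; congr 1; ring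

lemma cosh_sub_eq_split (w q : ℝ) : Real.cosh (w - 2 * q) =
    Real.cosh (w - q) * Real.cosh q - Real.sinh (w - q) * Real.sinh q := by
  rw [← Real.cosh_sub]; congr 1; ring

lemma sinh_mul_sinh_pos (h0 : 0 < q) (h1 : q < w / 2) :
    0 < Real.sinh w * Real.sinh (w - 2 * q) :=
  mul_pos (Real.sinh_pos_iff.2 (by linarith)) (Real.sinh_pos_iff.2 (by linarith))

/-- The derivative of `phi w`, where `sinh w * sinh (w - 2 * q) = sinh (w - q) ^ 2 - sinh q ^ 2`. -/
lemma hasDerivAt_phi (h0 : 0 < q) (h1 : q < w / 2) : HasDerivAt (phi w)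
    (Real.sinh w / (Real.sinh (w - q) * √(Real.sinh w * Real.sinh (w - 2 * q)))) q := by
  have hp : 0 < Real.sinh (w - q) := Real.sinh_pos_iff.2 (by linarith)
  have hST := sinh_mul_sinh_pos h0 h1
  have hd : HasDerivAt (fun q => Real.sinh q / Real.sinh (w - q))
      ((Real.cosh q * Real.sinh (w - q) - Real.sinh q * (Real.cosh (w - q) * -1)) /
        Real.sinh (w - q) ^ 2) q := by
    refine (Real.hasDerivAt_sinh q).div ?_ hp.ne'
    exact (Real.hasDerivAt_sinh (w - q)).comp q ((hasDerivAt_id q).const_sub w)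
  have hu1 : Real.sinh q / Real.sinh (w - q) < 1 := by
    rw [div_lt_one hp, Real.sinh_lt_sinh]; linarith
  have hu0 : 0 < Real.sinh q / Real.sinh (w - q) := div_pos (Real.sinh_pos_iff.2 h0) hp
  refine ((Real.hasDerivAt_arcsin (by linarith) hu1.ne).comp q hd).congr_deriv ?_
  have e : 1 - (Real.sinh q / Real.sinh (w - q)) ^ 2 =
      Real.sinh w * Real.sinh (w - 2 * q) / Real.sinh (w - q) ^ 2 := by
    rw [sinh_eq_split w q, sinh_sub_eq_split w q]
    field_simp
    linear_combination (-Real.sinh (w - q) ^ 2) * Real.cosh_sq q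
      + Real.sinh q ^ 2 * Real.cosh_sq (w - q)
  have e3 : Real.cosh q * Real.sinh (w - q) - Real.sinh q * (Real.cosh (w - q) * -1) =
      Real.sinh w := by
    rw [sinh_eq_split w q]; ring
  rw [e, e3, Real.sqrt_div hST.le, Real.sqrt_sq hp.le]
  have := (Real.sqrt_pos.2 hST).ne'
  field_simp

lemma hasDerivAt_alpha (h0 : 0 < q) (h1 : q < w / 2) : HasDerivAt (alpha w)
    (-(Real.sinh w / (Real.sinh (w - q) * √(Real.sinh w * Real.sinh (w - 2 * q)))) *
      (Real.cosh (w - 2 * q) / Real.cosh q)) q := by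
  have hp : 0 < Real.sinh (w - q) := Real.sinh_pos_iff.2 (by linarith)
  have hq : 0 < Real.sinh q := Real.sinh_pos_iff.2 h0
  have hcq : 0 < Real.cosh q := Real.cosh_pos q
  have hcp : 0 < Real.cosh (w - q) := Real.cosh_pos _
  have hST := sinh_mul_sinh_pos h0 h1
  have hT : 0 < Real.sinh (w - 2 * q) := Real.sinh_pos_iff.2 (by linarith)
  have e1 := sinh_eq_split w q
  have e2 := sinh_sub_eq_split w q
  have e4 := cosh_sub_eq_split w q
  have hsp : HasDerivAt (fun q => Real.sinh (w - q)) (Real.cosh (w - q) * -1) q :=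
    (Real.hasDerivAt_sinh (w - q)).comp q ((hasDerivAt_id q).const_sub w)
  have hcp' : HasDerivAt (fun q => Real.cosh (w - q)) (Real.sinh (w - q) * -1) q :=
    (Real.hasDerivAt_cosh (w - q)).comp q ((hasDerivAt_id q).const_sub w)
  have hd := ((Real.hasDerivAt_sinh q).mul hcp').div ((Real.hasDerivAt_cosh q).mul hsp)
    (mul_pos hcq hp).ne'
  have hu1 : Real.sinh q * Real.cosh (w - q) / (Real.cosh q * Real.sinh (w - q)) < 1 := by
    rw [div_lt_one (by positivity)]
    rw [e2] at hT
    linarith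
  have hu0 : 0 < Real.sinh q * Real.cosh (w - q) / (Real.cosh q * Real.sinh (w - q)) := by
    positivity
  refine ((Real.hasDerivAt_arccos (by linarith) hu1.ne).comp q hd).congr_deriv ?_
  have e : 1 - (Real.sinh q * Real.cosh (w - q) / (Real.cosh q * Real.sinh (w - q))) ^ 2 =
      Real.sinh w * Real.sinh (w - 2 * q) / (Real.cosh q * Real.sinh (w - q)) ^ 2 := by
    rw [e1, e2]
    field_simp
    ring
  have e3 : Real.sinh w * Real.cosh (w - 2 * q) =
      Real.cosh q * Real.cosh (w - q) * (Real.cosh q * Real.sinh (w - q)) +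
      Real.sinh q * Real.sinh (w - q) * -1 * (Real.cosh q * Real.sinh (w - q)) -
      Real.sinh q * Real.cosh (w - q) * (Real.sinh q * Real.sinh (w - q)) -
      Real.sinh q * Real.cosh (w - q) * (Real.cosh q * Real.cosh (w - q) * -1) := by
    rw [e1, e4]
    ring
  have hs := (Real.sqrt_pos.2 hST).ne'
  simp only [Pi.mul_apply]
  rw [e, Real.sqrt_div hST.le, Real.sqrt_sq (by positivity)]
  field_simp
  rw [e3]
  ring

/-- The negative of the derivative of `phi` with respect to `alpha`. -/
noncomputable def slope (w q : ℝ) : ℝ := Real.cosh q / Real.cosh (w - 2 * q)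

/-- The slope increases with `q` while `alpha` decreases, which is the convexity of `phi` as a function
of `alpha`. -/
lemma slope_lt {q q' : ℝ} (h0 : 0 < q) (hq : q < q') (h1 : q' < w / 2) :
    slope w q < slope w q' := by
  unfold slope
  refine div_lt_div₀ ?_ ?_ (Real.cosh_pos _).le (Real.cosh_pos _)
  · rw [Real.cosh_lt_cosh, abs_of_pos h0, abs_of_pos (h0.trans hq)]; exact hq
  · rw [Real.cosh_le_cosh, abs_of_pos (by linarith), abs_of_pos (by linarith)]; linarith

/-- The angle `phi` is a strictly convex function of the angle `alpha`: it lies above its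
tangents. -/
lemma tangent_lt {q q' : ℝ} (h0 : 0 < q) (h1 : q < w / 2) (h0' : 0 < q') (h1' : q' < w / 2)
    (hne : q ≠ q') :
    phi w q' + slope w q' * alpha w q' < phi w q + slope w q' * alpha w q := by
  set G : ℝ → ℝ := fun q => phi w q + slope w q' * alpha w q with hG
  set G' : ℝ → ℝ := fun q =>
    (Real.sinh w / (Real.sinh (w - q) * √(Real.sinh w * Real.sinh (w - 2 * q)))) *
      (1 - slope w q' / slope w q) with hG'
  have hd : ∀ q, 0 < q → q < w / 2 → HasDerivAt G (G' q) q := by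
    intro q h0 h1
    refine ((hasDerivAt_phi h0 h1).add ((hasDerivAt_alpha h0 h1).const_mul (slope w q'))).congr_deriv
      ?_
    simp only [hG']
    have : Real.cosh (w - 2 * q) / Real.cosh q = 1 / slope w q := by rw [slope, one_div_div]
    rw [this]; ring
  have hpos : ∀ q, 0 < q → q < w / 2 →
      0 < Real.sinh w / (Real.sinh (w - q) * √(Real.sinh w * Real.sinh (w - 2 * q))) := by
    intro q h0 h1
    have := Real.sqrt_pos.2 (sinh_mul_sinh_pos h0 h1)
    have : 0 < Real.sinh w := Real.sinh_pos_iff.2 (by linarith)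
    have : 0 < Real.sinh (w - q) := Real.sinh_pos_iff.2 (by linarith)
    positivity
  have hs : ∀ q, 0 < slope w q := fun q => div_pos (Real.cosh_pos _) (Real.cosh_pos _)
  rcases lt_or_gt_of_ne hne with h | h
  · have hanti : StrictAntiOn G (Set.Ioc 0 q') := by
      refine strictAntiOn_of_deriv_neg (convex_Ioc 0 q') (fun x hx =>
        (hd x hx.1 (hx.2.trans_lt h1')).continuousAt.continuousWithinAt) fun x hx => ?_
      rw [interior_Ioc] at hx
      rw [(hd x hx.1 (hx.2.trans h1')).deriv]
      refine mul_neg_of_pos_of_neg (hpos x hx.1 (hx.2.trans h1')) ?_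
      rw [sub_neg, one_lt_div (hs x)]
      exact slope_lt hx.1 hx.2 h1'
    exact hanti ⟨h0, h.le⟩ ⟨h0', le_rfl⟩ h
  · have hmono : StrictMonoOn G (Set.Ico q' (w / 2)) := by
      refine strictMonoOn_of_deriv_pos (convex_Ico q' (w / 2)) (fun x hx =>
        (hd x (h0'.trans_le hx.1) hx.2).continuousAt.continuousWithinAt) fun x hx => ?_
      rw [interior_Ico] at hx
      rw [(hd x (h0'.trans hx.1) hx.2).deriv]
      refine mul_pos (hpos x (h0'.trans hx.1) hx.2) ?_
      rw [sub_pos, div_lt_one (hs x)]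
      exact slope_lt h0' hx.1 hx.2
    exact hmono ⟨le_rfl, h1'⟩ ⟨h.le, h1⟩ h

/-- Jensen's inequality for `phi` as a function of `alpha`, with its equality case. As the function is
decreasing, an upper bound for the sum of the angles `alpha` is enough. -/
lemma jensen {ι : Type*} [Fintype ι] {q : ι → ℝ} {q' : ℝ} (h0 : ∀ i, 0 < q i)
    (h1 : ∀ i, q i < w / 2) (h0' : 0 < q') (h1' : q' < w / 2)
    (hsum : ∑ i, alpha w (q i) ≤ Fintype.card ι * alpha w q') :
    Fintype.card ι * phi w q' ≤ ∑ i, phi w (q i) ∧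
      (∑ i, phi w (q i) = Fintype.card ι * phi w q' → ∀ i, q i = q') := by
  have hs : 0 < slope w q' := div_pos (Real.cosh_pos _) (Real.cosh_pos _)
  have hle : ∀ i, phi w q' + slope w q' * alpha w q' ≤
      phi w (q i) + slope w q' * alpha w (q i) := by
    intro i
    rcases eq_or_ne (q i) q' with h | h
    · rw [h]
    · exact (tangent_lt (h0 i) (h1 i) h0' h1' h).le
  have hl : ∑ _i : ι, (phi w q' + slope w q' * alpha w q') =
      Fintype.card ι * phi w q' + slope w q' * (Fintype.card ι * alpha w q') := by
    simp; ring
  have hr : ∑ i, (phi w (q i) + slope w q' * alpha w (q i)) =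
      ∑ i, phi w (q i) + slope w q' * ∑ i, alpha w (q i) := by
    rw [Finset.sum_add_distrib, Finset.mul_sum]
  have hm := mul_le_mul_of_nonneg_left hsum hs.le
  refine ⟨?_, fun heq i => ?_⟩
  · have := Finset.sum_le_sum (s := Finset.univ) fun i _ => hle i
    rw [hl, hr] at this
    linarith
  · by_contra hne
    have := Finset.sum_lt_sum (s := Finset.univ) (fun i _ => hle i)
      ⟨i, Finset.mem_univ i, tangent_lt (h0 i) (h1 i) h0' h1' hne⟩
    rw [hl, hr] at this
    linarith

end

/-- The unoriented angle `∠ y x z` at `x`, from the hyperbolic law of cosines. -/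
noncomputable def uang (x y z : ℍ) : ℝ :=
  Real.arccos ((bil (vec x) (vec y) * bil (vec x) (vec z) - bil (vec y) (vec z)) /
      (Real.sinh (dist x y) * Real.sinh (dist x z)))

lemma uang_comm (x y z : ℍ) : uang x y z = uang x z y := by
  unfold uang
  rw [bil_comm (vec y) (vec z), mul_comm (bil _ _), mul_comm (Real.sinh _)]

/-- The angles of the triangle with a leg `q`, the hypotenuse `w - q` and a right angle at `t`. -/
lemma right_triangle {p t u : ℍ} {w q : ℝ} (h0 : 0 < q) (h1 : q < w / 2) (h2 : dist p t = q)
    (h3 : dist p u = w - q)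
    (h4 : bil (vec p) (vec u) = bil (vec p) (vec t) * bil (vec t) (vec u)) :
    uang p t u = alpha w q ∧ uang t u p = Real.pi / 2 ∧ uang u p t = phi w q := by
  have b1 : bil (vec p) (vec t) = Real.cosh q := by rw [bil_vec, h2]
  have b2 : bil (vec p) (vec u) = Real.cosh (w - q) := by rw [bil_vec, h3]
  have hsq : 0 < Real.sinh q := Real.sinh_pos_iff.2 h0
  have hsp : 0 < Real.sinh (w - q) := Real.sinh_pos_iff.2 (by linarith)
  have hcq := Real.cosh_pos q
  have hcp := Real.cosh_pos (w - q)
  have b3 : bil (vec t) (vec u) = Real.cosh (w - q) / Real.cosh q := by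
    rw [b1, b2] at h4
    rw [h4]; field_simp
  have e1 := Real.cosh_sq q
  have e2 := Real.cosh_sq (w - q)
  refine ⟨?_, ?_, ?_⟩
  · rw [uang, alpha, h2, h3, b1, b2, b3]
    congr 1
    field_simp
    linear_combination e1
  · rw [uang, bil_comm (vec t) (vec p), bil_comm (vec u) (vec p), h4]
    rw [mul_comm (bil (vec t) (vec u)), sub_self, zero_div, Real.arccos_zero]
  · have hlt : Real.sinh q < Real.sinh (w - q) := Real.sinh_lt_sinh.2 (by linarith)
    have hx : 0 ≤ Real.sinh q / Real.sinh (w - q) := by positivity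
    rw [uang, phi, Real.arcsin_eq_arccos hx]
    congr 1
    have hS : Real.sinh (dist u t) =
        √(Real.sinh (w - q) ^ 2 - Real.sinh q ^ 2) / Real.cosh q := by
      have h5 : 0 ≤ Real.sinh (dist u t) := Real.sinh_nonneg_iff.2 dist_nonneg
      rw [← Real.sqrt_sq h5, Real.sinh_sq, ← bil_vec, bil_comm, b3, div_pow,
        show Real.cosh (w - q) ^ 2 / Real.cosh q ^ 2 - 1 =
          (Real.sinh (w - q) ^ 2 - Real.sinh q ^ 2) / Real.cosh q ^ 2 by
            field_simp; linarith, Real.sqrt_div (by nlinarith), Real.sqrt_sq hcq.le]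
    have hpos : 0 < Real.sinh (w - q) ^ 2 - Real.sinh q ^ 2 := by nlinarith
    have hs := Real.sqrt_pos.2 hpos
    have hs2 := Real.mul_self_sqrt hpos.le
    rw [show 1 - (Real.sinh q / Real.sinh (w - q)) ^ 2 =
      (Real.sinh (w - q) ^ 2 - Real.sinh q ^ 2) / Real.sinh (w - q) ^ 2 by field_simp,
      Real.sqrt_div hpos.le, Real.sqrt_sq hsp.le, hS, dist_comm u p, h3, bil_comm (vec u) (vec p),
      bil_comm (vec u) (vec t), b1, b2, b3]
    field_simp
    linear_combination e2 - e1 - hs2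

/-! ### Butterflies -/

/-- Two segments `[u, t]` and `[u', t']` of length `w` with equal right triangles `u t u'` and
`u' t' u` cross in a point `p` that is equally far from `t` and `t'`. -/
lemma exists_butterfly {u t u' t' : ℍ} {w : ℝ}
    (h1 : bil (vec u) (vec t) = Real.cosh w) (h2 : bil (vec u') (vec t') = Real.cosh w)
    (hw : 0 < w) (h3 : bil (vec u) (vec u') = Real.cosh w * bil (vec t) (vec u'))
    (h4 : bil (vec u) (vec u') = Real.cosh w * bil (vec t') (vec u))
    (d1 : 0 < det (vec u) (vec t) (vec u')) (d2 : det (vec u) (vec t) (vec t') < 0)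
    (d3 : 0 < det (vec u') (vec t') (vec t)) (d4 : det (vec u') (vec t') (vec u) < 0) :
    ∃ (p : ℍ) (q x y x' y' : ℝ), 0 < q ∧ q < w / 2 ∧ 0 < x ∧ 0 < y ∧ 0 < x' ∧ 0 < y' ∧
      vec p = x • vec u + y • vec t ∧ vec p = x' • vec u' + y' • vec t' ∧
      dist p t = q ∧ dist p t' = q ∧ dist p u = w - q ∧ dist p u' = w - q ∧
      bil (vec p) (vec u') = bil (vec p) (vec t) * bil (vec t) (vec u') ∧
      bil (vec p) (vec u) = bil (vec p) (vec t') * bil (vec t') (vec u) := by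
  set c1 := det (vec u') (vec t') (vec t) with hc1
  set c2 := det (vec u') (vec t') (vec u) with hc2
  -- Cramer's rule for the four vectors, which gives the crossing of the two segments
  have hrel : c1 • vec u + (-c2) • vec t =
      (-det (vec u) (vec t) (vec t')) • vec u' + det (vec u) (vec t) (vec u') • vec t' := by
    rw [hc1, hc2]
    ext <;> simp [det] <;> ring
  obtain ⟨p, r, hr, -, hp⟩ := (future_comb (x := u) (y := t) d3.le (neg_pos.2 d4).le
    (by linarith)).exists_vec
  have hp1 : vec p = (c1 / r) • vec u + (-c2 / r) • vec t := by
    rw [div_eq_inv_mul, div_eq_inv_mul, mul_smul, mul_smul, ← smul_add, hp, smul_smul,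
      inv_mul_cancel₀ hr.ne', one_smul]
  have hp2 : vec p = (-det (vec u) (vec t) (vec t') / r) • vec u' +
      (det (vec u) (vec t) (vec u') / r) • vec t' := by
    rw [div_eq_inv_mul, div_eq_inv_mul, mul_smul, mul_smul, ← smul_add, ← hrel, hp, smul_smul,
      inv_mul_cancel₀ hr.ne', one_smul]
  have x0 : 0 < c1 / r := div_pos d3 hr
  have y0 : 0 < -c2 / r := div_pos (neg_pos.2 d4) hr
  have x0' : 0 < -det (vec u) (vec t) (vec t') / r := div_pos (neg_pos.2 d2) hr
  have y0' : 0 < det (vec u) (vec t) (vec u') / r := div_pos d1 hr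
  have n1 := (ne_of_det_pos d1).1
  have n2 := (ne_of_det_pos d1).2.1
  have n3 := (ne_of_det_pos d3).1
  obtain ⟨hs1, -, hpt⟩ := (mem_openSegment_iff n1).2 ⟨_, _, x0, y0, hp1⟩
  obtain ⟨hs2, -, hpt'⟩ := (mem_openSegment_iff n3).2 ⟨_, _, x0', y0', hp2⟩
  have hut : dist u t = w := by
    rw [bil_vec] at h1
    exact Real.cosh_injOn dist_nonneg hw.le h1
  have hut' : dist u' t' = w := by
    rw [bil_vec] at h2
    exact Real.cosh_injOn dist_nonneg hw.le h2
  change dist u p + dist p t = dist u t at hs1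
  change dist u' p + dist p t' = dist u' t' at hs2
  have r1 : bil (vec p) (vec u') = bil (vec p) (vec t) * bil (vec t) (vec u') := by
    rw [hp1]
    simp only [bil_add_left, bil_smul_left, bil_vec_self, h3, h1]
    ring
  have r2 : bil (vec p) (vec u) = bil (vec p) (vec t') * bil (vec t') (vec u) := by
    rw [hp2]
    simp only [bil_add_left, bil_smul_left, bil_vec_self, bil_comm (vec u') (vec u), h4, h2]
    ring
  set A := bil (vec t) (vec u') with hA
  have hA' : bil (vec t') (vec u) = A := by
    rw [h3] at h4
    exact (mul_left_cancel₀ (Real.cosh_pos w).ne' h4).symm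
  have hA1 : 1 < A := one_lt_bil n2
  set q := dist p t with hq
  set q' := dist p t' with hq'
  have e1 : dist p u = w - q := by rw [dist_comm]; linarith
  have e2 : dist p u' = w - q' := by rw [dist_comm]; linarith
  have f1 : Real.cosh (w - q') = Real.cosh q * A := by
    rw [← e2, ← bil_vec, r1, bil_vec]
  have f2 : Real.cosh (w - q) = Real.cosh q' * A := by
    rw [← e1, ← bil_vec, r2, bil_vec, hA']
  have q0 : 0 < q := dist_pos.2 hpt
  have q0' : 0 < q' := dist_pos.2 hpt'
  -- by the two right triangles, `cosh (w - 2 * q) = cosh (w - 2 * q')`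
  have hqq : q' = q := by
    have k1 := cosh_eq_split w q
    have k2 := cosh_eq_split w q'
    have k3 := cosh_sub_eq_split w q
    have k4 := cosh_sub_eq_split w q'
    have k5 : Real.cosh (w - q) * Real.cosh q = Real.cosh (w - q') * Real.cosh q' := by
      rw [f1, f2]; ring
    have k6 : Real.cosh (w - 2 * q) = Real.cosh (w - 2 * q') := by linarith
    rcases abs_eq_abs.1 (le_antisymm (Real.cosh_le_cosh.1 k6.le) (Real.cosh_le_cosh.1 k6.ge))
      with h | h
    · linarith
    · exfalso
      rw [show w - q' = q by linarith] at f1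
      have := Real.cosh_pos q
      nlinarith
  rw [hqq] at e2 f1
  have hlt : q < w / 2 := by
    have : Real.cosh q < Real.cosh (w - q) := by
      rw [f1]
      have := Real.cosh_pos q
      nlinarith
    rw [Real.cosh_lt_cosh, abs_of_pos q0, abs_of_nonneg (by rw [← e1]; exact dist_nonneg)] at this
    linarith
  exact ⟨p, q, _, _, _, _, q0, hlt, x0, y0, x0', y0', hp1, hp2, rfl, hqq, e1, e2, r1, r2⟩

/-- An ordinary reduced polygon of thickness `w` in terms of its vertices `u j` in star order, which is the order in
which `u j` and `u (j + 2)` are neighbours, and of the projections `t j` of `u j` on the opposite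
side `[u (j - 1), u (j + 1)]`. The polygon is counterclockwise (`pos`), and the right angles at the feet are
expressed by the Pythagorean theorem (`right`, `left`). -/
structure StarData (n : ℕ) (w : ℝ) (u t : ZMod n → ℍ) : Prop where
  three_le : 3 ≤ n
  odd : Odd n
  w_pos : 0 < w
  pos : ∀ i k j, k = i + 2 → j ≠ i → j ≠ k → 0 < det (vec (u i)) (vec (u k)) (vec (u j))
  foot : ∀ j, ∃ a b : ℝ, 0 < a ∧ 0 < b ∧ vec (t j) = a • vec (u (j - 1)) + b • vec (u (j + 1))
  bil_foot : ∀ j, bil (vec (u j)) (vec (t j)) = Real.cosh w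
  right : ∀ j, bil (vec (u j)) (vec (u (j + 1))) =
    Real.cosh w * bil (vec (t j)) (vec (u (j + 1)))
  left : ∀ j, bil (vec (u j)) (vec (u (j - 1))) =
    Real.cosh w * bil (vec (t j)) (vec (u (j - 1)))

namespace StarData

variable {n : ℕ} {w : ℝ} {u t : ZMod n → ℍ}

lemma nonneg (h : StarData n w u t) (i k j : ZMod n) (hk : k = i + 2) :
    0 ≤ det (vec (u i)) (vec (u k)) (vec (u j)) := by
  by_cases hj : j = i
  · subst hj; simp
  by_cases hj' : j = k
  · subst hj'; simp
  exact (h.pos i k j hk hj hj').le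

lemma one_ne (h : StarData n w u t) : (1 : ZMod n) ≠ 0 := ZMod.one_ne_zero_of_three_le h.three_le
lemma two_ne (h : StarData n w u t) : (2 : ZMod n) ≠ 0 := ZMod.two_ne_zero_of_three_le h.three_le

lemma four_ne (h : StarData n w u t) : (4 : ZMod n) ≠ 0 := by
  have : ((4 : ℕ) : ZMod n) ≠ 0 := by
    rw [Ne, ZMod.natCast_eq_zero_iff]
    intro hd
    have h1 := Nat.le_of_dvd (by norm_num) hd
    have h2 := h.three_le
    obtain ⟨k, hk⟩ := h.odd
    interval_cases n <;> omega
  simpa using this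

lemma mid_pos (h : StarData n w u t) (j : ZMod n) :
    0 < det (vec (u (j - 1))) (vec (u (j + 1))) (vec (u j)) :=
  h.pos _ _ _ (by ring) (fun e => h.one_ne (by linear_combination e))
    (fun e => h.one_ne (by linear_combination -e))

lemma next_pos (h : StarData n w u t) (j : ZMod n) :
    0 < det (vec (u j)) (vec (u (j + 2))) (vec (u (j + 1))) :=
  h.pos _ _ _ rfl (fun e => h.one_ne (by linear_combination e))
    (fun e => h.one_ne (by linear_combination -e))

lemma foot_left_pos (h : StarData n w u t) (j : ZMod n) :
    0 < det (vec (u j)) (vec (u (j + 2))) (vec (t j)) := by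
  obtain ⟨a, b, ha, hb, e⟩ := h.foot j
  rw [e, det_add_right, det_smul_right, det_smul_right]
  have := h.nonneg j (j + 2) (j - 1) rfl
  have := h.next_pos j
  positivity

/-- Of the line from `u j` to `t j`, the vertex `u (j + 1)` lies on the left, and `t (j + 1)` on the
right; together with the two mirrored statements this makes consecutive segments `[u j, t j]` cross. -/
lemma succ_left (h : StarData n w u t) (j : ZMod n) :
    0 < det (vec (u j)) (vec (t j)) (vec (u (j + 1))) := by
  obtain ⟨a, b, ha, hb, e⟩ := h.foot j
  rw [e, det_add_mid, det_smul_mid, det_smul_mid, det_self_right, mul_zero, add_zero, det_rot]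
  have := h.mid_pos j
  positivity

lemma foot_succ_right (h : StarData n w u t) (j : ZMod n) :
    det (vec (u j)) (vec (t j)) (vec (t (j + 1))) < 0 := by
  obtain ⟨a, b, ha, hb, e⟩ := h.foot (j + 1)
  rw [e, det_add_right, det_smul_right, det_smul_right, add_sub_cancel_right, det_self_outer,
    mul_zero, zero_add, det_swap, show j + 1 + 1 = j + 2 by ring]
  have := mul_pos hb (h.foot_left_pos j)
  linarith

lemma foot_left_of_succ (h : StarData n w u t) (j : ZMod n) :
    0 < det (vec (u (j + 1))) (vec (t (j + 1))) (vec (t j)) := by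
  obtain ⟨a, b, ha, hb, e⟩ := h.foot j
  obtain ⟨a', b', ha', hb', e'⟩ := h.foot (j + 1)
  rw [e, det_add_right, det_smul_right, det_smul_right, det_self_outer, mul_zero, add_zero,
    ← det_rot, e', det_add_right, det_smul_right, det_smul_right, add_sub_cancel_right]
  have := h.mid_pos j
  have := h.nonneg (j - 1) (j + 1) (j + 1 + 1) (by ring)
  positivity

lemma right_of_succ (h : StarData n w u t) (j : ZMod n) :
    det (vec (u (j + 1))) (vec (t (j + 1))) (vec (u j)) < 0 := by
  obtain ⟨a, b, ha, hb, e⟩ := h.foot (j + 1)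
  rw [e, det_add_mid, det_smul_mid, det_smul_mid, add_sub_cancel_right, det_self_right,
    mul_zero, zero_add, ← det_rot, det_swap, show j + 1 + 1 = j + 2 by ring]
  have := mul_pos hb (h.next_pos j)
  linarith

/-- The segments `[u j, t j]` and `[u (j + 1), t (j + 1)]` cross. -/
lemma exists_crossing (h : StarData n w u t) (j : ZMod n) :
    ∃ (p : ℍ) (q x y x' y' : ℝ), 0 < q ∧ q < w / 2 ∧ 0 < x ∧ 0 < y ∧ 0 < x' ∧ 0 < y' ∧
      vec p = x • vec (u j) + y • vec (t j) ∧
      vec p = x' • vec (u (j + 1)) + y' • vec (t (j + 1)) ∧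
      dist p (t j) = q ∧ dist p (t (j + 1)) = q ∧ dist p (u j) = w - q ∧
      dist p (u (j + 1)) = w - q ∧
      bil (vec p) (vec (u (j + 1))) =
        bil (vec p) (vec (t j)) * bil (vec (t j)) (vec (u (j + 1))) ∧
      bil (vec p) (vec (u j)) =
        bil (vec p) (vec (t (j + 1))) * bil (vec (t (j + 1))) (vec (u j)) := by
  refine exists_butterfly (h.bil_foot j) (h.bil_foot (j + 1)) h.w_pos (h.right j) ?_ (h.succ_left j)
    (h.foot_succ_right j) (h.foot_left_of_succ j) (h.right_of_succ j)
  have := h.left (j + 1)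
  rwa [add_sub_cancel_right, bil_comm] at this

/-- Every point to the left of all sides lies in one of the two triangles of some butterfly: as `n`
is odd, the point cannot change sides at each step from the line `u j t j` to the next. -/
lemma exists_mem_butterfly (h : StarData n w u t) {p : ZMod n → ℍ}
    (hp : ∀ j, ∃ x y : ℝ, 0 < x ∧ 0 < y ∧ vec (p j) = x • vec (u j) + y • vec (t j))
    (hp' : ∀ j, ∃ x y : ℝ, 0 < x ∧ 0 < y ∧
      vec (p j) = x • vec (u (j + 1)) + y • vec (t (j + 1))) {o : ℍ}
    (ho : ∀ j, 0 ≤ det (vec (u j)) (vec (u (j + 2))) (vec o)) :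
    ∃ j, o ∈ tri (p j) (t j) (u (j + 1)) ∨ o ∈ tri (p j) (u j) (t (j + 1)) := by
  have : NeZero n := ⟨by have := h.three_le; omega⟩
  set f : ZMod n → ℝ := fun j => det (vec (u j)) (vec (t j)) (vec o) with hf
  -- otherwise the product of all `-(f j * f (j + 1))` is positive, while it is minus a square
  have hex : ∃ j, 0 ≤ f j * f (j + 1) := by
    by_contra hcon
    push Not at hcon
    have h1 : ∏ j, (-(f j * f (j + 1))) = -(∏ j, f j) ^ 2 := by
      have e : ∏ j, f (j + 1) = ∏ j, f j := Fintype.prod_equiv (Equiv.addRight 1) _ _ fun _ => rfl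
      rw [Finset.prod_neg, Finset.prod_mul_distrib, e, Finset.card_univ, ZMod.card, h.odd.neg_one_pow]
      ring
    have h2 : 0 < ∏ j, (-(f j * f (j + 1))) :=
      Finset.prod_pos fun j _ => neg_pos.2 (hcon j)
    rw [h1] at h2
    linarith [sq_nonneg (∏ j, f j)]
  obtain ⟨j, hj⟩ := hex
  obtain ⟨x, y, hx, hy, e⟩ := hp j
  obtain ⟨x', y', hx', hy', e'⟩ := hp' j
  obtain ⟨a, b, ha, hb, et⟩ := h.foot j
  obtain ⟨a', b', ha', hb', et'⟩ := h.foot (j + 1)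
  have s1 := ho (j - 1)
  rw [show j - 1 + 2 = j + 1 by ring] at s1
  have s2 := ho j
  have key : (0 ≤ f j ∧ 0 ≤ f (j + 1)) ∨ (f j ≤ 0 ∧ f (j + 1) ≤ 0) := mul_nonneg_iff.1 hj
  refine ⟨j, ?_⟩
  rcases key with ⟨k1, k2⟩ | ⟨k1, k2⟩
  · refine Or.inl ⟨?_, ?_, ?_⟩
    · rw [e]; simpa using mul_nonneg hx.le k1
    · rw [et]; simpa using mul_nonneg ha.le s1
    · rw [e']; simpa using mul_nonneg hy'.le k2
  · refine Or.inr ⟨?_, ?_, ?_⟩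
    · rw [e, det_swap']
      have := mul_nonneg hy.le (neg_nonneg.2 k1)
      simp only [hf] at this
      simp
      linarith
    · rw [et', add_sub_cancel_right, show j + 1 + 1 = j + 2 by ring]
      simpa using mul_nonneg hb'.le s2
    · rw [e', det_swap']
      have := mul_nonneg hx'.le (neg_nonneg.2 k2)
      simp only [hf] at this
      rw [det_add_left, det_smul_left, det_smul_left, det_self_left]
      linarith

end StarData

/-! ### The area of an ordinary reduced polygon -/

lemma ang_eq_uang {x y z : ℍ} (h : 0 < det (vec x) (vec y) (vec z)) : ang x y z = uang x y z :=
  ang_eq_arccos h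

/-- For odd `n`, the index `(n + 1) / 2` is the inverse of `2` modulo `n`. -/
lemma half_mul_two {n : ℕ} (hn : Odd n) : (((n + 1) / 2 : ℕ) : ZMod n) * 2 = 1 := by
  obtain ⟨k, hk⟩ := hn
  have h1 : (n + 1) / 2 * 2 = n + 1 := by omega
  have : (((n + 1) / 2 * 2 : ℕ) : ZMod n) = ((n + 1 : ℕ) : ZMod n) := by rw [h1]
  push_cast at this
  rw [this]; simp

lemma two_mul_bijective {n : ℕ} (hn : Odd n) :
    Function.Bijective fun i : ZMod n => 2 * i := by
  have h := half_mul_two hn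
  refine ⟨fun i j hij => ?_, fun j => ⟨((n + 1) / 2 : ℕ) * j, ?_⟩⟩
  · have hij : 2 * i = 2 * j := hij
    linear_combination (((n + 1) / 2 : ℕ) : ZMod n) * hij - (i - j) * h
  · change 2 * _ = j
    linear_combination j * h

/-- The parameter `q` of a butterfly is determined by the distance of a foot from an adjacent vertex,
whose hyperbolic cosine is `A`. -/
lemma eq_of_cosh_div {w q q' A : ℝ} (h0 : 0 < q) (h1 : q < w / 2) (h0' : 0 < q') (h1' : q' < w / 2)
    (h : Real.cosh (w - q) = A * Real.cosh q) (h' : Real.cosh (w - q') = A * Real.cosh q') :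
    q = q' := by
  have key : ∀ q q' : ℝ, 0 < q → q < q' → q' < w / 2 → Real.cosh (w - q) = A * Real.cosh q →
      Real.cosh (w - q') = A * Real.cosh q' → False := by
    intro q q' h0 hlt h1' h h'
    have e1 : Real.cosh q < Real.cosh q' := by
      rw [Real.cosh_lt_cosh, abs_of_pos h0, abs_of_pos (by linarith)]; exact hlt
    have e2 : Real.cosh (w - q') < Real.cosh (w - q) := by
      rw [Real.cosh_lt_cosh, abs_of_pos (by linarith), abs_of_pos (by linarith)]; linarith
    rw [h, h'] at e2
    have := Real.cosh_pos q
    have := Real.cosh_pos (w - q)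
    have hA : 0 < A := by
      by_contra hneg
      nlinarith
    nlinarith
  rcases lt_trichotomy q q' with hlt | heq | hlt
  · exact (key q q' h0 hlt h1' h h').elim
  · exact heq
  · exact (key q' q h0' hlt h1 h' h).elim

namespace StarData

variable {n : ℕ} {w : ℝ} {u t : ZMod n → ℍ}

/-- Doubling the indices leads from the star order to the cyclic order. -/
lemma oriented (h : StarData n w u t) : Oriented fun i => u (2 * i) := by
  intro i j hj hj'
  refine h.pos _ _ _ (by ring) (fun e => hj ((two_mul_bijective h.odd).1 e))
    (fun e => hj' ((two_mul_bijective h.odd).1 ?_))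
  change 2 * j = 2 * (i + 1)
  rw [e]

lemma range_eq (h : StarData n w u t) : (Set.range fun i => u (2 * i)) = Set.range u :=
  (two_mul_bijective h.odd).2.range_comp u

lemma det_nonneg_of_mem (h : StarData n w u t) {o : ℍ} (ho : o ∈ hull (Set.range u)) (j : ZMod n) :
    0 ≤ det (vec (u j)) (vec (u (j + 2))) (vec o) := by
  rw [← h.range_eq, h.oriented.mem_hull_iff h.three_le] at ho
  obtain ⟨i, hi⟩ := (two_mul_bijective h.odd).2 j
  have := ho i
  rw [← hi]
  rwa [show 2 * i + 2 = 2 * (i + 1) by ring]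

/-- The angles in the two right triangles of a butterfly. -/
lemma angles (h : StarData n w u t) {j : ZMod n} {p : ℍ} {q x y x' y' : ℝ} (q0 : 0 < q)
    (q1 : q < w / 2) (hx : 0 < x) (hy' : 0 < y')
    (e : vec p = x • vec (u j) + y • vec (t j))
    (e' : vec p = x' • vec (u (j + 1)) + y' • vec (t (j + 1))) (hy : 0 < y)
    (d1 : dist p (t j) = q) (d2 : dist p (t (j + 1)) = q) (d3 : dist p (u j) = w - q)
    (d4 : dist p (u (j + 1)) = w - q)
    (r1 : bil (vec p) (vec (u (j + 1))) =
        bil (vec p) (vec (t j)) * bil (vec (t j)) (vec (u (j + 1))))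
    (r2 : bil (vec p) (vec (u j)) =
        bil (vec p) (vec (t (j + 1))) * bil (vec (t (j + 1))) (vec (u j))) :
    ang (u (j + 1)) (t (j + 1)) (t j) = phi w q ∧ ang (u j) (t (j + 1)) (t j) = phi w q ∧
    volume (tri p (t j) (u (j + 1))) = ENNReal.ofReal (Real.pi / 2 - phi w q - alpha w q) ∧
    volume (tri p (u j) (t (j + 1))) = ENNReal.ofReal (Real.pi / 2 - phi w q - alpha w q) ∧
    0 ≤ Real.pi / 2 - phi w q - alpha w q := by
  have D1 : 0 < det (vec p) (vec (t j)) (vec (u (j + 1))) := by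
    rw [e]
    simpa using mul_pos hx (h.succ_left j)
  have D2 : 0 < det (vec p) (vec (u j)) (vec (t (j + 1))) := by
    rw [e, det_add_left, det_smul_left, det_smul_left, det_self_left, det_swap']
    have := mul_neg_of_pos_of_neg hy (h.foot_succ_right j)
    linarith
  obtain ⟨a1, a2, a3⟩ := right_triangle q0 q1 d1 d4 r1
  obtain ⟨b1, b2, b3⟩ := right_triangle q0 q1 d2 d3 r2
  have D1' : 0 < det (vec (t j)) (vec (u (j + 1))) (vec p) := by rwa [← det_rot]
  have D1'' : 0 < det (vec (u (j + 1))) (vec p) (vec (t j)) := by rwa [det_rot]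
  have D2' : 0 < det (vec (u j)) (vec (t (j + 1))) (vec p) := by rwa [← det_rot]
  have D2'' : 0 < det (vec (t (j + 1))) (vec p) (vec (u j)) := by rwa [det_rot]
  have v1 := volume_tri_eq D1
  have v2 := volume_tri_eq D2
  have v3 := tri_defect_pos D1
  rw [ang_eq_uang D1, ang_eq_uang D1', ang_eq_uang D1'', a1, a2, a3] at v1 v3
  rw [ang_eq_uang D2, ang_eq_uang D2', ang_eq_uang D2'', uang_comm p, b1, uang_comm (u j), b3,
    uang_comm (t (j + 1)), b2] at v2
  refine ⟨?_, ?_, ?_, ?_, by linarith⟩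
  · rw [← ang_congr_left hy' e', ang_eq_uang D1'', a3]
  · rw [← ang_congr_right hy e, ang_eq_uang D2', uang_comm, b3]
  · rw [v1]; congr 1; ring
  · rw [v2]; congr 1; ring

/-- The vertex `u j` splits its interior angle along the line to its foot `t j`. -/
lemma interiorAngle_eq (h : StarData n w u t) (i : ZMod n) :
    interiorAngle (fun i => u (2 * i)) i =
      ang (u (2 * i)) (t (2 * i + 1)) (t (2 * i)) +
      ang (u (2 * i - 1 + 1)) (t (2 * i - 1 + 1)) (t (2 * i - 1)) := by
  obtain ⟨a, b, ha, hb, e⟩ := h.foot (2 * i + 1)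
  obtain ⟨a', b', ha', hb', e'⟩ := h.foot (2 * i - 1)
  rw [add_sub_cancel_right, show 2 * i + 1 + 1 = 2 * i + 2 by ring] at e
  rw [sub_add_cancel, add_comm, show 2 * i - 1 - 1 = 2 * i - 2 by ring] at e'
  unfold interiorAngle
  rw [sub_add_cancel, ang_congr_left hb e, ang_congr_right ha' e']
  change ang (u (2 * i)) (u (2 * (i + 1))) (u (2 * (i - 1))) = _
  rw [show 2 * (i + 1) = 2 * i + 2 by ring, show 2 * (i - 1) = 2 * i - 2 by ring]
  symm
  apply ang_add
  · exact h.foot_left_pos _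
  · rw [← det_rot]
    obtain ⟨a, b, ha, hb, e⟩ := h.foot (2 * i)
    rw [e, det_add_right, det_smul_right, det_smul_right]
    have h1 := h.next_pos (2 * i - 2)
    have h2 := h.nonneg (2 * i - 2) (2 * i) (2 * i + 1) (by ring)
    rw [show 2 * i - 2 + 2 = 2 * i by ring, show 2 * i - 2 + 1 = 2 * i - 1 by ring] at h1
    positivity
  · exact h.pos _ _ _ rfl (fun e => h.two_ne (by linear_combination -e))
      (fun e => h.four_ne (by linear_combination -e))

/-- The area of an ordinary reduced polygon in terms of the angles `phi` of its butterflies, and the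
bound for the angles `alpha` at the crossings that the covering by butterflies provides. -/
lemma exists_param (h : StarData n w u t) [NeZero n] : ∃ q : ZMod n → ℝ,
    (∀ j, 0 < q j) ∧ (∀ j, q j < w / 2) ∧
    (∀ j, Real.cosh (w - q j) = bil (vec (t j)) (vec (u (j + 1))) * Real.cosh (q j)) ∧
    volume (hull (Set.range u)) =
      ENNReal.ofReal ((n - 2) * Real.pi - 2 * ∑ j, phi w (q j)) ∧
    0 ≤ (n - 2) * Real.pi - 2 * ∑ j, phi w (q j) ∧
    ∑ j, alpha w (q j) ≤ Real.pi := by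
  choose p q x y x' y' q0 q1 hx hy hx' hy' e e' d1 d2 d3 d4 r1 r2 using h.exists_crossing
  have A := fun j => h.angles (q0 j) (q1 j) (hx j) (hy' j) (e j) (e' j) (hy j) (d1 j) (d2 j) (d3 j)
    (d4 j) (r1 j) (r2 j)
  obtain ⟨V, V0⟩ := h.oriented.volume_hull_eq h.three_le
  -- each butterfly contributes twice the angle `phi` to the interior angles
  have hint : ∑ i, interiorAngle (fun i => u (2 * i)) i = 2 * ∑ j, phi w (q j) := by
    have h1 : ∀ i, interiorAngle (fun i => u (2 * i)) i =
        phi w (q (2 * i)) + phi w (q (2 * i - 1)) := by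
      intro i
      rw [h.interiorAngle_eq, (A (2 * i)).2.1, (A (2 * i - 1)).1]
    have h2 : ∑ i, phi w (q (2 * i)) = ∑ j, phi w (q j) :=
      (two_mul_bijective h.odd).sum_comp fun j => phi w (q j)
    have h3 : ∑ i, phi w (q (2 * i - 1)) = ∑ j, phi w (q j) := by
      rw [(two_mul_bijective h.odd).sum_comp fun j => phi w (q (j - 1))]
      exact Fintype.sum_equiv (Equiv.subRight 1) _ _ fun _ => rfl
    rw [Finset.sum_congr rfl fun i _ => h1 i, Finset.sum_add_distrib, h2, h3]
    ring
  rw [hint, h.range_eq] at V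
  rw [hint] at V0
  refine ⟨q, q0, q1, fun j => ?_, V, V0, ?_⟩
  · rw [← d4 j, ← bil_vec, r1 j, bil_vec, d1 j]; ring
  · -- the area is at most the total area of the butterflies
    have hcov : hull (Set.range u) ⊆
        ⋃ j, (tri (p j) (t j) (u (j + 1)) ∪ tri (p j) (u j) (t (j + 1))) := by
      intro o ho
      obtain ⟨j, hj⟩ := h.exists_mem_butterfly (p := p)
        (fun j => ⟨_, _, hx j, hy j, e j⟩) (fun j => ⟨_, _, hx' j, hy' j, e' j⟩)
        (h.det_nonneg_of_mem ho)
      exact Set.mem_iUnion.2 ⟨j, hj⟩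
    have hle : volume (hull (Set.range u)) ≤
        ENNReal.ofReal (∑ j, 2 * (Real.pi / 2 - phi w (q j) - alpha w (q j))) := by
      refine (measure_mono hcov).trans ((measure_iUnion_fintype_le _ _).trans ?_)
      rw [ENNReal.ofReal_sum_of_nonneg fun j _ => mul_nonneg zero_le_two (A j).2.2.2.2]
      refine Finset.sum_le_sum fun j _ => (measure_union_le _ _).trans ?_
      rw [(A j).2.2.1, (A j).2.2.2.1, ← ENNReal.ofReal_add (A j).2.2.2.2 (A j).2.2.2.2, two_mul]
    rw [V, ENNReal.ofReal_le_ofReal_iff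
      (Finset.sum_nonneg fun j _ => mul_nonneg zero_le_two (A j).2.2.2.2)] at hle
    have hsum : ∑ j, 2 * (Real.pi / 2 - phi w (q j) - alpha w (q j)) =
        n * Real.pi - 2 * ∑ j, phi w (q j) - 2 * ∑ j, alpha w (q j) := by
      rw [← Finset.mul_sum, Finset.sum_sub_distrib, Finset.sum_sub_distrib]
      simp
      ring
    rw [hsum] at hle
    linarith

end StarData

/-! ### Orthogonal projections and ordinary reduced polygons -/

namespace Line

variable {L : Line} {p t s x y : ℍ}

lemma segment_subset_carrier (hx : x ∈ L.carrier) (hy : y ∈ L.carrier) :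
    segment x y ⊆ L.carrier := by
  intro z hz
  obtain ⟨a, b, -, -, e⟩ := mem_segment_iff.1 hz
  rw [mem_carrier] at *
  rw [e, fn_comb, hx, hy]
  simp

/-- The Pythagorean theorem at the foot of a perpendicular. -/
lemma IsProj.bil_eq (h : L.IsProj p t) (hs : s ∈ L.carrier) :
    bil (vec p) (vec s) = bil (vec p) (vec t) * bil (vec t) (vec s) := by
  by_contra hne
  set c := bil (vec t) (vec s) with hc
  set m := bil (vec p) (vec t) with hm
  set b := bil (vec p) (vec s) - m * c with hb
  have hb0 : 0 < b ^ 2 := by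
    have : b ≠ 0 := sub_ne_zero.2 hne
    positivity
  have hst : t ≠ s := by
    rintro rfl
    simp [hc, ← hm] at hne
  have hc1 : 1 < c := one_lt_bil hst
  have hm1 : 1 ≤ m := one_le_bil _ _
  have hk : 0 < c ^ 2 - 1 := by nlinarith
  set k := c ^ 2 - 1 with hkdef
  -- moving `t` along the line by a small amount in the direction that decreases the distance
  set δ := 1 / (1 + m * k + b ^ 2 * k) with hδ
  have hden : 0 < 1 + m * k + b ^ 2 * k := by positivity
  have hδ0 : 0 < δ := by positivity
  have hδ1 : δ * (1 + m * k + b ^ 2 * k) = 1 := by rw [hδ]; field_simp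
  have hmk : 0 < δ * (m * k) := by positivity
  have hbk : 0 < δ * (b ^ 2 * k) := by positivity
  have hδle : δ < 1 := by linarith
  set Z : ℝ × ℝ × ℝ := vec t + (-(δ * b)) • (vec s - c • vec t) with hZ
  have hcs : bil (vec s) (vec t) = c := bil_comm _ _
  have hZZ : bil Z Z = 1 - δ ^ 2 * b ^ 2 * k := by
    rw [hZ]
    simp only [bil_add_left, bil_add_right, bil_sub_left, bil_sub_right, bil_smul_left,
      bil_smul_right, bil_vec_self, ← hc, hcs]
    rw [hkdef]; ring
  have hsmall : δ ^ 2 * b ^ 2 * k < 1 := by nlinarith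
  have hZt : bil Z (vec t) = 1 := by
    rw [hZ]
    simp only [bil_add_left, bil_sub_left, bil_smul_left, bil_vec_self, hcs]
    ring
  obtain ⟨z, r, hr, hr2, hz⟩ := (Future.of_bil_pos (t := t) (by linarith) (by linarith) :
    Future Z).exists_vec
  have hzL : z ∈ L.carrier := by
    have h1 := h.1
    rw [mem_carrier] at h1 hs ⊢
    have h2 : L.fn Z = 0 := by
      rw [show Z = (1 + δ * b * c) • vec t + (-(δ * b)) • vec s by
        rw [hZ]; ext <;> simp <;> ring, fn_comb, h1, hs]
      simp
    rw [hz, show r • vec z = r • vec z + (0 : ℝ) • vec z by simp, fn_comb] at h2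
    simpa [hr.ne'] using h2
  have hle : m ≤ bil (vec p) (vec z) := by
    have := h.2 z hzL
    rw [hm, bil_vec, bil_vec, Real.cosh_le_cosh, abs_of_nonneg dist_nonneg,
      abs_of_nonneg dist_nonneg]
    exact this
  have hpZ : bil (vec p) Z = m - δ * b ^ 2 := by
    rw [hZ]
    simp only [bil_add_right, bil_sub_right, bil_smul_right, ← hm]
    rw [hb]; ring
  rw [hz, bil_smul_right] at hpZ
  rw [hZZ] at hr2
  have hrle : r ≥ 1 - δ ^ 2 * b ^ 2 * k := by
    have hpos : 0 < δ ^ 2 * b ^ 2 * k := by positivity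
    nlinarith
  have h3 : m * (1 - δ ^ 2 * b ^ 2 * k) ≤ m - δ * b ^ 2 := by
    rw [← hpZ]; nlinarith
  have h4 : δ * b ^ 2 * (1 - δ * (m * k)) ≤ 0 := by linarith
  have h5 : 0 < δ * b ^ 2 * (1 - δ * (m * k)) := by
    apply mul_pos (by positivity); linarith
  linarith

/-- The converse of the Pythagorean theorem. -/
lemma isProj_of_bil (ht : t ∈ L.carrier) (h : ∀ s ∈ L.carrier,
    bil (vec p) (vec s) = bil (vec p) (vec t) * bil (vec t) (vec s)) : L.IsProj p t := by
  refine ⟨ht, fun s hs => dist_le_iff_bil.2 ?_⟩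
  rw [h s hs]
  nlinarith [one_le_bil t s, one_le_bil p t]

lemma IsProj.infDist_segment (h : L.IsProj p t) (hx : x ∈ L.carrier) (hy : y ∈ L.carrier)
    (ht : t ∈ segment x y) : Metric.infDist p (segment x y) = dist p t :=
  le_antisymm (Metric.infDist_le_dist_of_mem ht)
    ((Metric.le_infDist ⟨t, ht⟩).2 fun _ hs => h.2 _ (segment_subset_carrier hx hy hs))

end Line

/-- `v` numbers the vertices of the polygon `R` in cyclic order; each `v i` is at distance `w > 0`
from a relatively interior point `t` of the opposite side, and the triangles formed by `v i`, `t`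
and an end point of that side have a right angle at `t`. -/
structure Reduced (n : ℕ) (w : ℝ) (v : ZMod n → ℍ) (R : Set ℍ) : Prop where
  ngon : IsNGon n v R
  odd : Odd n
  w_pos : 0 < w
  foot : ∀ i, ∃ t : ℍ, t ∈ openSegment (v (i + ((n - 1) / 2 : ℕ))) (v (i + ((n + 1) / 2 : ℕ))) ∧
    bil (vec (v i)) (vec t) = Real.cosh w ∧
    bil (vec (v i)) (vec (v (i + ((n - 1) / 2 : ℕ)))) =
      Real.cosh w * bil (vec t) (vec (v (i + ((n - 1) / 2 : ℕ)))) ∧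
    bil (vec (v i)) (vec (v (i + ((n + 1) / 2 : ℕ)))) =
      Real.cosh w * bil (vec t) (vec (v (i + ((n + 1) / 2 : ℕ))))

lemma half_sub {n : ℕ} (hn : Odd n) :
    (((n - 1) / 2 : ℕ) : ZMod n) = -(((n + 1) / 2 : ℕ) : ZMod n) := by
  obtain ⟨k, hk⟩ := hn
  have h1 : (n - 1) / 2 + (n + 1) / 2 = n := by omega
  have : (((n - 1) / 2 + (n + 1) / 2 : ℕ) : ZMod n) = ((n : ℕ) : ZMod n) := by rw [h1]
  push_cast at this
  rw [ZMod.natCast_self] at this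
  linear_combination this

lemma half_ne_zero {n : ℕ} (hn : Odd n) (h3 : 3 ≤ n) : (((n + 1) / 2 : ℕ) : ZMod n) ≠ 0 := by
  intro h
  have := half_mul_two hn
  rw [h, zero_mul] at this
  exact ZMod.one_ne_zero_of_three_le h3 this.symm

section
variable {n : ℕ} {w : ℝ} {R : Set ℍ} {v : ZMod n → ℍ}

lemma IsOrdinaryReduced.exists_reduced (hR : IsOrdinaryReduced n w R) :
    ∃ v, Reduced n w v R := by
  obtain ⟨hn, -, v, hv, h⟩ := hR
  refine ⟨v, hv, hn, ?_, fun i => ?_⟩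
  · obtain ⟨hd, L, hp, hq, t, ht, hto⟩ := h 0
    rw [ht.infDist_segment hp hq hto.1] at hd
    rw [← hd, dist_pos]
    rintro e
    refine hv.notMem_segment (i := 0) ?_ ?_ (e ▸ hto.1)
    · simpa [half_sub hn] using half_ne_zero hn hv.three_le
    · simpa using half_ne_zero hn hv.three_le
  · obtain ⟨hd, L, hp, hq, t, ht, hto⟩ := h i
    rw [ht.infDist_segment hp hq hto.1] at hd
    refine ⟨t, hto, by rw [bil_vec, hd], ?_, ?_⟩
    · rw [ht.bil_eq hp, bil_vec _ t, hd]
    · rw [ht.bil_eq hq, bil_vec _ t, hd]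

namespace Reduced

lemma isOrdinaryReduced (h : Reduced n w v R) (hw : thickness R = w) :
    IsOrdinaryReduced n w R := by
  refine ⟨h.odd, hw, v, h.ngon, fun i => ?_⟩
  obtain ⟨t, ht, e0, e1, e2⟩ := h.foot i
  intro p q
  have hpq : p ≠ q := by
    intro e
    have := h.ngon.injective e
    rw [add_right_inj, half_sub h.odd] at this
    refine ZMod.one_ne_zero_of_three_le h.ngon.three_le ?_
    rw [← half_mul_two h.odd]
    linear_combination -this
  have hp : p ∈ (lineThrough hpq).carrier := by
    rw [Line.mem_carrier, fn_lineThrough]; simp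
  have hq : q ∈ (lineThrough hpq).carrier := by
    rw [Line.mem_carrier, fn_lineThrough]; simp
  have htL := Line.segment_subset_carrier hp hq ht.1
  have hproj : (lineThrough hpq).IsProj (v i) t := by
    refine Line.isProj_of_bil htL fun s hs => ?_
    rw [Line.mem_carrier, fn_lineThrough] at hs
    obtain ⟨a, b, e⟩ := exists_comb_of_det_eq_zero hpq hs
    rw [e]
    simp only [bil_add_right, bil_smul_right]
    rw [e0, e1, e2]
    ring
  refine ⟨?_, lineThrough hpq, hp, hq, t, hproj, ht⟩
  rw [hproj.infDist_segment hp hq ht.1]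
  rw [bil_vec] at e0
  exact Real.cosh_injOn dist_nonneg h.w_pos.le e0

lemma neg (h : Reduced n w v R) : Reduced n w (fun i => v (-i)) R := by
  refine ⟨h.ngon.neg, h.odd, h.w_pos, fun i => ?_⟩
  obtain ⟨t, ht, e0, e1, e2⟩ := h.foot (-i)
  have f1 : -(i + (((n - 1) / 2 : ℕ) : ZMod n)) = -i + (((n + 1) / 2 : ℕ) : ZMod n) := by
    rw [half_sub h.odd]; ring
  have f2 : -(i + (((n + 1) / 2 : ℕ) : ZMod n)) = -i + (((n - 1) / 2 : ℕ) : ZMod n) := by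
    rw [half_sub h.odd]; ring
  rw [f1, f2]
  refine ⟨t, ?_, e0, e2, e1⟩
  obtain ⟨h1, h2, h3⟩ := ht
  refine ⟨?_, h3, h2⟩
  change dist _ t + dist t _ = dist _ _
  change dist _ t + dist t _ = dist _ _ at h1
  linarith [dist_comm (v (-i + ((n + 1) / 2 : ℕ))) t, dist_comm t (v (-i + ((n - 1) / 2 : ℕ))),
    dist_comm (v (-i + ((n + 1) / 2 : ℕ))) (v (-i + ((n - 1) / 2 : ℕ)))]

/-- In the counterclockwise case, multiplication of the indices by `(n + 1) / 2` leads from the cyclic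
order to the star order. -/
lemma exists_starData (h : Reduced n w v R) (ho : Oriented v) :
    ∃ t, StarData n w (fun j => v (((n + 1) / 2 : ℕ) * j)) t := by
  have h2 := half_mul_two h.odd
  have hs := half_sub h.odd
  set k : ZMod n := (((n + 1) / 2 : ℕ) : ZMod n) with hk
  have hf := fun j => h.foot (k * j)
  choose t ht e0 e1 e2 using hf
  have f1 : ∀ j, k * j + (((n - 1) / 2 : ℕ) : ZMod n) = k * (j - 1) := fun j => by
    rw [hs]; ring
  have f2 : ∀ j, k * j + (((n + 1) / 2 : ℕ) : ZMod n) = k * (j + 1) := fun j => by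
    rw [← hk]; ring
  have hne : ∀ j, k * (j - 1) ≠ k * (j + 1) := fun j e => by
    refine ZMod.one_ne_zero_of_three_le h.ngon.three_le ?_
    rw [← h2]; linear_combination -e
  simp only [f1, f2] at ht e1 e2
  have hinj : ∀ i j, k * i = k * j → i = j := fun i j e => by
    linear_combination 2 * e - (i - j) * h2
  refine ⟨t, h.ngon.three_le, h.odd, h.w_pos, ?_, fun j => ?_, e0, e2, e1⟩
  · rintro i _ j rfl h1 h3
    have := ho (k * i) (k * j) (fun e => h1 (hinj _ _ e))
      (fun e => h3 (hinj _ _ (by rw [e]; linear_combination -h2)))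
    rwa [show k * (i + 2) = k * i + 1 by linear_combination h2]
  · exact (mem_openSegment_iff (h.ngon.injective.ne (hne j))).1 (ht j)

lemma range_star (h : Reduced n w v R) :
    (Set.range fun j => v (((n + 1) / 2 : ℕ) * j)) = Set.range v := by
  have h2 := half_mul_two h.odd
  refine Function.Surjective.range_comp (f := fun j => (((n + 1) / 2 : ℕ) : ZMod n) * j)
    (fun j => ⟨2 * j, ?_⟩) v
  change _ * (2 * j) = j
  linear_combination j * h2

/-- An ordinary reduced polygon is a star, up to a reversal of the order of its vertices. -/
lemma exists_star (h : Reduced n w v R) :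
    ∃ u t, StarData n w u t ∧ R = hull (Set.range u) ∧ ∃ e, ∀ j, u j = v (e * j) := by
  rcases h.ngon.oriented_or with ho | ho
  · obtain ⟨t, ht⟩ := h.exists_starData ho
    exact ⟨_, t, ht, by rw [h.range_star]; exact h.ngon.eq_hull, _, fun j => rfl⟩
  · obtain ⟨t, ht⟩ := h.neg.exists_starData ho
    exact ⟨_, t, ht, by rw [h.neg.range_star]; exact h.neg.ngon.eq_hull, -((n + 1) / 2 : ℕ),
      fun j => by rw [neg_mul]⟩

end Reduced

lemma StarData.reduced {t : ZMod n → ℍ} (hv : IsNGon n v R)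
    (h : StarData n w (fun j => v (((n + 1) / 2 : ℕ) * j)) t) : Reduced n w v R := by
  refine ⟨hv, h.odd, h.w_pos, fun i => ⟨t (2 * i), ?_⟩⟩
  have h2 := half_mul_two h.odd
  have hs := half_sub h.odd
  have e0 := h.bil_foot (2 * i)
  have e1 := h.left (2 * i)
  have e2 := h.right (2 * i)
  have e3 := h.foot (2 * i)
  rw [hs]
  set k : ZMod n := (((n + 1) / 2 : ℕ) : ZMod n) with hk
  rw [show k * (2 * i - 1) = i + -k by linear_combination i * h2,
    show k * (2 * i + 1) = i + k by linear_combination i * h2] at e3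
  rw [show k * (2 * i - 1) = i + -k by linear_combination i * h2,
    show k * (2 * i) = i by linear_combination i * h2] at e1
  rw [show k * (2 * i + 1) = i + k by linear_combination i * h2,
    show k * (2 * i) = i by linear_combination i * h2] at e2
  rw [show k * (2 * i) = i by linear_combination i * h2] at e0
  refine ⟨(mem_openSegment_iff (hv.injective.ne fun e => ?_)).2 e3, e0, e1, e2⟩
  refine h.one_ne ?_
  rw [← h2]; linear_combination -e

/-- Isometries map polygons to polygons. -/
lemma IsNGon.image (h : IsNGon n v R) (g : ℍ ≃ᵢ ℍ) : IsNGon n (fun i => g (v i)) (g '' R) := by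
  have hr : (Set.range fun i => g (v i)) = g '' Set.range v := Set.range_comp g v
  refine ⟨h.three_le, fun i j e => h.injective (g.injective e), ?_, ?_, fun i => ?_, fun i => ?_⟩
  · rw [hr, ← image_hull, ← h.eq_hull]
  · rw [← g.coe_toHomeomorph, ← g.toHomeomorph.image_interior]
    exact h.interior_nonempty.image _
  · rw [hr, ← Set.image_singleton, ← Set.image_sdiff g.injective, ← image_hull]
    rintro ⟨x, hx, e⟩
    exact h.vertex i (g.injective e ▸ hx)
  · have hne : v i ≠ v (i + 1) := h.injective.ne fun e =>
      ZMod.one_ne_zero_of_three_le h.three_le (by simpa using e)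
    have hne' : g (v i) ≠ g (v (i + 1)) := g.injective.ne hne
    refine ⟨lineThrough hne', ?_, ?_, ⟨g (v i), ⟨v i, h.mem i, rfl⟩, ?_⟩, ?_⟩
    · rw [Line.mem_carrier, fn_lineThrough]; simp
    · rw [Line.mem_carrier, fn_lineThrough]; simp
    · rw [Line.mem_carrier, fn_lineThrough]; simp
    · obtain ⟨L, h1, h2, -, hL⟩ := h.side i
      obtain ⟨c, hc, hfn⟩ := L.exists_fn_eq hne h1 h2
      -- a third vertex determines the side of the line on which the image lies
      have h0 : ∃ z ∈ R, det (vec (v i)) (vec (v (i + 1))) (vec z) ≠ 0 := by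
        refine ⟨v (i + 1 + 1), h.mem _, h.det_ne_zero ?_ ?_ ?_⟩
        · intro e; exact ZMod.one_ne_zero_of_three_le h.three_le (by simpa using e)
        · intro e; exact ZMod.two_ne_zero_of_three_le h.three_le (by linear_combination -e)
        · intro e; exact ZMod.one_ne_zero_of_three_le h.three_le (by simpa using e)
      obtain ⟨z, hz, hz0⟩ := h0
      have key := fun y => det_mul_det_isometry g (v i) (v (i + 1)) y (v i) (v (i + 1)) z
      have hz0' : det (vec (g (v i))) (vec (g (v (i + 1)))) (vec (g z)) ≠ 0 := by
        intro e
        have := key z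
        rw [e] at this
        simp at this
        exact hz0 this
      set D := det (vec (v i)) (vec (v (i + 1))) (vec z)
      set D' := det (vec (g (v i))) (vec (g (v (i + 1)))) (vec (g z))
      have hside : (∀ y ∈ R, 0 ≤ det (vec (v i)) (vec (v (i + 1))) (vec y) * D) := by
        intro y hy
        have hyz : 0 ≤ (c * det (vec (v i)) (vec (v (i + 1))) (vec y)) * (c * D) := by
          rw [← hfn, ← hfn]
          rcases hL with hL | hL
          · exact mul_nonneg ((L.mem_posSide _).1 (hL hy)) ((L.mem_posSide _).1 (hL hz))
          · exact mul_nonneg_of_nonpos_of_nonpos ((L.mem_negSide _).1 (hL hy))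
              ((L.mem_negSide _).1 (hL hz))
        have hc2 : 0 < c ^ 2 := by positivity
        rw [show (c * det (vec (v i)) (vec (v (i + 1))) (vec y)) * (c * D) =
          c ^ 2 * (det (vec (v i)) (vec (v (i + 1))) (vec y) * D) by ring] at hyz
        exact nonneg_of_mul_nonneg_right hyz hc2
      rcases lt_or_gt_of_ne hz0' with hD | hD
      · right
        rintro _ ⟨y, hy, rfl⟩
        rw [Line.mem_negSide, fn_lineThrough]
        have h3 := hside y hy
        rw [← key y] at h3
        by_contra hcon
        nlinarith
      · left
        rintro _ ⟨y, hy, rfl⟩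
        rw [Line.mem_posSide, fn_lineThrough]
        have h3 := hside y hy
        rw [← key y] at h3
        by_contra hcon
        nlinarith

lemma Reduced.image (h : Reduced n w v R) (g : ℍ ≃ᵢ ℍ) :
    Reduced n w (fun i => g (v i)) (g '' R) := by
  refine ⟨h.ngon.image g, h.odd, h.w_pos, fun i => ?_⟩
  obtain ⟨t, ht, e⟩ := h.foot i
  refine ⟨g t, ⟨?_, g.injective.ne ht.2.1, g.injective.ne ht.2.2⟩, by simpa only [bil_isometry]⟩
  rw [← image_segment]
  exact ⟨t, ht.1, rfl⟩

end

/-! ### Sequences of points with constant consecutive distances -/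

/-- The points `x j` have constant distances to the next two points, and they turn consistently
in the same direction. -/
structure Recurrent {n : ℕ} (c₁ c₂ δ : ℝ) (x : ZMod n → ℍ) : Prop where
  one_lt : 1 < c₁
  step_one : ∀ j, bil (vec (x j)) (vec (x (j + 1))) = c₁
  step_two : ∀ j, bil (vec (x j)) (vec (x (j + 2))) = c₂
  turn : ∀ j, det (vec (x j)) (vec (x (j + 1))) (vec (x (j + 2))) = δ

namespace Recurrent

variable {n : ℕ} {c₁ c₂ δ : ℝ} {x : ZMod n → ℍ}

/-- A point is determined by its distances to the two preceding ones and by its side of the line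
through them, which turns the recursion into a linear one. -/
lemma succ_eq (h : Recurrent c₁ c₂ δ x) (j : ZMod n) :
    vec (x (j + 3)) = vec (x j) + ((c₂ - c₁) / (c₁ - 1)) • (vec (x (j + 2)) - vec (x (j + 1))) := by
  have hc : c₁ - 1 ≠ 0 := by have := h.one_lt; linarith
  have e1 := h.step_one j
  have e2 := h.step_one (j + 1)
  have e3 := h.step_one (j + 2)
  have e4 := h.step_two j
  have e5 := h.step_two (j + 1)
  have e6 := h.turn j
  have e7 := h.turn (j + 1)
  rw [show j + 1 + 1 = j + 2 by ring] at e2 e7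
  rw [show j + 1 + 2 = j + 3 by ring] at e5 e7
  rw [show j + 2 + 1 = j + 3 by ring] at e3
  have hne : x (j + 1) ≠ x (j + 2) := by
    intro e
    rw [e, bil_vec_self] at e2
    linarith [h.one_lt]
  refine eq_of_bil_of_det hne ?_ ?_ ?_
  · rw [bil_add_right, bil_smul_right, bil_sub_right, bil_vec_self, e2, e5, bil_comm, e1]
    field_simp
    ring
  · rw [bil_add_right, bil_smul_right, bil_sub_right, bil_vec_self, e3, bil_comm, e4,
      bil_comm, e2]
    field_simp
    ring
  · rw [e7, det_add_right, det_smul_right, det_sub_right, det_self_right, det_self_outer, ← det_rot,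
      e6]
    ring

/-- The distances in such a sequence are determined by the two constants. -/
lemma bil_add_natCast {δ' : ℝ} {x' : ZMod n → ℍ} (h : Recurrent c₁ c₂ δ x)
    (h' : Recurrent c₁ c₂ δ' x') (m : ℕ) (j j' : ZMod n) :
    bil (vec (x j)) (vec (x (j + m))) = bil (vec (x' j')) (vec (x' (j' + m))) := by
  induction m using Nat.strong_induction_on with
  | _ m ih =>
    match m, ih with
    | 0, _ => simp
    | 1, _ => simp [h.step_one, h'.step_one]
    | 2, _ => simp [h.step_two, h'.step_two]
    | m + 3, ih =>
      have i0 := ih m (by omega)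
      have i1 := ih (m + 1) (by omega)
      have i2 := ih (m + 2) (by omega)
      push_cast at i1 i2 ⊢
      rw [← add_assoc, ← add_assoc] at i1 i2 ⊢
      rw [h.succ_eq, h'.succ_eq]
      simp only [bil_add_right, bil_smul_right, bil_sub_right]
      rw [i0, i1, i2]

lemma bil_eq [NeZero n] {δ' : ℝ} {x' : ZMod n → ℍ} (h : Recurrent c₁ c₂ δ x)
    (h' : Recurrent c₁ c₂ δ' x') (d j j' : ZMod n) :
    bil (vec (x j)) (vec (x (j + d))) = bil (vec (x' j')) (vec (x' (j' + d))) := by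
  have := h.bil_add_natCast h' d.val j j'
  rwa [ZMod.natCast_zmod_val] at this

/-- A consistent direction of turning suffices, as the three distances determine the absolute value of
the determinant. -/
lemma of_pos (h1 : ∀ j, bil (vec (x j)) (vec (x (j + 1))) = c₁)
    (h2 : ∀ j, bil (vec (x j)) (vec (x (j + 2))) = c₂)
    (h3 : ∀ j, 0 < δ * det (vec (x j)) (vec (x (j + 1))) (vec (x (j + 2)))) :
    Recurrent c₁ c₂ (det (vec (x 0)) (vec (x 1)) (vec (x 2))) x := by
  have hne : x 0 ≠ x (0 + 1) := by
    intro e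
    have := h3 0
    rw [← e] at this
    simp at this
  refine ⟨by rw [← h1 0]; exact one_lt_bil hne, h1, h2, fun j => ?_⟩
  have hj := h3 j
  have h0 := h3 0
  have e := det_sq (x j) (x (j + 1)) (x (j + 2))
  have e0 := det_sq (x 0) (x 1) (x 2)
  have f1 := h1 (j + 1)
  have f2 := h1 (0 + 1)
  have f3 := h1 0
  have f4 := h2 0
  rw [show j + 1 + 1 = j + 2 by ring] at f1
  rw [show (0 : ZMod n) + 1 + 1 = 2 by ring, zero_add] at f2
  rw [zero_add] at f3 f4
  rw [h1, h2, f1] at e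
  rw [f2, f3, f4, ← e] at e0
  simp only [zero_add] at h0
  rcases sq_eq_sq_iff_eq_or_eq_neg.1 e0 with h | h
  · exact h.symm
  · rw [h] at h0
    linarith

end Recurrent

/-! ### Regular polygons -/

/-- The hyperbolic law of cosines for the angle measured in the disk model. -/
lemma inner_toDisk (p x y : ℍ) : inner ℝ (toDisk p x) (toDisk p y) *
    ((bil (vec p) (vec x) + 1) * (bil (vec p) (vec y) + 1)) =
      bil (vec p) (vec x) * bil (vec p) (vec y) - bil (vec x) (vec y) := by
  have hp := p.im_pos
  have hx := x.im_pos
  have hy := y.im_pos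
  have hN : ∀ z : ℍ, (z.re - p.re) ^ 2 + (z.im + p.im) ^ 2 ≠ 0 := fun z => by
    have := z.im_pos
    positivity
  have hre : ∀ z : ℍ, (toDisk p z).re = ((z.re - p.re) ^ 2 + z.im ^ 2 - p.im ^ 2) /
      ((z.re - p.re) ^ 2 + (z.im + p.im) ^ 2) := fun z => by
    simp only [toDisk, Complex.div_re, Complex.normSq_apply, Complex.sub_re, Complex.sub_im,
      UpperHalfPlane.coe_re, UpperHalfPlane.coe_im, Complex.conj_re, Complex.conj_im]
    rw [← add_div]
    congr 1 <;> ring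
  have him : ∀ z : ℍ, (toDisk p z).im = -2 * p.im * (z.re - p.re) /
      ((z.re - p.re) ^ 2 + (z.im + p.im) ^ 2) := fun z => by
    simp only [toDisk, Complex.div_im, Complex.normSq_apply, Complex.sub_re, Complex.sub_im,
      UpperHalfPlane.coe_re, UpperHalfPlane.coe_im, Complex.conj_re, Complex.conj_im]
    rw [← sub_div]
    congr 1 <;> ring
  have hb : ∀ z : ℍ, bil (vec p) (vec z) + 1 =
      ((z.re - p.re) ^ 2 + (z.im + p.im) ^ 2) / (2 * p.im * z.im) := fun z => by
    have := z.im_pos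
    simp only [bil, vec]
    field_simp
    ring
  have e : inner ℝ (toDisk p x) (toDisk p y) =
      (toDisk p x).re * (toDisk p y).re + (toDisk p x).im * (toDisk p y).im := by
    rw [Complex.inner]
    simp only [Complex.mul_re, Complex.conj_re, Complex.conj_im]
    ring
  rw [e, hb, hb, hre, hre, him, him]
  have h1 := hN x
  have h2 := hN y
  have e2 : ((x.re - p.re) ^ 2 + x.im ^ 2 - p.im ^ 2) /
      ((x.re - p.re) ^ 2 + (x.im + p.im) ^ 2) * (((y.re - p.re) ^ 2 + y.im ^ 2 - p.im ^ 2) /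
      ((y.re - p.re) ^ 2 + (y.im + p.im) ^ 2)) + -2 * p.im * (x.re - p.re) /
      ((x.re - p.re) ^ 2 + (x.im + p.im) ^ 2) * (-2 * p.im * (y.re - p.re) /
      ((y.re - p.re) ^ 2 + (y.im + p.im) ^ 2)) =
      (((x.re - p.re) ^ 2 + x.im ^ 2 - p.im ^ 2) * ((y.re - p.re) ^ 2 + y.im ^ 2 - p.im ^ 2) +
        4 * p.im ^ 2 * (x.re - p.re) * (y.re - p.re)) /
      (((x.re - p.re) ^ 2 + (x.im + p.im) ^ 2) * ((y.re - p.re) ^ 2 + (y.im + p.im) ^ 2)) := by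
    field_simp
    ring
  rw [e2]
  generalize (x.re - p.re) ^ 2 + (x.im + p.im) ^ 2 = N at *
  generalize (y.re - p.re) ^ 2 + (y.im + p.im) ^ 2 = M at *
  simp only [bil, vec]
  field_simp
  ring

/-- Two sides and the enclosed angle determine the third side. -/
lemma bil_eq_of_angle_eq {x p y x' p' y' : ℍ} (hx : dist p x = dist p' x')
    (hy : dist p y = dist p' y') (h : angle x p y = angle x' p' y') :
    bil (vec x) (vec y) = bil (vec x') (vec y') := by
  have hbx : bil (vec p) (vec x) = bil (vec p') (vec x') := by rw [bil_vec, bil_vec, hx]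
  have hby : bil (vec p) (vec y) = bil (vec p') (vec y') := by rw [bil_vec, bil_vec, hy]
  have norm_eq : ∀ p x p' x' : ℍ, bil (vec p) (vec x) = bil (vec p') (vec x') →
      ‖toDisk p x‖ = ‖toDisk p' x'‖ := by
    intro p x p' x' e
    have h1 := inner_toDisk p x x
    have h2 := inner_toDisk p' x' x'
    rw [real_inner_self_eq_norm_sq, bil_vec_self] at h1 h2
    have h3 := one_le_bil p' x'
    have h4 : ‖toDisk p x‖ ^ 2 = ‖toDisk p' x'‖ ^ 2 := by
      rw [e, ← h2] at h1
      exact mul_right_cancel₀ (by positivity) h1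
    exact (sq_eq_sq₀ (norm_nonneg _) (norm_nonneg _)).1 h4
  have hin : inner ℝ (toDisk p x) (toDisk p y) = inner ℝ (toDisk p' x') (toDisk p' y') := by
    rw [← InnerProductGeometry.cos_angle_mul_norm_mul_norm,
      ← InnerProductGeometry.cos_angle_mul_norm_mul_norm (toDisk p' x'), norm_eq _ _ _ _ hbx,
      norm_eq _ _ _ _ hby]
    change Real.cos (angle x p y) * _ = Real.cos (angle x' p' y') * _
    rw [h]
  have h1 := inner_toDisk p x y
  have h2 := inner_toDisk p' x' y'
  rw [hin, hbx, hby, h2] at h1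
  linarith

section
variable {n : ℕ} {R : Set ℍ}

/-- A regular polygon has a counterclockwise numbering of its vertices for which the distances of
vertices depend only on the difference of their indices. -/
lemma IsRegular.exists_circulant (h : IsRegular n R) : ∃ v : ZMod n → ℍ, IsNGon n v R ∧
    Oriented v ∧ ∀ d i j, bil (vec (v i)) (vec (v (i + d))) = bil (vec (v j)) (vec (v (j + d))) := by
  obtain ⟨v, hv, hs, ha⟩ := h
  have := hv.neZero
  have h1 := ZMod.one_ne_zero_of_three_le hv.three_le
  have h2 := ZMod.two_ne_zero_of_three_le hv.three_le
  have s1 : ∀ i j, bil (vec (v i)) (vec (v (i + 1))) = bil (vec (v j)) (vec (v (j + 1))) :=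
    fun i j => by rw [bil_vec, bil_vec, hs i j]
  have s2 : ∀ i j, bil (vec (v i)) (vec (v (i + 2))) = bil (vec (v j)) (vec (v (j + 2))) := by
    intro i j
    have := ha (i + 1) (j + 1)
    rw [add_sub_cancel_right, add_sub_cancel_right, show i + 1 + 1 = i + 2 by ring,
      show j + 1 + 1 = j + 2 by ring] at this
    refine bil_eq_of_angle_eq ?_ ?_ this
    · rw [dist_comm, hs i j, dist_comm]
    · have := hs (i + 1) (j + 1)
      rwa [show i + 1 + 1 = i + 2 by ring, show j + 1 + 1 = j + 2 by ring] at this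
  have circ : ∀ v : ZMod n → ℍ, Oriented v →
      (∀ i j, bil (vec (v i)) (vec (v (i + 1))) = bil (vec (v j)) (vec (v (j + 1)))) →
      (∀ i j, bil (vec (v i)) (vec (v (i + 2))) = bil (vec (v j)) (vec (v (j + 2)))) →
      ∀ d i j, bil (vec (v i)) (vec (v (i + d))) = bil (vec (v j)) (vec (v (j + d))) := by
    intro v ho s1 s2 d i j
    have hrec : Recurrent _ _ _ v := Recurrent.of_pos (δ := 1) (fun j => s1 j 0) (fun j => s2 j 0)
      (fun j => by
        rw [one_mul]
        exact ho j (j + 2) (fun e => h2 (by linear_combination e))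
          (fun e => h1 (by linear_combination e)))
    exact hrec.bil_eq hrec d i j
  rcases hv.oriented_or with ho | ho
  · exact ⟨v, hv, ho, circ v ho s1 s2⟩
  · refine ⟨_, hv.neg, ho, circ _ ho (fun i j => ?_) (fun i j => ?_)⟩
    · have := s1 (-(i + 1)) (-(j + 1))
      rw [show -(i + 1) + 1 = -i by ring, show -(j + 1) + 1 = -j by ring, bil_comm,
        bil_comm (vec (v (-(j + 1))))] at this
      exact this
    · have := s2 (-(i + 2)) (-(j + 2))
      rw [show -(i + 2) + 2 = -i by ring, show -(j + 2) + 2 = -j by ring, bil_comm,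
        bil_comm (vec (v (-(j + 2))))] at this
      exact this

/-- A regular polygon with an odd number of vertices consists of a star whose feet are the midpoints
of the sides. -/
lemma IsRegular.exists_starData (h : IsRegular n R) (hn : Odd n) :
    ∃ (v t : ZMod n → ℍ) (w : ℝ), IsNGon n v R ∧
      (∀ d i j, bil (vec (v i)) (vec (v (i + d))) = bil (vec (v j)) (vec (v (j + d)))) ∧
      StarData n w (fun j => v (((n + 1) / 2 : ℕ) * j)) t := by
  obtain ⟨v, hv, ho, hc⟩ := h.exists_circulant
  have h1 := ZMod.one_ne_zero_of_three_le hv.three_le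
  have h2 := half_mul_two hn
  set k : ZMod n := (((n + 1) / 2 : ℕ) : ZMod n) with hk
  have hinj : ∀ i j, k * i = k * j → i = j := fun i j e => by
    linear_combination 2 * e - (i - j) * h2
  set u : ZMod n → ℍ := fun j => v (k * j) with hu
  have hcirc : ∀ d i j, bil (vec (u i)) (vec (u (i + d))) = bil (vec (u j)) (vec (u (j + d))) := by
    intro d i j
    simp only [hu, mul_add]
    exact hc _ _ _
  have hpos : ∀ i l j, l = i + 2 → j ≠ i → j ≠ l →
      0 < det (vec (u i)) (vec (u l)) (vec (u j)) := by
    rintro i _ j rfl h1 h3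
    have := ho (k * i) (k * j) (fun e => h1 (hinj _ _ e))
      (fun e => h3 (hinj _ _ (by rw [e]; linear_combination -h2)))
    simp only [hu]
    rwa [show k * (i + 2) = k * i + 1 by linear_combination h2]
  have ht : ∀ j, ∃ (t : ℍ) (r : ℝ), 0 < r ∧
      r ^ 2 * (2 + 2 * bil (vec (u 0)) (vec (u (0 + 2)))) = 1 ∧
      vec t = r • (vec (u (j - 1)) + vec (u (j + 1))) := by
    intro j
    obtain ⟨t, r, hr, hr2, e⟩ := ((future_vec (u (j - 1))).add (future_vec (u (j + 1)))).exists_vec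
    refine ⟨t, r⁻¹, inv_pos.2 hr, ?_, ?_⟩
    · have e2 := hcirc 2 (j - 1) 0
      rw [show j - 1 + 2 = j + 1 by ring] at e2
      simp only [bil_add_left, bil_add_right, bil_vec_self, bil_comm (vec (u (j + 1))), e2] at hr2
      rw [show 2 + 2 * bil (vec (u 0)) (vec (u (0 + 2))) = r ^ 2 by rw [hr2]; ring]
      field_simp
    · rw [e, smul_smul, inv_mul_cancel₀ hr.ne', one_smul]
  choose t r hr hr2 e using ht
  have hrr : ∀ j, r j = r 0 := by
    intro j
    have e1 := hr2 j
    rw [← hr2 0] at e1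
    have : (2 + 2 * bil (vec (u 0)) (vec (u (0 + 2)))) ≠ 0 := by
      have := one_le_bil (u 0) (u (0 + 2))
      positivity
    have := mul_right_cancel₀ this e1
    exact (sq_eq_sq₀ (hr j).le (hr 0).le).1 this
  have c1 : ∀ j, bil (vec (u j)) (vec (u (j + 1))) = bil (vec (u 0)) (vec (u (0 + 1))) :=
    fun j => hcirc 1 j 0
  have c1' : ∀ j, bil (vec (u j)) (vec (u (j - 1))) = bil (vec (u 0)) (vec (u (0 + 1))) := by
    intro j
    rw [← c1 (j - 1), sub_add_cancel, bil_comm]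
  have c2 : ∀ j, bil (vec (u (j - 1))) (vec (u (j + 1))) = bil (vec (u 0)) (vec (u (0 + 2))) := by
    intro j
    rw [← hcirc 2 (j - 1) 0, show j - 1 + 2 = j + 1 by ring]
  have hft : ∀ j, bil (vec (u j)) (vec (t j)) = 2 * r 0 * bil (vec (u 0)) (vec (u (0 + 1))) := by
    intro j
    rw [e, bil_smul_right, bil_add_right, c1, c1', hrr]
    ring
  have hfoot : ∀ j, bil (vec (u j)) (vec (t j)) = Real.cosh (dist (u 0) (t 0)) := fun j => by
    rw [← bil_vec, hft, hft]
  have h0 : u 0 ≠ t 0 := by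
    intro e0
    have hp := hpos (0 - 1) (0 + 1) 0 (by ring) (fun e => h1 (by linear_combination e))
      (fun e => h1 (by linear_combination -e))
    rw [e0, e 0] at hp
    simp at hp
  refine ⟨v, t, dist (u 0) (t 0), hv, hc, hv.three_le, hn, dist_pos.2 h0, hpos, fun j => ?_, hfoot,
    fun j => ?_, fun j => ?_⟩
  · exact ⟨r j, r j, hr j, hr j, by rw [e j, smul_add]⟩
  · rw [← hfoot j, hft, c1, e, hrr j, bil_smul_left, bil_add_left, bil_vec_self, c2]
    linear_combination -bil (vec (u 0)) (vec (u (0 + 1))) * hr2 0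
  · rw [← hfoot j, hft, c1', e, hrr j, bil_smul_left, bil_add_left, bil_vec_self,
      bil_comm (vec (u (j + 1))), c2]
    linear_combination -bil (vec (u 0)) (vec (u (0 + 1))) * hr2 0

end

/-! ### Comparison of the areas -/

namespace StarData

variable {n : ℕ} {w A : ℝ} {u t : ZMod n → ℍ}

lemma step_one (h : StarData n w u t) (hA : ∀ j, bil (vec (t j)) (vec (u (j + 1))) = A)
    (j : ZMod n) : bil (vec (u j)) (vec (u (j + 1))) = Real.cosh w * A := by
  rw [h.right, hA]

/-- The foot `t (j + 1)` is the midpoint of its side. -/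
lemma step_two (h : StarData n w u t) (hA : ∀ j, bil (vec (t j)) (vec (u (j + 1))) = A)
    (j : ZMod n) : bil (vec (u j)) (vec (u (j + 2))) = 2 * A ^ 2 - 1 := by
  have hne : u (j + 1 - 1) ≠ u (j + 1 + 1) := by
    intro e
    have := h.next_pos j
    rw [add_sub_cancel_right, show j + 1 + 1 = j + 2 by ring] at e
    rw [e] at this
    simp at this
  obtain ⟨hs, -, -⟩ := (mem_openSegment_iff hne).2 (h.foot (j + 1))
  change dist _ _ + dist _ _ = dist _ _ at hs
  have e1 : bil (vec (t (j + 1))) (vec (u (j + 1 + 1))) = A := hA _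
  have e2 : bil (vec (t (j + 1))) (vec (u (j + 1 - 1))) = A := by
    have h1 := h.left (j + 1)
    rw [add_sub_cancel_right, bil_comm, h.step_one hA] at h1
    rw [add_sub_cancel_right]
    exact (mul_left_cancel₀ (Real.cosh_pos w).ne' h1).symm
  have hd : dist (u (j + 1 - 1)) (t (j + 1)) = dist (t (j + 1)) (u (j + 1 + 1)) := by
    rw [dist_comm]
    exact dist_eq_of_bil (e2.trans e1.symm)
  rw [hd, ← two_mul] at hs
  rw [add_sub_cancel_right, show j + 1 + 1 = j + 2 by ring] at hs
  rw [show j + 1 + 1 = j + 2 by ring, bil_vec] at e1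
  rw [bil_vec, ← hs, Real.cosh_two_mul, Real.sinh_sq, e1]
  ring

lemma recurrent (h : StarData n w u t) (hA : ∀ j, bil (vec (t j)) (vec (u (j + 1))) = A) :
    Recurrent (Real.cosh w * A) (2 * A ^ 2 - 1) (det (vec (u 0)) (vec (u 1)) (vec (u 2))) u :=
  Recurrent.of_pos (δ := -1) (h.step_one hA) (h.step_two hA) fun j => by
    rw [det_swap]
    have := h.next_pos j
    linarith

/-- If all the butterflies are congruent, the angle `alpha` at their crossings is at least
`Real.pi / n`: a linear functional takes on the differences of consecutive vertices values
proportional to `(-1) ^ m * sin (m * α)`, and the vertices are periodic with the odd period `n`. -/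
lemma pi_le (h : StarData n w u t) (hA : ∀ j, bil (vec (t j)) (vec (u (j + 1))) = A) {q : ℝ}
    (h0 : 0 < q) (h1 : q < w / 2) (hq : Real.cosh (w - q) = A * Real.cosh q) :
    Real.pi ≤ n * alpha w q := by
  have hrec := h.recurrent hA
  have hc1 := hrec.one_lt
  have hsq : 0 < Real.sinh q := Real.sinh_pos_iff.2 h0
  have hsp : 0 < Real.sinh (w - q) := Real.sinh_pos_iff.2 (by linarith)
  have hsw : 0 < Real.sinh w := Real.sinh_pos_iff.2 (by linarith)
  have hcq := Real.cosh_pos q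
  have hcp := Real.cosh_pos (w - q)
  set c := Real.sinh q * Real.cosh (w - q) / (Real.cosh q * Real.sinh (w - q)) with hcdef
  have c0 : 0 < c := by positivity
  have c1 : c < 1 := by
    rw [hcdef, div_lt_one (by positivity)]
    have : 0 < Real.sinh (w - q - q) := Real.sinh_pos_iff.2 (by linarith)
    rw [Real.sinh_sub] at this
    linarith
  have hcos : Real.cos (alpha w q) = c := Real.cos_arccos (by linarith) c1.le
  have ha0 : 0 < alpha w q := Real.arccos_pos.2 c1
  have hapi : alpha w q < Real.pi := by
    have : alpha w q < Real.pi / 2 := Real.arccos_lt_pi_div_two.2 c0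
    linarith [Real.pi_pos]
  have hsin : 0 < Real.sin (alpha w q) := Real.sin_pos_of_pos_of_lt_pi ha0 hapi
  set α := alpha w q with hα
  -- the coefficient of the linear recursion of the vertices
  have hκ : ((2 * A ^ 2 - 1) - Real.cosh w * A) / (Real.cosh w * A - 1) = 1 - 2 * c := by
    have hAe : A = Real.cosh (w - q) / Real.cosh q := by rw [hq]; field_simp
    have e1 := cosh_eq_split w q
    have e2 := sinh_eq_split w q
    have e3 := Real.cosh_sq q
    have e4 := Real.cosh_sq (w - q)
    have e5 : Real.cosh w * A - 1 = Real.sinh (w - q) * Real.sinh w / Real.cosh q := by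
      rw [hAe, e1, e2]
      field_simp
      linear_combination Real.cosh q * e4
    have e6 : Real.cosh w - A = Real.sinh q * Real.sinh w / Real.cosh q := by
      rw [hAe, e1, e2]
      field_simp
      linear_combination Real.cosh (w - q) * e3
    have e7 : ((2 * A ^ 2 - 1) - Real.cosh w * A) =
        (Real.cosh w * A - 1) - 2 * A * (Real.cosh w - A) := by ring
    rw [e7, sub_div, div_self (by linarith), e6, e5, hAe, hcdef]
    field_simp
  set δ := det (vec (u 0)) (vec (u 1)) (vec (u 2)) with hδ
  have hδ0 : δ ≠ 0 := by
    have := h.next_pos 0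
    rw [zero_add, zero_add, det_swap, ← hδ] at this
    linarith
  -- this functional vanishes at the vertices `u 0` and `u 1`
  set x : ℕ → ℝ := fun m => det (vec (u 0)) (vec (u 1)) (vec (u m)) with hx
  have hxrec : ∀ m, x (m + 3) = x m + (1 - 2 * c) * (x (m + 2) - x (m + 1)) := by
    intro m
    have := hrec.succ_eq m
    rw [hκ] at this
    simp only [hx]
    push_cast
    rw [this, det_add_right, det_smul_right, det_sub_right]
  have hx0 : x 0 = 0 := by simp [hx]
  have hx1 : x 1 = 0 := by simp [hx]
  have hx2 : x 2 = δ := by simp [hx, hδ]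
  have key : ∀ m : ℕ, Real.sin α * (x (m + 1) - x m) = (-1) ^ (m + 1) * Real.sin (m * α) * δ ∧
      Real.sin α * (x (m + 2) - x (m + 1)) = (-1) ^ (m + 2) * Real.sin ((m + 1) * α) * δ := by
    intro m
    induction m with
    | zero => simp [hx0, hx1, hx2]
    | succ m ih =>
      obtain ⟨i1, i2⟩ := ih
      refine ⟨by push_cast; exact i2, ?_⟩
      rw [hxrec]
      push_cast
      have s1 : Real.sin ((m + 1 + 1) * α) = 2 * c * Real.sin ((m + 1) * α) - Real.sin (m * α) := by
        rw [← hcos, show ((m : ℝ) + 1 + 1) * α = (m + 1) * α + α by ring,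
          show (m : ℝ) * α = (m + 1) * α - α by ring, Real.sin_add, Real.sin_sub]
        ring
      rw [s1]
      rw [pow_succ] at i1 i2 ⊢
      rw [pow_succ] at i2 ⊢
      rw [pow_succ]
      linear_combination (-2 * c) * i2 - i1
  have hn := (key n).1
  have hxn : x (n + 1) - x n = 0 := by simp [hx]
  rw [hxn, mul_zero] at hn
  have hsn : Real.sin (n * α) = 0 := by
    have : ((-1 : ℝ)) ^ (n + 1) ≠ 0 := by simp
    rcases mul_eq_zero.1 hn.symm with h' | h'
    · exact (mul_eq_zero.1 h').resolve_left this
    · exact absurd h' hδ0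
  by_contra hlt
  have hn0 : 0 < (n : ℝ) := by
    have := h.three_le
    exact_mod_cast (by omega : 0 < n)
  exact (Real.sin_pos_of_pos_of_lt_pi (by positivity) (not_le.1 hlt)).ne' hsn

/-- Among the ordinary reduced polygons of a given thickness, those with congruent butterflies have
the largest area. -/
lemma volume_le (h : StarData n w u t) {u' t' : ZMod n → ℍ} (h' : StarData n w u' t')
    (hA : ∀ j, bil (vec (t' j)) (vec (u' (j + 1))) = A) :
    volume (hull (Set.range u)) ≤ volume (hull (Set.range u')) ∧
      (volume (hull (Set.range u)) = volume (hull (Set.range u')) →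
        Congruent (hull (Set.range u)) (hull (Set.range u'))) := by
  have : NeZero n := ⟨by have := h.three_le; omega⟩
  obtain ⟨q, q0, q1, hq, V, V0, hs⟩ := h.exists_param
  obtain ⟨q', q0', q1', hq', V', V0', -⟩ := h'.exists_param
  have hqq : ∀ j, q' j = q' 0 := fun j =>
    eq_of_cosh_div (A := A) (q0' j) (q1' j) (q0' 0) (q1' 0) (by rw [hq', hA]) (by rw [hq', hA])
  have hpi := h'.pi_le hA (q0' 0) (q1' 0) (by rw [hq', hA])
  obtain ⟨J1, J2⟩ := jensen q0 q1 (q0' 0) (q1' 0) (by rw [ZMod.card]; exact hs.trans hpi)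
  have hsum : ∑ j, phi w (q' j) = n * phi w (q' 0) := by
    rw [Finset.sum_congr rfl fun j _ => by rw [hqq j]]
    simp
  rw [ZMod.card] at J1 J2
  rw [V, V', hsum]
  rw [hsum] at V0'
  refine ⟨ENNReal.ofReal_le_ofReal (by linarith), fun e => ?_⟩
  rw [ENNReal.ofReal_eq_ofReal_iff V0 V0'] at e
  have hqe := J2 (by linarith)
  have hA' : ∀ j, bil (vec (t j)) (vec (u (j + 1))) = A := by
    intro j
    have e1 := hq j
    have e2 := hq' 0
    rw [hqe j, e2, hA] at e1
    exact (mul_right_cancel₀ (Real.cosh_pos _).ne' e1).symm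
  obtain ⟨g, hg⟩ := exists_isometry_of_gram u u' 0 1 2 (by
      have := h.next_pos 0
      rw [zero_add, zero_add, det_swap] at this
      linarith) (fun i j => by
      have := (h.recurrent hA').bil_eq (h'.recurrent hA) (j - i) i i
      rwa [add_sub_cancel] at this)
  refine ⟨g, ?_⟩
  rw [image_hull, ← Set.range_comp]
  congr 2
  exact funext hg

end StarData

/-! ### Distances of supporting lines -/

/-- A point of a geodesic segment on the hyperboloid lies between the chord and the origin. -/
lemma add_le_one_of_comb {x y z : ℍ} {a b : ℝ} (ha : 0 ≤ a) (hb : 0 ≤ b)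
    (e : vec z = a • vec x + b • vec y) : a + b ≤ 1 := by
  have h := bil_vec_self z
  rw [e] at h
  simp only [bil_add_left, bil_add_right, bil_smul_left, bil_smul_right, bil_vec_self,
    bil_comm (vec y) (vec x)] at h
  have := one_le_bil x y
  nlinarith [mul_nonneg ha hb]

/-- If `l` is the normal of a line, this is the region on one side of an equidistant curve, on the side
that contains the line; if `l` is a point of the hyperboloid, it is a disk. -/
lemma isConvex_setOf_bil_le (l : ℝ × ℝ × ℝ) {s : ℝ} (hs : 0 ≤ s) :
    IsConvex {z | bil l (vec z) ≤ s} := by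
  intro x hx y hy z hz
  obtain ⟨a, b, ha, hb, e⟩ := mem_segment_iff.1 hz
  have := add_le_one_of_comb ha hb e
  change bil l (vec x) ≤ s at hx
  change bil l (vec y) ≤ s at hy
  change bil l (vec z) ≤ s
  rw [e, bil_add_right, bil_smul_right, bil_smul_right]
  nlinarith

lemma isConvex_setOf_bil_pos (l : ℝ × ℝ × ℝ) : IsConvex {z | 0 < bil l (vec z)} := by
  intro x hx y hy z hz
  obtain ⟨a, b, ha, hb, e⟩ := mem_segment_iff.1 hz
  change 0 < bil l (vec x) at hx
  change 0 < bil l (vec y) at hy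
  change 0 < bil l (vec z)
  rw [e, bil_add_right, bil_smul_right, bil_smul_right]
  rcases ha.eq_or_lt with h | h
  · rcases hb.eq_or_lt with h' | h'
    · have h1 := vec_fst_pos z
      rw [e, ← h, ← h'] at h1
      simp at h1
    · have := mul_pos h' hy
      positivity
  · have := mul_pos h hx
    positivity

namespace Line

variable {L L' : Line} {x y : ℍ}

lemma distance_le (hx : x ∈ L.carrier) (hy : y ∈ L'.carrier) : L.distance L' ≤ dist x y :=
  csInf_le ⟨0, by rintro _ ⟨x, -, y, -, rfl⟩; exact dist_nonneg⟩ ⟨x, hx, y, hy, rfl⟩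

lemma le_distance {d : ℝ} (hx : x ∈ L.carrier) (hy : y ∈ L'.carrier)
    (h : ∀ x ∈ L.carrier, ∀ y ∈ L'.carrier, d ≤ dist x y) : d ≤ L.distance L' :=
  le_csInf ⟨_, x, hx, y, hy, rfl⟩ (by rintro _ ⟨x, hx, y, hy, rfl⟩; exact h x hx y hy)

lemma distance_nonneg : 0 ≤ L.distance L' :=
  Real.sInf_nonneg (by rintro _ ⟨x, -, y, -, rfl⟩; exact dist_nonneg)

end Line

lemma width_nonneg (K : Set ℍ) (L : Line) : 0 ≤ width K L :=
  Real.sSup_nonneg (by rintro _ ⟨L', -, rfl⟩; exact Line.distance_nonneg)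

/-- A point `y` with `bil l y = sinh d` has at least the distance `d` from the points of the line with
unit normal `l`. -/
lemma sq_le_bil_sq {l : ℝ × ℝ × ℝ} (hl : bil l l = -1) {x y : ℍ} (hx : bil l (vec x) = 0) :
    1 + bil l (vec y) ^ 2 ≤ bil (vec x) (vec y) ^ 2 := by
  have h := det_mul_det (vec x) (vec y) l (vec x) (vec y) l
  simp only [bil_vec_self, hl, bil_comm _ l, hx, bil_comm (vec y) (vec x)] at h
  nlinarith [mul_self_nonneg (det (vec x) (vec y) l)]

/-- The foot of the perpendicular from `z` to the line with unit normal `l` has distance `d` from `z`,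
where `sinh d = bil l z`. -/
lemma exists_dist_le {l : ℝ × ℝ × ℝ} (hl : bil l l = -1) {z : ℍ} {w : ℝ} (hw : 0 ≤ w)
    (h0 : 0 ≤ bil l (vec z)) (h1 : bil l (vec z) ≤ Real.sinh w) :
    ∃ y : ℍ, bil l (vec y) = 0 ∧ dist z y ≤ w := by
  set s := bil l (vec z) with hs
  have hs' : bil (vec z) l = s := bil_comm _ _
  have e1 : bil (vec z + s • l) (vec z + s • l) = 1 + s ^ 2 := by
    simp only [bil_add_left, bil_add_right, bil_smul_left, bil_smul_right, bil_vec_self, hl, ← hs,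
      hs']
    ring
  have e2 : bil (vec z + s • l) (vec z) = 1 + s ^ 2 := by
    simp only [bil_add_left, bil_smul_left, bil_vec_self, ← hs]
    ring
  obtain ⟨y, r, hr, hr2, e⟩ := (Future.of_bil_pos (t := z) (by rw [e1]; positivity)
    (by rw [e2]; positivity) : Future (vec z + s • l)).exists_vec
  rw [e1] at hr2
  refine ⟨y, ?_, ?_⟩
  · have h := congrArg (bil l) e
    simp only [bil_add_right, bil_smul_right, hl, ← hs] at h
    have : r * bil l (vec y) = 0 := by rw [← h]; ring
    exact (mul_eq_zero.1 this).resolve_left hr.ne'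
  · rw [e, bil_smul_left, ← hr2] at e2
    have h3 : bil (vec z) (vec y) = r := by
      rw [bil_comm]
      have : r * bil (vec y) (vec z) = r * r := by rw [e2]; ring
      exact mul_left_cancel₀ hr.ne' this
    have h4 : r ≤ Real.cosh w := by
      have := Real.cosh_sq w
      have := Real.cosh_pos w
      by_contra hlt
      nlinarith
    rw [← h3, bil_vec, Real.cosh_le_cosh, abs_of_nonneg dist_nonneg, abs_of_nonneg hw] at h4
    exact h4

section
variable {ι : Type*} [Finite ι] {u : ι → ℍ}

/-- Polygons are bounded. -/
lemma exists_forall_dist_le [Nonempty ι] (u : ι → ℍ) :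
    ∃ M, ∀ x ∈ hull (Set.range u), ∀ y ∈ hull (Set.range u), dist x y ≤ M := by
  obtain ⟨i⟩ := ‹Nonempty ι›
  obtain ⟨j, hj⟩ := Finite.exists_max fun j => bil (vec (u i)) (vec (u j))
  set m := bil (vec (u i)) (vec (u j)) with hm
  have h : hull (Set.range u) ⊆ {z | bil (vec (u i)) (vec z) ≤ m} :=
    hull_subset (isConvex_setOf_bil_le _ (zero_le_one.trans (one_le_bil _ _)))
      (by rintro _ ⟨k, rfl⟩; exact hj k)
  have h' : ∀ x ∈ hull (Set.range u), dist (u i) x ≤ m := fun x hx => by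
    have h1 : bil (vec (u i)) (vec x) ≤ m := h hx
    rw [bil_vec] at h1
    have := Real.self_le_sinh_iff.2 (dist_nonneg (x := u i) (y := x))
    have := Real.sinh_lt_cosh (dist (u i) x)
    linarith
  refine ⟨m + m, fun x hx y hy => (dist_triangle_left x y (u i)).trans ?_⟩
  exact add_le_add (h' x hx) (h' y hy)

lemma bddAbove_width [Nonempty ι] {L : Line} (hL : L.Supports (hull (Set.range u))) :
    BddAbove {d | ∃ L' : Line, L'.Supports (hull (Set.range u)) ∧ d = L.distance L'} := by
  obtain ⟨M, hM⟩ := exists_forall_dist_le u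
  obtain ⟨⟨x, hx, hxL⟩, -⟩ := hL
  refine ⟨M, ?_⟩
  rintro _ ⟨L', ⟨⟨y, hy, hyL⟩, -⟩, rfl⟩
  exact (Line.distance_le hxL hyL).trans (hM x hx y hy)

/-- If some vertex is at distance at least `w` from the supporting line `L`, then so is the
supporting line perpendicular to the segment from the farthest vertex to `L`. -/
lemma le_width [Nonempty ι] {L : Line} (hL : L.Supports (hull (Set.range u))) {l : ℝ × ℝ × ℝ}
    (hl : bil l l = -1) (hLl : ∀ z, z ∈ L.carrier → bil l (vec z) = 0) {w : ℝ} (hw : 0 < w) {i : ι}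
    (hi : Real.sinh w ≤ bil l (vec (u i))) : w ≤ width (hull (Set.range u)) L := by
  obtain ⟨j, hj⟩ := Finite.exists_max fun j => bil l (vec (u j))
  set s := bil l (vec (u j)) with hs
  have hsw : Real.sinh w ≤ s := hi.trans (hj i)
  have hw' := Real.sinh_pos_iff.2 hw
  have hs0 : 0 < s := by linarith
  have hs' : bil (vec (u j)) l = s := bil_comm _ _
  have hneg : bil (l - s • vec (u j)) (l - s • vec (u j)) < 0 := by
    simp only [bil_sub_left, bil_sub_right, bil_smul_left, bil_smul_right, bil_vec_self, hl, ← hs,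
      hs']
    nlinarith
  -- the line through the farthest vertex `u j` with the normal `l - s • vec (u j)`
  have hfn : ∀ z, (Line.ofNormal _ hneg).fn (vec z) =
      bil l (vec z) - s * bil (vec (u j)) (vec z) := fun z => by
    rw [Line.fn_ofNormal, bil_sub_left, bil_smul_left]
  have hmem : u j ∈ (Line.ofNormal _ hneg).carrier := by
    rw [Line.mem_carrier, hfn, bil_vec_self, ← hs]; ring
  have hsup : (Line.ofNormal _ hneg).Supports (hull (Set.range u)) := by
    refine ⟨⟨u j, subset_hull _ ⟨j, rfl⟩, hmem⟩, Or.inr fun z hz => ?_⟩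
    rw [Line.mem_negSide, hfn]
    have h1 : bil l (vec z) ≤ s := hull_subset (isConvex_setOf_bil_le l hs0.le)
      (by rintro _ ⟨k, rfl⟩; exact hj k) hz
    have h2 := one_le_bil (u j) z
    nlinarith
  obtain ⟨⟨x, -, hx⟩, -⟩ := id hL
  refine le_trans (Line.le_distance hx hmem fun x hx y hy => ?_)
    (le_csSup (bddAbove_width hL) ⟨_, hsup, rfl⟩)
  rw [Line.mem_carrier, hfn] at hy
  have h1 := sq_le_bil_sq hl (y := y) (hLl x hx)
  have h2 := one_le_bil (u j) y
  have h3 := one_le_bil x y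
  have h4 : Real.sinh w ≤ bil l (vec y) := by nlinarith
  have h5 : Real.cosh w ≤ bil (vec x) (vec y) := by
    have := Real.cosh_sq w
    by_contra hlt
    have := Real.cosh_pos w
    nlinarith
  rw [bil_vec, Real.cosh_le_cosh, abs_of_pos hw, abs_of_nonneg dist_nonneg] at h5
  exact h5

end

/-! ### The thickness of a regular polygon -/

/-- In the plane of unit normals of lines through the point `p`, a normal `l` between `l₀` and `l₁`
is a combination of them with coefficients of sum at least one, so that it takes a large value
where both `l₀` and `l₁` do. -/
lemma le_bil_of_between {p : ℍ} {l l₀ l₁ U V W : ℝ × ℝ × ℝ} {s : ℝ} (hs : 0 < s)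
    (h : bil l l = -1) (h₀ : bil l₀ l₀ = -1) (h₁ : bil l₁ l₁ = -1)
    (hp : bil (vec p) l = 0) (hp₀ : bil (vec p) l₀ = 0) (hp₁ : bil (vec p) l₁ = 0)
    (hV : 0 ≤ bil V l) (hV₀ : 0 < bil V l₀) (hV₁ : bil V l₁ = 0)
    (hU₀ : s ≤ bil U l₀) (hU₁ : bil U l₁ = s) (hW₀ : bil W l₀ = bil U l₀) (hW₁ : bil W l₁ < s)
    (hW : bil W l ≤ bil U l) (hdet : det (vec p) V U ≠ 0) : s ≤ bil U l := by
  set x := bil V l / bil V l₀ with hx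
  set y := (bil U l - x * bil U l₀) / s with hy
  have e : l = x • l₀ + y • l₁ := by
    refine eq_of_bil_eq hdet ?_ ?_ ?_
    · rw [bil_add_right, bil_smul_right, bil_smul_right, hp, hp₀, hp₁]; ring
    · rw [bil_add_right, bil_smul_right, bil_smul_right, hV₁, hx]; field_simp; ring
    · rw [bil_add_right, bil_smul_right, bil_smul_right, hU₁, hy]; field_simp; ring
  have eU : bil U l = x * bil U l₀ + y * s := by
    rw [e, bil_add_right, bil_smul_right, bil_smul_right, hU₁]
  have eW : bil W l = x * bil U l₀ + y * bil W l₁ := by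
    rw [e, bil_add_right, bil_smul_right, bil_smul_right, hW₀]
  have hx0 : 0 ≤ x := div_nonneg hV hV₀.le
  have hy0 : 0 ≤ y := by
    by_contra hneg
    rw [eU, eW] at hW
    nlinarith
  -- the Cauchy–Schwarz inequality in the negative definite plane orthogonal to `p`
  have hb : bil l₀ l₁ ^ 2 ≤ 1 := by
    have hd := det_mul_det (vec p) l₀ l₁ (vec p) l₀ l₁
    simp only [bil_vec_self, h₀, h₁, hp₀, hp₁, bil_comm _ (vec p), bil_comm l₁ l₀] at hd
    nlinarith [mul_self_nonneg (det (vec p) l₀ l₁)]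
  have hb' : -1 ≤ bil l₀ l₁ := by nlinarith
  have hxy : 1 ≤ x + y := by
    rw [e] at h
    simp only [bil_add_left, bil_add_right, bil_smul_left, bil_smul_right, h₀, h₁,
      bil_comm l₁ l₀] at h
    nlinarith [mul_nonneg hx0 hy0]
  rw [eU]
  nlinarith

/-- The unit normal of the side opposite to the vertex `u j`, pointing to `u j`. -/
noncomputable def sideNormal {n : ℕ} (w : ℝ) (u t : ZMod n → ℍ) (j : ZMod n) : ℝ × ℝ × ℝ :=
  (Real.sinh w)⁻¹ • (Real.cosh w • vec (t j) - vec (u j))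

/-- The unit normal of the line through the vertex `u j` that is perpendicular to the segment
`[u j, t j]`, pointing to `t j`. -/
noncomputable def tipNormal {n : ℕ} (w : ℝ) (u t : ZMod n → ℍ) (j : ZMod n) : ℝ × ℝ × ℝ :=
  (Real.sinh w)⁻¹ • (Real.cosh w • vec (u j) - vec (t j))

namespace StarData

variable {n : ℕ} {w A : ℝ} {u t : ZMod n → ℍ}

/-- The products of the normal of a side with the opposite vertex and with the end points. -/
lemma bil_sideNormal (h : StarData n w u t) (j : ZMod n) :
    bil (sideNormal w u t j) (sideNormal w u t j) = -1 ∧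
    bil (vec (u j)) (sideNormal w u t j) = Real.sinh w ∧
    bil (vec (u (j + 1))) (sideNormal w u t j) = 0 ∧
    bil (vec (u (j - 1))) (sideNormal w u t j) = 0 := by
  have hs := Real.sinh_pos_iff.2 h.w_pos
  have hc := Real.cosh_sq w
  have e1 := h.bil_foot j
  have e2 : bil (vec (t j)) (vec (u j)) = Real.cosh w := by rw [bil_comm, e1]
  refine ⟨?_, ?_, ?_, ?_⟩ <;> unfold sideNormal <;>
    simp only [bil_sub_left, bil_sub_right, bil_smul_left, bil_smul_right, bil_vec_self, e1, e2]
  · field_simp; linear_combination -hc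
  · field_simp; linear_combination hc
  · rw [bil_comm _ (vec (t j)), bil_comm _ (vec (u j)), h.right]; ring
  · rw [bil_comm _ (vec (t j)), bil_comm _ (vec (u j)), h.left]; ring

lemma one_lt (h : StarData n w u t) (hA : ∀ j, bil (vec (t j)) (vec (u (j + 1))) = A) :
    1 < A := by
  have hne : u (0 - 1) ≠ u (0 + 1) := by
    intro e
    have := h.mid_pos 0
    rw [e] at this
    simp at this
  rw [← hA 0]
  exact one_lt_bil ((mem_openSegment_iff hne).2 (h.foot 0)).2.2

lemma lt_cosh (h : StarData n w u t) (hA : ∀ j, bil (vec (t j)) (vec (u (j + 1))) = A) :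
    A < Real.cosh w := by
  have : NeZero n := ⟨by have := h.three_le; omega⟩
  obtain ⟨q, q0, q1, hq, -⟩ := h.exists_param
  have e := hq 0
  rw [hA] at e
  have h1 : Real.cosh (w - q 0) < Real.cosh w := by
    rw [Real.cosh_lt_cosh, abs_of_pos (by linarith [q0 0, q1 0]), abs_of_pos h.w_pos]
    linarith [q0 0]
  have := Real.one_le_cosh (q 0)
  have := h.one_lt hA
  nlinarith

lemma bil_foot_left (h : StarData n w u t) (hA : ∀ j, bil (vec (t j)) (vec (u (j + 1))) = A)
    (j : ZMod n) : bil (vec (t j)) (vec (u (j - 1))) = A := by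
  have h1 := h.left j
  have h2 := h.step_one hA (j - 1)
  rw [sub_add_cancel, bil_comm, h1] at h2
  exact mul_left_cancel₀ (Real.cosh_pos w).ne' h2

/-- The linear recursion of the vertices, with bounds for its coefficient. -/
lemma exists_succ_eq (h : StarData n w u t) (hA : ∀ j, bil (vec (t j)) (vec (u (j + 1))) = A) :
    ∃ κ, κ * (Real.cosh w * A - 1) = 2 * A ^ 2 - 1 - Real.cosh w * A ∧
    -1 < κ ∧ κ < 3 ∧
    ∀ j, vec (u (j + 3)) = vec (u j) + κ • (vec (u (j + 2)) - vec (u (j + 1))) := by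
  have hr := h.recurrent hA
  have h1 := h.one_lt hA
  have h2 := h.lt_cosh hA
  have h3 := hr.one_lt
  refine ⟨_, div_mul_cancel₀ _ (by linarith), ?_, ?_, hr.succ_eq⟩
  · rw [lt_div_iff₀ (by linarith)]; nlinarith
  · rw [div_lt_iff₀ (by linarith)]; nlinarith

/-- The vertex `u j` is farthest from its opposite side: by the recursion of the vertices, the values
of the normal are proportional to `cos α + (-1) ^ m * cos (m * α)`. -/
lemma bil_sideNormal_le (h : StarData n w u t) (hA : ∀ j, bil (vec (t j)) (vec (u (j + 1))) = A)
    (j i : ZMod n) :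
    bil (vec (u i)) (sideNormal w u t j) ≤ Real.sinh w := by
  have : NeZero n := ⟨by have := h.three_le; omega⟩
  obtain ⟨κ, -, hκ1, hκ2, hrec⟩ := h.exists_succ_eq hA
  obtain ⟨-, n0, n1, n2⟩ := h.bil_sideNormal j
  have hs := Real.sinh_pos_iff.2 h.w_pos
  set S := Real.sinh w
  set l := sideNormal w u t j
  set α := Real.arccos ((1 - κ) / 2)
  have hc : Real.cos α = (1 - κ) / 2 := Real.cos_arccos (by linarith) (by linarith)
  set c := Real.cos α
  have hκ : κ = 1 - 2 * c := by rw [hc]; ring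
  have key : ∀ m : ℕ,
      (1 + c) * bil (vec (u (j + m))) l = S * (c + (-1) ^ m * Real.cos (m * α)) ∧
      (1 + c) * bil (vec (u (j + m + 1))) l = S * (c + (-1) ^ (m + 1) * Real.cos ((m + 1) * α)) ∧
      (1 + c) * bil (vec (u (j + m + 2))) l =
        S * (c + (-1) ^ (m + 2) * Real.cos ((m + 2) * α)) := by
    intro m
    induction m with
    | zero =>
      refine ⟨?_, ?_, ?_⟩
      · simp [n0]; ring
      · simp [n1, c]
      · have e := hrec (j - 1)
        rw [show j - 1 + 3 = j + 2 by ring, show j - 1 + 2 = j + 1 by ring, sub_add_cancel] at e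
        simp only [Nat.cast_zero, add_zero, zero_add]
        rw [e, bil_add_left, bil_smul_left, bil_sub_left, n0, n1, n2, hκ, Real.cos_two_mul]
        ring
    | succ m ih =>
      obtain ⟨i1, i2, i3⟩ := ih
      refine ⟨?_, ?_, ?_⟩
      · push_cast; rw [← add_assoc]; exact i2
      · push_cast
        rw [show j + ((m : ZMod n) + 1) + 1 = j + m + 2 by ring,
          show (m : ℝ) + 1 + 1 = m + 2 by ring]
        exact i3
      · push_cast
        have e := hrec (j + m)
        rw [show j + ((m : ZMod n) + 1) + 2 = j + m + 3 by ring, e, bil_add_left, bil_smul_left,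
          bil_sub_left]
        have s1 : Real.cos ((m + 1 + 2) * α) =
            2 * c * Real.cos ((m + 2) * α) - Real.cos ((m + 1) * α) := by
          rw [show ((m : ℝ) + 1 + 2) * α = (m + 2) * α + α by ring,
            show ((m : ℝ) + 1) * α = (m + 2) * α - α by ring, Real.cos_add, Real.cos_sub]
          ring
        have s2 : Real.cos (m * α) = 2 * c * Real.cos ((m + 1) * α) - Real.cos ((m + 2) * α) := by
          rw [show (m : ℝ) * α = (m + 1) * α - α by ring,
            show ((m : ℝ) + 2) * α = (m + 1) * α + α by ring, Real.cos_add, Real.cos_sub]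
          ring
        rw [s1, hκ]
        rw [s2] at i1
        rw [show ((-1 : ℝ)) ^ (m + 1 + 2) = -(-1) ^ m by ring]
        rw [show ((-1 : ℝ)) ^ (m + 1) = -(-1) ^ m by ring] at i2
        rw [show ((-1 : ℝ)) ^ (m + 2) = (-1) ^ m by ring] at i3
        linear_combination i1 + (1 - 2 * c) * (i3 - i2)
  have h1 := (key (i - j).val).1
  rw [ZMod.natCast_zmod_val, add_sub_cancel] at h1
  have hc1 : 0 < 1 + c := by rw [hc]; linarith
  have h2 : (-1 : ℝ) ^ (i - j).val * Real.cos ((i - j).val * α) ≤ 1 := by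
    refine (le_abs_self _).trans ?_
    rw [abs_mul, abs_pow, abs_neg, abs_one, one_pow, one_mul]
    exact Real.abs_cos_le_one _
  have h3 : (1 + c) * bil (vec (u i)) l ≤ (1 + c) * S := by
    rw [h1]; nlinarith
  exact le_of_mul_le_mul_left h3 hc1

lemma bil_tipNormal (h : StarData n w u t) (hA : ∀ j, bil (vec (t j)) (vec (u (j + 1))) = A)
    (j : ZMod n) :
    bil (tipNormal w u t j) (tipNormal w u t j) = -1 ∧
    bil (vec (u j)) (tipNormal w u t j) = 0 ∧
    bil (vec (u (j + 1))) (tipNormal w u t j) = A * Real.sinh w ∧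
    bil (vec (u (j - 1))) (tipNormal w u t j) = A * Real.sinh w ∧
    0 < bil (vec (u (j + 2))) (tipNormal w u t j) ∧
    0 < bil (vec (u (j - 2))) (tipNormal w u t j) := by
  have hs := Real.sinh_pos_iff.2 h.w_pos
  have hc := Real.cosh_sq w
  have e1 := h.bil_foot j
  have e2 : bil (vec (t j)) (vec (u j)) = Real.cosh w := by rw [bil_comm, e1]
  have f1 : bil (vec (u (j + 1))) (vec (u j)) = Real.cosh w * A := by
    rw [bil_comm, h.step_one hA]
  have f2 : bil (vec (u (j - 1))) (vec (u j)) = Real.cosh w * A := by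
    have := h.step_one hA (j - 1)
    rwa [sub_add_cancel] at this
  have f3 : bil (vec (u (j + 1))) (vec (t j)) = A := by rw [bil_comm, hA]
  have f4 : bil (vec (u (j - 1))) (vec (t j)) = A := by rw [bil_comm, h.bil_foot_left hA]
  have f5 : bil (vec (u (j + 2))) (vec (u j)) = 2 * A ^ 2 - 1 := by
    rw [bil_comm, h.step_two hA]
  have f6 : bil (vec (u (j - 2))) (vec (u j)) = 2 * A ^ 2 - 1 := by
    have := h.step_two hA (j - 2)
    rwa [sub_add_cancel] at this
  obtain ⟨κ, hκ, -, -, hrec⟩ := h.exists_succ_eq hA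
  have g1 : bil (vec (u (j + 2))) (vec (t j)) = A + κ * (A - Real.cosh w) := by
    have e := hrec (j - 1)
    rw [show j - 1 + 3 = j + 2 by ring, show j - 1 + 2 = j + 1 by ring, sub_add_cancel] at e
    rw [e, bil_add_left, bil_smul_left, bil_sub_left, f3, f4, e1]
  have g2 : bil (vec (u (j - 2))) (vec (t j)) = A + κ * (A - Real.cosh w) := by
    have e := congrArg (fun X => bil X (vec (t j))) (hrec (j - 2))
    rw [show j - 2 + 3 = j + 1 by ring, show j - 2 + 1 = j - 1 by ring, sub_add_cancel] at e
    simp only [bil_add_left, bil_smul_left, bil_sub_left, f3, f4, e1] at e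
    linarith
  have h1 := h.one_lt hA
  have h2 := h.lt_cosh hA
  have h3 := (h.recurrent hA).one_lt
  have pos : 0 < Real.cosh w * (2 * A ^ 2 - 1) - (A + κ * (A - Real.cosh w)) := by
    have e : (Real.cosh w * (2 * A ^ 2 - 1) - (A + κ * (A - Real.cosh w))) *
        (Real.cosh w * A - 1) =
        2 * A * (Real.cosh w ^ 2 - 1) * (A ^ 2 - 1) := by
      linear_combination (Real.cosh w - A) * hκ
    have hc1 : 0 < Real.cosh w ^ 2 - 1 := by nlinarith
    have hA1 : 0 < A ^ 2 - 1 := by nlinarith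
    have hA0 : 0 < A := by linarith
    have : 0 < 2 * A * (Real.cosh w ^ 2 - 1) * (A ^ 2 - 1) := by positivity
    rw [← e] at this
    exact pos_of_mul_pos_left this (by linarith)
  refine ⟨?_, ?_, ?_, ?_, ?_, ?_⟩ <;> unfold tipNormal <;>
    simp only [bil_sub_left, bil_sub_right, bil_smul_left, bil_smul_right, bil_vec_self, e1, e2,
      f1, f2, f3, f4, f5, f6, g1, g2]
  · field_simp; linear_combination -hc
  · ring
  · field_simp; linear_combination hc
  · field_simp; linear_combination hc
  · positivity
  · positivity

/-- Any supporting line through the vertex `u j` is far from one of the vertices `u (j + 1)` and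
`u (j - 1)`. -/
lemma exists_le_bil (h : StarData n w u t) (hA : ∀ j, bil (vec (t j)) (vec (u (j + 1))) = A)
    {l : ℝ × ℝ × ℝ} (hl : bil l l = -1) (hpos : ∀ i, 0 ≤ bil (vec (u i)) l)
    {j : ZMod n} (hj : bil (vec (u j)) l = 0) : ∃ i, Real.sinh w ≤ bil (vec (u i)) l := by
  have hs := Real.sinh_pos_iff.2 h.w_pos
  have hA1 := h.one_lt hA
  obtain ⟨κ, -, hκ, -, hrec⟩ := h.exists_succ_eq hA
  -- the line lies in the angle between `tipNormal` and the normal of one of the sides at `u j`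
  obtain ⟨t1, t2, t3, t4, t5, t6⟩ := h.bil_tipNormal hA j
  have hAs : Real.sinh w ≤ A * Real.sinh w := by nlinarith
  rcases le_total (bil (vec (u (j - 1))) l) (bil (vec (u (j + 1))) l) with hle | hle
  · obtain ⟨s1, s2, s3, s4⟩ := h.bil_sideNormal (j + 1)
    rw [add_sub_cancel_right] at s4
    have e3 : vec (u (j + 1 + 1)) = vec (u (j + 2)) := by rw [show j + 1 + 1 = j + 2 by ring]
    rw [e3] at s3
    refine ⟨j + 1, le_bil_of_between hs hl t1 s1 hj t2 s4 (hpos _) t5 s3 (by rw [t3]; exact hAs) s2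
      (by rw [t4, t3]) ?_ hle (h.next_pos j).ne'⟩
    have e := congrArg (fun X => bil X (sideNormal w u t (j + 1))) (hrec (j - 1))
    rw [show j - 1 + 3 = j + 2 by ring, show j - 1 + 2 = j + 1 by ring, sub_add_cancel] at e
    simp only [bil_add_left, bil_smul_left, bil_sub_left, s2, s3, s4] at e
    nlinarith
  · obtain ⟨s1, s2, s3, s4⟩ := h.bil_sideNormal (j - 1)
    rw [sub_add_cancel] at s3
    have e4 : vec (u (j - 1 - 1)) = vec (u (j - 2)) := by rw [show j - 1 - 1 = j - 2 by ring]
    rw [e4] at s4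
    refine ⟨j - 1, le_bil_of_between hs hl t1 s1 hj t2 s3 (hpos _) t6 s4 (by rw [t4]; exact hAs) s2
      (by rw [t4, t3]) ?_ hle ?_⟩
    · have e := congrArg (fun X => bil X (sideNormal w u t (j - 1))) (hrec (j - 2))
      rw [show j - 2 + 3 = j + 1 by ring, show j - 2 + 1 = j - 1 by ring, sub_add_cancel] at e
      simp only [bil_add_left, bil_smul_left, bil_sub_left, s2, s3, s4] at e
      nlinarith
    · have := h.next_pos (j - 2)
      rw [sub_add_cancel, show j - 2 + 1 = j - 1 by ring, det_swap'] at this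
      linarith

/-- A star with congruent butterflies has thickness `w`: this is the width with respect to a side, and
any other width is at least `w`. -/
lemma thickness_eq (h : StarData n w u t) (hA : ∀ j, bil (vec (t j)) (vec (u (j + 1))) = A) :
    thickness (hull (Set.range u)) = w := by
  have : NeZero n := ⟨by have := h.three_le; omega⟩
  have hs := Real.sinh_pos_iff.2 h.w_pos
  have hmem : ∀ j, u j ∈ hull (Set.range u) := fun j => subset_hull _ ⟨j, rfl⟩
  obtain ⟨s1, s2, s3, s4⟩ := h.bil_sideNormal 0
  set l := sideNormal w u t 0
  -- the side opposite to `u 0`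
  have hL0 : (Line.ofNormal l (by linarith)).Supports (hull (Set.range u)) := by
    refine ⟨⟨u (0 + 1), hmem _, ?_⟩, Or.inl fun z hz => ?_⟩
    · rw [Line.mem_carrier, Line.fn_ofNormal, bil_comm, s3]
    · rw [Line.mem_posSide, Line.fn_ofNormal]
      have hne : u (0 - 1) ≠ u (0 - 1 + 2) := by
        intro e
        have := h.next_pos (0 - 1)
        rw [← e] at this
        simp at this
      have hd := h.det_nonneg_of_mem hz (0 - 1)
      have hd0 := h.next_pos (0 - 1)
      obtain ⟨k, hk, hfn⟩ := (Line.ofNormal l (by linarith)).exists_fn_eq hne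
        (by rw [Line.mem_carrier, Line.fn_ofNormal, bil_comm, s4])
        (by rw [Line.mem_carrier, Line.fn_ofNormal, bil_comm,
              show (0 : ZMod n) - 1 + 2 = 0 + 1 by ring, s3])
      have h0 := hfn (vec (u 0))
      rw [Line.fn_ofNormal, bil_comm, s2] at h0
      rw [sub_add_cancel] at hd0
      have hk0 : 0 < k := by
        by_contra hneg
        nlinarith
      rw [← Line.fn_ofNormal l (by linarith), hfn]
      positivity
  apply le_antisymm
  · have hne : {d | ∃ L' : Line, L'.Supports (hull (Set.range u)) ∧
        d = (Line.ofNormal l (by linarith)).distance L'}.Nonempty := ⟨_, _, hL0, rfl⟩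
    have hbdd : BddBelow {d | ∃ L : Line, L.Supports (hull (Set.range u)) ∧
        d = width (hull (Set.range u)) L} :=
      ⟨0, by rintro _ ⟨L, -, rfl⟩; exact width_nonneg _ _⟩
    refine (csInf_le hbdd ⟨_, hL0, rfl⟩).trans (csSup_le hne ?_)
    · rintro _ ⟨L', ⟨⟨z, hz, hzL⟩, -⟩, rfl⟩
      have h1 : bil l (vec z) ≤ Real.sinh w := hull_subset (isConvex_setOf_bil_le l hs.le)
        (by
          rintro _ ⟨k, rfl⟩
          change bil l (vec (u k)) ≤ _
          rw [bil_comm]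
          exact h.bil_sideNormal_le hA 0 k) hz
      have h0 : 0 ≤ bil l (vec z) := by
        obtain ⟨⟨x, -, hx⟩, hside⟩ := hL0
        have hu : 0 < bil l (vec (u 0)) := by rw [bil_comm, s2]; exact hs
        rcases hside with hside | hside
        · have := hside hz
          rwa [Line.mem_posSide, Line.fn_ofNormal] at this
        · have := hside (hmem 0)
          rw [Line.mem_negSide, Line.fn_ofNormal] at this
          linarith
      obtain ⟨y, hy, hd⟩ := exists_dist_le s1 h.w_pos.le h0 h1
      refine le_trans (Line.distance_le (x := y) (y := z) ?_ hzL) (by rwa [dist_comm])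
      rw [Line.mem_carrier, Line.fn_ofNormal, hy]
  · refine le_csInf ⟨_, _, hL0, rfl⟩ ?_
    rintro _ ⟨L, hL, rfl⟩
    obtain ⟨l, r, hr, hl, hfn⟩ := L.exists_normal
    have hl' : ∃ l, bil l l = -1 ∧ (∀ z, z ∈ L.carrier → bil l (vec z) = 0) ∧
        ∀ z ∈ hull (Set.range u), 0 ≤ bil l (vec z) := by
      have hc : ∀ z, z ∈ L.carrier → bil l (vec z) = 0 := fun z hz => by
        rw [Line.mem_carrier, hfn] at hz
        exact (mul_eq_zero.1 hz).resolve_left hr.ne'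
      rcases hL.2 with hside | hside
      · refine ⟨l, hl, hc, fun z hz => ?_⟩
        have := hside hz
        rw [Line.mem_posSide, hfn] at this
        exact nonneg_of_mul_nonneg_right this hr
      · refine ⟨(-1 : ℝ) • l, by rw [bil_smul_left, bil_smul_right, hl]; ring,
          fun z hz => by rw [bil_smul_left, hc z hz]; ring, fun z hz => ?_⟩
        have := hside hz
        rw [Line.mem_negSide, hfn] at this
        rw [bil_smul_left]
        by_contra hneg
        nlinarith
    obtain ⟨l, hl, hc, hside⟩ := hl'
    -- a supporting line contains a vertex
    have hv : ∃ j, bil (vec (u j)) l = 0 := by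
      by_contra hcon
      push Not at hcon
      obtain ⟨⟨z, hz, hzL⟩, -⟩ := hL
      have : 0 < bil l (vec z) := hull_subset (isConvex_setOf_bil_pos l) (by
        rintro _ ⟨j, rfl⟩
        refine lt_of_le_of_ne (hside _ (hmem j)) fun e => hcon j ?_
        rw [bil_comm, ← e]) hz
      exact this.ne' (hc z hzL)
    obtain ⟨j, hj⟩ := hv
    obtain ⟨i, hi⟩ := h.exists_le_bil hA hl
      (fun i => by rw [bil_comm]; exact hside _ (hmem i)) hj
    rw [bil_comm] at hi
    exact le_width hL hl hc h.w_pos hi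

end StarData

end HypPlane

/-! ### Comparison with a regular polygon -/

theorem mainTheorem1 (n : ℕ) (w : ℝ) (R R' : Set ℍ)
    (hR : HypPlane.IsOrdinaryReduced n w R)
    (hR' : HypPlane.IsRegular n R') (hw' : HypPlane.thickness R' = w) :
    HypPlane.IsOrdinaryReduced n w R' ∧
    HypPlane.area R ≤ HypPlane.area R' ∧
    (HypPlane.area R = HypPlane.area R' ↔ HypPlane.Congruent R R') := by
  open HypPlane in
  obtain ⟨v, hv⟩ := hR.exists_reduced
  obtain ⟨u, t, hu, rfl, -⟩ := hv.exists_star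
  obtain ⟨v', t', w', hng, hcirc, hs⟩ := hR'.exists_starData hR.1
  set u' : ZMod n → ℍ := fun j => v' (((n + 1) / 2 : ℕ) * j) with hu'
  -- the distances `A` of the feet from the adjacent vertices are constant for a regular polygon
  have hconst : ∀ {u t : ZMod n → ℍ} (_ : StarData n w' u t)
      (_ : ∃ e, ∀ i j, bil (vec (u i)) (vec (u j)) = bil (vec (v' (e * i))) (vec (v' (e * j))))
      (j : ZMod n),
      bil (vec (t j)) (vec (u (j + 1))) = bil (vec (t 0)) (vec (u (0 + 1))) := by
    rintro u t h ⟨e, he⟩ j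
    refine mul_left_cancel₀ (Real.cosh_pos w').ne' ?_
    rw [← h.right, ← h.right, he, he, mul_add, mul_add]
    exact hcirc _ _ _
  have hA' := hconst hs ⟨_, fun i j => rfl⟩
  have hR'eq : R' = hull (Set.range u') := by
    have := (hs.reduced hng).range_star
    rw [hu', this]
    exact hng.eq_hull
  have hww : w' = w := by rw [← hw', hR'eq, hs.thickness_eq hA']
  subst hww
  have hred := hs.reduced hng
  obtain ⟨hle, heq⟩ := hu.volume_le hs hA'
  rw [← hR'eq] at hle heq
  refine ⟨hred.isOrdinaryReduced hw', hle, heq, ?_⟩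
  rintro ⟨g, hg⟩
  -- the inverse isometry makes the other polygon regular, too
  refine le_antisymm hle ?_
  have himg : g.symm '' R' = hull (Set.range u) := by
    rw [← hg, ← Set.image_comp]
    simp
  have hred2 := hred.image g.symm
  rw [himg] at hred2
  obtain ⟨u₂, t₂, h₂, e₂, e, he⟩ := hred2.exists_star
  have := (hs.volume_le h₂ (hconst h₂ ⟨e, fun i j => by rw [he, he, bil_isometry]⟩)).1
  rw [← hR'eq, ← e₂] at this
  exact this
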